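/- The vertex-centred Kreweras lattice has as vertices the points $a+b\omega$ ($a,b\in\mathbb{Z}$, $\omega=e^{2\pi i/3}$) of the plane, with an edge from each vertex $v$ to each of $v+1$, $v+\omega$, $v+\omega^2$. Let $w_0,w_1,w_2$ be the three vertices from which there is an edge pointing to $0$. The winding angle of a walk that avoids $0$ is the total anticlockwise angle swept around $0$ by a point moving continuously along the walk. For $k\ge 0$ let \[T_{k}(u,q)=\sum_{n=0}^{\infty}(-1)^{n}(2n+1)^k q^{n(n+1)/2}\left(u^{n+1}-(-1)^k u^{-n}\right).\] There is a unique formal power series $q\equiv q(t)\in\mathbb{Q}[[t]]$ with constant term $0$ that has a cube root $q^{1/3}\in\mathbb{Q}[[t]]$ with \[t=q^{1/3}\frac{T_{1}(1,q^3)}{4T_{0}(q,q^3)+6T_{1}(q,q^3)},\] and $q=t^3+15t^6+279t^9+O(t^{12})$. Let $\tilde{E}(t,s)$ be the generating function of walks along the edges of the lattice that start at $w_0$, end at one of $w_0,w_1,w_2$ and do not pass through $0$, in which each walk of length $n$ and winding angle $\frac{2\pi k}{3}$ contributes $t^n s^k$. Then, as formal Laurent series in $t$ over $\mathbb{Q}(s)$,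 \[\tilde{E}(t,s)=\frac{s q^{-2/3}}{t(1+s+s^2)}\frac{T_{0}(q,q^3)^2}{T_{1}(1,q^3)^2}\left(\frac{T_{1}(q,q^{3})^2}{T_{0}(q,q^{3})^2}-\frac{T_{2}(q,q^{3})}{T_{0}(q,q^{3})}-\frac{T_{2}(s,q)}{2T_{0}(s,q)}+\frac{T_{3}(1,q)}{6T_{1}(1,q)}+\frac{T_{3}(1,q^3)}{3T_{1}(1,q^3)}\right).\] -/

import Mathlib

open scoped PowerSeries LaurentSeries

noncomputable section

namespace Kreweras

/-! The vertex-centred Kreweras lattice: the vertices are the points `a + b ω` of the plane, with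
`ω = exp (2 π i / 3)` and integers `a`, `b`, and an edge leads from each vertex `v` to `v + 1`,
`v + ω` and `v + ω ^ 2`. A vertex is represented by its coordinates `(a, b)`. -/

/-- The position in the plane of the vertex with coordinates `(a, b)`. -/
def pos (v : ℤ × ℤ) : ℂ :=
  (v.1 : ℂ) + (v.2 : ℂ) * Complex.exp (2 * Real.pi * Complex.I / 3)

/-- There is an edge from `v` to `w`. Here `(1, 0)`, `(0, 1)`, `(-1, -1)` are the coordinates of
`1`, `ω` and `ω ^ 2 = -1 - ω`. -/
def Edge (v w : ℤ × ℤ) : Prop :=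
  w - v = (1, 0) ∨ w - v = (0, 1) ∨ w - v = (-1, -1)

/-- `γ 0, …, γ n` is a walk of length `n` along the edges that avoids the origin. -/
def IsWalk {n : ℕ} (γ : Fin (n + 1) → ℤ × ℤ) : Prop :=
  (∀ i : Fin n, Edge (γ i.castSucc) (γ i.succ)) ∧ ∀ i, γ i ≠ 0

/-- The anticlockwise angle that is swept around the origin along the segment from `pos v` to
`pos w` (see `edgeAngle_eq_of_lift`). -/
def edgeAngle (v w : ℤ × ℤ) : ℝ := Complex.arg (pos w / pos v)

/-- The total anticlockwise angle that is swept around the origin along the walk `γ`. -/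
def windingAngle {n : ℕ} (γ : Fin (n + 1) → ℤ × ℤ) : ℝ :=
  ∑ i : Fin n, edgeAngle (γ i.castSucc) (γ i.succ)

lemma exp_third : Complex.exp (2 * Real.pi * Complex.I / 3) =
    ⟨-1 / 2, Real.sqrt 3 / 2⟩ := by
  have h : (2 * Real.pi * Complex.I / 3 : ℂ) = ((Real.pi - Real.pi / 3 : ℝ) : ℂ) * Complex.I := by
    push_cast; ring
  rw [h, Complex.exp_mul_I, ← Complex.ofReal_cos, ← Complex.ofReal_sin, Real.cos_pi_sub,
    Real.sin_pi_sub, Real.cos_pi_div_three, Real.sin_pi_div_three]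
  apply Complex.ext <;> simp
  norm_num

lemma normSq_pos (v : ℤ × ℤ) :
    Complex.normSq (pos v) = ((v.1 ^ 2 - v.1 * v.2 + v.2 ^ 2 : ℤ) : ℝ) := by
  have h3 : Real.sqrt 3 * Real.sqrt 3 = 3 := Real.mul_self_sqrt (by norm_num)
  rw [pos, exp_third, Complex.normSq_apply]
  simp
  linear_combination (v.2 : ℝ) ^ 2 / 4 * h3

lemma one_le_norm_pos {v : ℤ × ℤ} (hv : v ≠ 0) : 1 ≤ ‖pos v‖ := by
  have h : (1 : ℤ) ≤ v.1 ^ 2 - v.1 * v.2 + v.2 ^ 2 := by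
    by_contra hc
    have h0 : v.1 ^ 2 - v.1 * v.2 + v.2 ^ 2 ≤ 0 := by omega
    have h2 : v.2 = 0 := by nlinarith [sq_nonneg (2 * v.1 - v.2), sq_nonneg v.2]
    have h1 : v.1 = 0 := by rw [h2] at h0; nlinarith
    exact hv (Prod.ext h1 h2)
  have h' : (1 : ℝ) ≤ ‖pos v‖ ^ 2 := by
    rw [← Complex.normSq_eq_norm_sq, normSq_pos]; exact_mod_cast h
  nlinarith [norm_nonneg (pos v)]

lemma norm_sub_of_edge {v w : ℤ × ℤ} (h : Edge v w) : ‖pos w - pos v‖ = 1 := by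
  have hs : pos w - pos v = pos (w - v) := by simp [pos]; ring
  have h' : ‖pos (w - v)‖ ^ 2 = 1 := by
    rw [← Complex.normSq_eq_norm_sq, normSq_pos]
    rcases h with h | h | h <;> rw [h] <;> norm_num
  rw [hs]
  nlinarith [norm_nonneg (pos (w - v))]

/-- If `φ` is a continuous choice of the angle of the point that moves along the segment from
`pos v` to `pos w`, then the change of `φ` is `edgeAngle v w`. -/
theorem edgeAngle_eq_of_lift {v w : ℤ × ℤ} (hv : v ≠ 0) (hw : w ≠ 0) (h : Edge v w)
    (φ : ℝ → ℝ) (hφ : ContinuousOn φ (Set.Icc 0 1))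
    (hlift : ∀ x ∈ Set.Icc (0 : ℝ) 1, pos v + x * (pos w - pos v) =
      ‖pos v + x * (pos w - pos v)‖ * Complex.exp (φ x * Complex.I)) :
    edgeAngle v w = φ 1 - φ 0 := by
  have hv1 := one_le_norm_pos hv
  have hw1 := one_le_norm_pos hw
  have hv0 : pos v ≠ 0 := norm_pos_iff.mp (by linarith)
  have hw0 : pos w ≠ 0 := norm_pos_iff.mp (by linarith)
  set d : ℂ := (pos w - pos v) / pos v with hd
  have hdn : ‖d‖ ≤ 1 := by
    rw [hd, norm_div, norm_sub_of_edge h]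
    exact (div_le_one (by linarith)).2 hv1
  have hdre : -1 < d.re := by
    have h1 := (abs_le.1 ((Complex.abs_re_le_norm d).trans hdn)).1
    refine lt_of_le_of_ne h1 fun he => hw0 ?_
    have h2 : d.re * d.re + d.im * d.im ≤ 1 := by
      rw [← Complex.normSq_apply, Complex.normSq_eq_norm_sq]
      nlinarith [norm_nonneg d]
    have him : d.im = 0 := by
      rw [← he] at h2
      nlinarith [mul_self_nonneg d.im]
    have hd1 : d = -1 := Complex.ext (by simp [← he]) (by simp [him])
    rw [hd, div_eq_iff hv0] at hd1
    linear_combination hd1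
  have hslit : ∀ x ∈ Set.Icc (0 : ℝ) 1, 1 + (x : ℂ) * d ∈ Complex.slitPlane := by
    intro x hx
    left
    simp only [Complex.add_re, Complex.one_re, Complex.mul_re, Complex.ofReal_re,
      Complex.ofReal_im, zero_mul, sub_zero]
    rcases hx.2.lt_or_eq with h1 | h1
    · nlinarith [hx.1, mul_nonneg hx.1 (by linarith : 0 ≤ d.re + 1)]
    · rw [h1]; linarith
  have harg : ContinuousOn (fun x : ℝ => Complex.arg (1 + (x : ℂ) * d)) (Set.Icc 0 1) := by
    intro x hx
    have hc : ContinuousAt (fun x : ℝ => 1 + (x : ℂ) * d) x := by fun_prop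
    exact (ContinuousAt.comp (f := fun x : ℝ => 1 + (x : ℂ) * d)
      (Complex.continuousAt_arg (hslit x hx)) hc).continuousWithinAt
  have hexp : ∀ x ∈ Set.Icc (0 : ℝ) 1, Complex.exp (φ x * Complex.I) =
      Complex.exp (φ 0 * Complex.I) * Complex.exp (Complex.arg (1 + (x : ℂ) * d) * Complex.I) := by
    intro x hx
    have e0 := hlift 0 ⟨le_rfl, zero_le_one⟩
    have ex := hlift x hx
    have e1 := Complex.norm_mul_exp_arg_mul_I (1 + (x : ℂ) * d)
    have hne : 1 + (x : ℂ) * d ≠ 0 := Complex.slitPlane_ne_zero (hslit x hx)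
    have hprod : pos v + x * (pos w - pos v) = pos v * (1 + (x : ℂ) * d) := by
      rw [hd]; field_simp
    simp only [Complex.ofReal_zero, zero_mul, add_zero] at e0
    rw [hprod, norm_mul] at ex
    have hA : ((‖pos v‖ : ℝ) : ℂ) ≠ 0 := by exact_mod_cast (norm_pos_iff.mpr hv0).ne'
    have hB : ((‖1 + (x : ℂ) * d‖ : ℝ) : ℂ) ≠ 0 := by exact_mod_cast (norm_pos_iff.mpr hne).ne'
    apply mul_left_cancel₀ (mul_ne_zero hA hB)
    push_cast at ex
    rw [← ex]
    calc pos v * (1 + (x : ℂ) * d) = ((‖pos v‖ : ℂ) * Complex.exp (φ 0 * Complex.I)) *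
          (‖1 + (x : ℂ) * d‖ * Complex.exp (Complex.arg (1 + (x : ℂ) * d) * Complex.I)) := by
          rw [← e0, e1]
      _ = _ := by ring
  have hint : ∀ x ∈ Set.Icc (0 : ℝ) 1, ∃ n : ℤ,
      (φ x - φ 0 - Complex.arg (1 + (x : ℂ) * d)) / (2 * Real.pi) = n := by
    intro x hx
    have := hexp x hx
    rw [← Complex.exp_add, Complex.exp_eq_exp_iff_exists_int] at this
    obtain ⟨n, hn⟩ := this
    refine ⟨n, ?_⟩
    have hn' := congrArg Complex.im hn
    simp at hn'
    rw [div_eq_iff (by positivity)]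
    linarith
  have hcont : ContinuousOn
      (fun x : ℝ => (φ x - φ 0 - Complex.arg (1 + (x : ℂ) * d)) / (2 * Real.pi))
      (Set.Icc 0 1) := ((hφ.sub continuousOn_const).sub harg).div_const _
  have hdisc : IsDiscrete (Set.range ((↑) : ℤ → ℝ)) :=
    Int.isClosedEmbedding_coe_real.isEmbedding.isDiscrete_range
  have hconst := isPreconnected_Icc.constant_of_mapsTo hdisc
    hcont (fun x hx => (hint x hx).imp fun n hn => hn.symm)
    (Set.left_mem_Icc.2 zero_le_one) (Set.right_mem_Icc.2 (zero_le_one (α := ℝ)))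
  have hd1 : 1 + d = pos w / pos v := by rw [hd]; field_simp; ring
  have h2 : (2 * Real.pi) ≠ 0 := by positivity
  simp only [Complex.ofReal_zero, zero_mul, add_zero, Complex.arg_one, sub_self, zero_div,
    Complex.ofReal_one, one_mul, hd1] at hconst
  have hz := ((div_eq_zero_iff).1 hconst.symm).resolve_right h2
  rw [edgeAngle]; linarith

/-- The number of walks of length `n` from `w₀` to one of the vertices from which an edge points
to `0`, avoiding `0`, with winding angle `2 π k / 3`. -/
def walkCount (w₀ : ℤ × ℤ) (n : ℕ) (k : ℤ) : ℕ :=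
  Nat.card {γ : Fin (n + 1) → ℤ × ℤ // IsWalk γ ∧ γ 0 = w₀ ∧ Edge (γ (Fin.last n)) 0 ∧
    windingAngle γ = 2 * Real.pi * k / 3}

/-- The generating function of these walks, as a power series in `t` whose coefficients are
Laurent polynomials in `s` (seen in the field of rational functions in `s`). For each `n` only
finitely many `k` contribute. -/
def walkGF (w₀ : ℤ × ℤ) : (RatFunc ℚ)⟦X⟧ :=
  PowerSeries.mk fun n => ∑ᶠ k : ℤ, (walkCount w₀ n k : RatFunc ℚ) * RatFunc.X ^ k

/-- `T_k(u, q) = ∑_{n ≥ 0} (-1)^n (2n+1)^k q^{n(n+1)/2} (u^{n+1} - (-1)^k u^{-n})`, for Laurent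
series `u` and `q`; the sum is taken in the usual topology of formal Laurent series. -/
def T {F : Type} [Field F] (k : ℕ) (u q : F⸨X⸩) : F⸨X⸩ :=
  ∑' n : ℕ, (-1) ^ n * (2 * (n : F⸨X⸩) + 1) ^ k * q ^ (n * (n + 1) / 2) *
    (u ^ (n + 1) - (-1) ^ k * (u ^ n)⁻¹)

/-- `q` is a power series in `t` with constant term `0`, `r = q^{1/3}`, and
`t = q^{1/3} T_1(1, q^3) / (4 T_0(q, q^3) + 6 T_1(q, q^3))`. -/
structure IsNome (q r : ℚ⟦X⟧) : Prop where
  constantCoeff_eq : PowerSeries.constantCoeff q = 0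
  root : r ^ 3 = q
  param : ((PowerSeries.X : ℚ⟦X⟧) : ℚ⸨X⸩) =
    (r : ℚ⸨X⸩) * T 1 1 ((q : ℚ⸨X⸩) ^ 3) /
      (4 * T 0 (q : ℚ⸨X⸩) ((q : ℚ⸨X⸩) ^ 3) + 6 * T 1 (q : ℚ⸨X⸩) ((q : ℚ⸨X⸩) ^ 3))

/-- A power series in `t` over `ℚ`, seen as a Laurent series in `t` over the field `ℚ(s)`. -/
def lift (f : ℚ⟦X⟧) : (RatFunc ℚ)⸨X⸩ :=
  ((PowerSeries.map (algebraMap ℚ (RatFunc ℚ)) f : (RatFunc ℚ)⟦X⟧) : (RatFunc ℚ)⸨X⸩)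

/-- The indeterminate `s`, as a constant Laurent series in `t`. -/
def sVar : (RatFunc ℚ)⸨X⸩ := HahnSeries.C RatFunc.X

/-- The right-hand side of the formula for the generating function, where `r = q^{1/3}`. -/
def closedForm (t s q r : (RatFunc ℚ)⸨X⸩) : (RatFunc ℚ)⸨X⸩ :=
  s * (r ^ 2)⁻¹ / (t * (1 + s + s ^ 2)) * (T 0 q (q ^ 3) ^ 2 / T 1 1 (q ^ 3) ^ 2) *
    (T 1 q (q ^ 3) ^ 2 / T 0 q (q ^ 3) ^ 2 - T 2 q (q ^ 3) / T 0 q (q ^ 3)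
      - T 2 s q / (2 * T 0 s q) + T 3 1 q / (6 * T 1 1 q)
      + T 3 1 (q ^ 3) / (3 * T 1 1 (q ^ 3)))

end Kreweras

end

open scoped PowerSeries LaurentSeries

noncomputable section

namespace Kreweras

open PowerSeries

/-! ### `X`-adic limits and infinite sums of power series -/

section Limits

variable {R : Type*} [CommRing R]

/-! Put X = q^{1/3} and let w be a formal elliptic variable. The analysis takes place in power
series in X over Laurent polynomials in w, where `Shift 3` expresses the substitution w ↦ X³w = qw.

Walks. The universal cover of the punctured plane is cut into sectors indexed by k ∈ ℤ, each with
coordinates (i, j) ∈ ℕ². Inside a sector the steps are (-1, 0), (0, -1), (1, 1); a step into a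
neighbouring sector costs a factor s or s⁻¹. Each vertex of the cover has a definite angle, so
winding angle 2πk/3 means ending at the corner of sector k (`encard_walks_vertex`, `walkCount_eq`).
The result is a functional equation with kernel xy - t(x²y² + x + y) and unknown boundary series
(`evalAt_step`, `gen_kernel`).

Parametrization. With θ(w) = T_0(w, q³), the kernel vanishes at x(w) = Xθ(q²w)θ(w)/θ(qw)² and y(w) =
x(qw) (`kernel_root`, `shift_root`); the relation between t and q is the constant of proportionality
between two series in a one-dimensional space. On this curve, after division by y, the unknowns
combine into a single series B and its translate: x(w) + t(B(w) - sB(qw) - s⁻¹E) = 0, where E is the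
desired generating function (`root0_add_bdry`).

Solution. By an addition theorem x is an affine function of the second logarithmic derivative of
θ(qw) (`root0_eq`), so its coefficients in w are explicit. Comparing coefficients of w^m gives B up
to its constant term; the coefficient of w⁰ together with the value at w = 1, where x = 0 and B = (1
+ s⁻¹)E, gives E (`genCorner_mul`). Partial fractions turn E into Lambert series (`genCorner_eq`),
which the triple product and the heat equation identify with quotients of the T_k (`theta_two_eq`,
`evalW_one_theta_three`, `theta_one_sq_sub`).

The theta identities rest on `Shift.eq_zero`: a series with f(X^d w) = c w^{-i} f(w) is determined
by i of its coefficients. Finally, t = X + ⋯ has a unique compositional inverse r, and q = r³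
(`isNome_iff`, `existsUnique_tser_subst`). -/

lemma eq_of_forall_X_pow_dvd_sub {f g : R⟦X⟧} (h : ∀ N : ℕ, (X : R⟦X⟧) ^ N ∣ f - g) : f = g := by
  ext k
  have := X_pow_dvd_iff.1 (h (k + 1)) k (Nat.lt_succ_self k)
  rwa [map_sub, sub_eq_zero] at this

lemma X_pow_dvd_sub_trans {f g h : R⟦X⟧} {N : ℕ} (h₁ : (X : R⟦X⟧) ^ N ∣ f - g)
    (h₂ : (X : R⟦X⟧) ^ N ∣ g - h) : (X : R⟦X⟧) ^ N ∣ f - h := by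
  simpa using dvd_add h₁ h₂

lemma X_pow_dvd_sub_symm {f g : R⟦X⟧} {N : ℕ} (h₁ : (X : R⟦X⟧) ^ N ∣ f - g) :
    (X : R⟦X⟧) ^ N ∣ g - f := by
  simpa using (dvd_neg.2 h₁)

lemma X_pow_dvd_mul_sub_mul {f f' g g' : R⟦X⟧} {N : ℕ} (h₁ : (X : R⟦X⟧) ^ N ∣ f - f')
    (h₂ : (X : R⟦X⟧) ^ N ∣ g - g') : (X : R⟦X⟧) ^ N ∣ f * g - f' * g' := by
  have : f * g - f' * g' = (f - f') * g + f' * (g - g') := by ring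
  rw [this]
  exact dvd_add (Dvd.dvd.mul_right h₁ _) (Dvd.dvd.mul_left h₂ _)

/-- Carries identities between partial sums or partial products over to their limits. -/
lemma eq_of_tendsto_eq {f g : R⟦X⟧} {F G : ℕ → R⟦X⟧} (hf : ∀ N, (X : R⟦X⟧) ^ N ∣ f - F N)
    (hg : ∀ N, (X : R⟦X⟧) ^ N ∣ g - G N) (h : ∀ N, F N = G N) : f = g :=
  eq_of_forall_X_pow_dvd_sub fun N =>
    X_pow_dvd_sub_trans (hf N) (by rw [h N]; exact X_pow_dvd_sub_symm (hg N))

/-- The limit of a sequence of power series whose `N`-th term is correct modulo `X ^ N`. -/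
def lim (F : ℕ → R⟦X⟧) : R⟦X⟧ := mk fun k => coeff k (F (k + 1))

lemma lim_spec {F : ℕ → R⟦X⟧} (hF : ∀ N, (X : R⟦X⟧) ^ N ∣ F (N + 1) - F N) (N : ℕ) :
    (X : R⟦X⟧) ^ N ∣ lim F - F N := by
  rw [X_pow_dvd_iff]
  intro m hm
  rw [map_sub, lim, coeff_mk, sub_eq_zero]
  have key : ∀ j, coeff m (F (m + 1 + j)) = coeff m (F (m + 1)) := by
    intro j
    induction j with
    | zero => rfl
    | succ j ih =>
      rw [← ih, ← sub_eq_zero, ← map_sub]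
      exact X_pow_dvd_iff.1 (hF (m + 1 + j)) m (by omega)
  rw [← key (N - (m + 1))]
  congr 2
  omega

/-- The sum of a sequence of power series whose `n`-th term is divisible by `X ^ n`. -/
def lsum (f : ℕ → R⟦X⟧) : R⟦X⟧ := lim fun N => ∑ n ∈ Finset.range N, f n

lemma lsum_spec {f : ℕ → R⟦X⟧} (hf : ∀ n, (X : R⟦X⟧) ^ n ∣ f n) (N : ℕ) :
    (X : R⟦X⟧) ^ N ∣ lsum f - ∑ n ∈ Finset.range N, f n :=
  lim_spec (F := fun N => ∑ n ∈ Finset.range N, f n)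
    (fun N => by simpa [Finset.sum_range_succ] using hf N) N

lemma coeff_lsum (f : ℕ → R⟦X⟧) (k : ℕ) :
    coeff k (lsum f) = ∑ n ∈ Finset.range (k + 1), coeff k (f n) := by
  simp [lsum, lim]

lemma lsum_eq {f : ℕ → R⟦X⟧} {g : R⟦X⟧}
    (h : ∀ N, (X : R⟦X⟧) ^ N ∣ g - ∑ n ∈ Finset.range N, f n) : lsum f = g := by
  ext k
  have := X_pow_dvd_iff.1 (h (k + 1)) k (Nat.lt_succ_self k)
  rw [map_sub, sub_eq_zero, map_sum] at this
  rw [coeff_lsum, this]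

lemma lsum_add (f g : ℕ → R⟦X⟧) : lsum (fun n => f n + g n) = lsum f + lsum g := by
  ext k; simp [coeff_lsum, Finset.sum_add_distrib]

lemma lsum_sub (f g : ℕ → R⟦X⟧) : lsum (fun n => f n - g n) = lsum f - lsum g := by
  ext k; simp [coeff_lsum, Finset.sum_sub_distrib]

lemma lsum_neg (f : ℕ → R⟦X⟧) : lsum (fun n => -f n) = -lsum f := by
  ext k; simp [coeff_lsum]

lemma lsum_mul_left (a : R⟦X⟧) {f : ℕ → R⟦X⟧} (hf : ∀ n, (X : R⟦X⟧) ^ n ∣ f n) :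
    lsum (fun n => a * f n) = a * lsum f :=
  lsum_eq fun N => by
    rw [← Finset.mul_sum, ← mul_sub]
    exact Dvd.dvd.mul_left (lsum_spec hf N) _

lemma map_lsum {S : Type*} [CommRing S] (φ : R →+* S) (f : ℕ → R⟦X⟧) :
    PowerSeries.map φ (lsum f) = lsum fun n => PowerSeries.map φ (f n) := by
  ext k; simp [coeff_lsum]

lemma constantCoeff_lsum (f : ℕ → R⟦X⟧) :
    constantCoeff (lsum f) = constantCoeff (f 0) := by
  have := coeff_lsum f 0
  simpa using this

lemma lsum_eq_single {f : ℕ → R⟦X⟧} (m : ℕ) (hf : (X : R⟦X⟧) ^ m ∣ f m)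
    (h : ∀ n, n ≠ m → f n = 0) : lsum f = f m :=
  lsum_eq fun N => by
    by_cases hm : m < N
    · rw [Finset.sum_eq_single m (fun n _ hn => h n hn)
        (fun hn => absurd (Finset.mem_range.2 hm) hn), sub_self]
      exact dvd_zero _
    · rw [Finset.sum_eq_zero, sub_zero]
      · exact (pow_dvd_pow _ (not_lt.1 hm)).trans hf
      · intro n hn
        exact h n (by rw [Finset.mem_range] at hn; omega)

lemma lsum_eq_single' {f : ℕ → R⟦X⟧} (hf : ∀ n, (X : R⟦X⟧) ^ n ∣ f n) (m : ℕ)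
    (h : ∀ n, n ≠ m → f n = 0) : lsum f = f m := lsum_eq_single m (hf m) h

lemma lsum_zero : lsum (fun _ => (0 : R⟦X⟧)) = 0 := by
  ext k; simp [coeff_lsum]

lemma hasSubst_of_X_dvd {r : R⟦X⟧} (hr : constantCoeff r = 0) : HasSubst r :=
  HasSubst.of_constantCoeff_zero' hr

lemma X_pow_dvd_subst {r : R⟦X⟧} (hr : constantCoeff r = 0) {f : R⟦X⟧} {N : ℕ}
    (h : (X : R⟦X⟧) ^ N ∣ f) : (X : R⟦X⟧) ^ N ∣ f.subst r := by
  obtain ⟨g, rfl⟩ := h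
  have hs := hasSubst_of_X_dvd hr
  rw [subst_mul hs, subst_pow hs, subst_X hs]
  exact Dvd.dvd.mul_right (pow_dvd_pow_of_dvd (X_dvd_iff.2 hr) N) _

lemma subst_lsum {r : R⟦X⟧} (hr : constantCoeff r = 0) {f : ℕ → R⟦X⟧}
    (hf : ∀ n, (X : R⟦X⟧) ^ n ∣ f n) :
    (lsum f).subst r = lsum fun n => (f n).subst r := by
  symm
  apply lsum_eq
  intro N
  have hs := hasSubst_of_X_dvd hr
  have h := X_pow_dvd_subst hr (lsum_spec hf N)
  rwa [← coe_substAlgHom hs, map_sub, map_sum, coe_substAlgHom hs] at h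

lemma constantCoeff_subst_of_zero {r : R⟦X⟧} (hr : constantCoeff r = 0) (f : R⟦X⟧) :
    constantCoeff (f.subst r) = constantCoeff f := by
  have hs := hasSubst_of_X_dvd hr
  obtain ⟨g, hg⟩ := X_dvd_iff.2 (show constantCoeff (f - C (constantCoeff f)) = 0 by simp)
  have : f = X * g + C (constantCoeff f) := by rw [← hg]; ring
  conv_lhs => rw [this]
  rw [subst_add hs, subst_mul hs, subst_X hs, subst_C]
  rw [map_add, map_mul, hr, zero_mul, zero_add]
  exact MvPowerSeries.constantCoeff_C _

end Limits

/-! ### Formal sums as convergent sums of Laurent series -/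

section Laurent

variable {F : Type} [Field F]

/-- Links `lsum` to the topological sum in the definition of `T`: every finite partial sum that
contains the first `D` terms agrees with the limit modulo `X ^ D`. -/
lemma hasSum_coe {f : ℕ → F⟦X⟧} {g : F⟦X⟧} (hf : ∀ n, (X : F⟦X⟧) ^ n ∣ f n)
    (hg : lsum f = g) : HasSum (fun n => (f n : F⸨X⸩)) (g : F⸨X⸩) := by
  subst hg
  rw [HasSum, SummationFilter.unconditional_filter, Filter.tendsto_def]
  intro s hs
  rw [Valued.mem_nhds] at hs
  obtain ⟨γ, hγ⟩ := hs
  obtain ⟨D, hD⟩ : ∃ D : ℕ, ∀ y : F⟦X⟧, (X : F⟦X⟧) ^ D ∣ y →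
      (Valued.v : Valuation F⸨X⸩ _).restrict (y : F⸨X⸩) < γ := by
    set δ := MonoidWithZeroHom.ValueGroup₀.embedding γ.1 with hδ
    have hδ0 : δ ≠ 0 := by simp [hδ]
    obtain ⟨d, hd⟩ : ∃ d : ℤ, δ = WithZero.exp d := ⟨δ.log, (WithZero.exp_log hδ0).symm⟩
    -- A series without coefficients below degree `1 - d` has valuation at most `exp (d - 1)`, just
    -- below the radius `exp d`.
    refine ⟨(1 - d).toNat, fun y hy => ?_⟩
    rw [Valuation.restrict_lt_iff_lt_embedding, ← hδ, hd]
    refine lt_of_le_of_lt ((LaurentSeries.valuation_le_iff_coeff_lt_eq_zero F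
      (D := 1 - d)).2 fun n hn => ?_) (WithZero.exp_lt_exp.2 (by omega))
    rw [PowerSeries.coeff_coe]
    split_ifs with h0
    · rfl
    · exact X_pow_dvd_iff.1 hy _ (by omega)
  refine Filter.mem_atTop_sets.2 ⟨Finset.range D, fun t ht => hγ ?_⟩
  have h1 : ∑ n ∈ t, (f n : F⸨X⸩) - (lsum f : F⸨X⸩) =
      ((∑ n ∈ t, f n - lsum f : F⟦X⟧) : F⸨X⸩) := by
    simp [map_sum]
  rw [Set.mem_ofPred_eq, h1]
  apply hD
  have h2 : ∑ n ∈ t, f n - lsum f =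
      ∑ n ∈ t \ Finset.range D, f n - (lsum f - ∑ n ∈ Finset.range D, f n) := by
    rw [← Finset.sum_sdiff ht]; ring
  rw [h2]
  refine dvd_sub (Finset.dvd_sum fun n hn => ?_) (lsum_spec hf D)
  rw [Finset.mem_sdiff, Finset.mem_range, not_lt] at hn
  exact (pow_dvd_pow _ hn.2).trans (hf n)

end Laurent

end Kreweras

end

open scoped PowerSeries LaurentSeries

noncomputable section

namespace Kreweras

open PowerSeries
open scoped LaurentPolynomial

/-! ### Series in `X` over Laurent polynomials in `w`, and the shift of `w` -/

section Bivariate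

variable {K : Type*} [Field K]

/-- The coefficient of `w ^ m * X ^ k`. -/
def bcoeff (f : K[T;T⁻¹]⟦X⟧) (a : ℤ × ℤ) : K :=
  if 0 ≤ a.2 then (coeff a.2.toNat f).coeff a.1 else 0

/-- The coefficient of `w ^ m`, a power series. -/
def slice (m : ℤ) (f : K[T;T⁻¹]⟦X⟧) : K⟦X⟧ :=
  PowerSeries.mk fun k => (coeff k f : K[T;T⁻¹]).coeff m

@[simp] lemma coeff_slice (m : ℤ) (f : K[T;T⁻¹]⟦X⟧) (k : ℕ) :
    coeff k (slice m f) = (coeff k f).coeff m := by simp [slice]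

lemma slice_ext {f g : K[T;T⁻¹]⟦X⟧} (h : ∀ m, slice m f = slice m g) : f = g := by
  refine PowerSeries.ext fun k => LaurentPolynomial.ext fun m => ?_
  rw [← coeff_slice, h m, coeff_slice]

lemma bcoeff_natCast (f : K[T;T⁻¹]⟦X⟧) (m : ℤ) (k : ℕ) :
    bcoeff f (m, k) = coeff k (slice m f) := by simp [bcoeff]

lemma bcoeff_of_neg (f : K[T;T⁻¹]⟦X⟧) {a : ℤ × ℤ} (h : a.2 < 0) : bcoeff f a = 0 := by
  simp [bcoeff, not_le.2 h]

lemma bcoeff_ext {f g : K[T;T⁻¹]⟦X⟧} (h : ∀ a, bcoeff f a = bcoeff g a) : f = g :=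
  slice_ext fun m => by
    ext k
    rw [← bcoeff_natCast, h, bcoeff_natCast]

@[simp] lemma slice_add (m : ℤ) (f g : K[T;T⁻¹]⟦X⟧) : slice m (f + g) = slice m f + slice m g := by
  ext k; simp

@[simp] lemma slice_sub (m : ℤ) (f g : K[T;T⁻¹]⟦X⟧) : slice m (f - g) = slice m f - slice m g := by
  ext k; simp

@[simp] lemma slice_neg (m : ℤ) (f : K[T;T⁻¹]⟦X⟧) : slice m (-f) = -slice m f := by
  ext k; simp

@[simp] lemma slice_zero (m : ℤ) : slice m (0 : K[T;T⁻¹]⟦X⟧) = 0 := by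
  ext k; simp

lemma slice_lsum (m : ℤ) (f : ℕ → K[T;T⁻¹]⟦X⟧) :
    slice m (lsum f) = lsum fun n => slice m (f n) := by
  ext k
  rw [coeff_lsum, coeff_slice, coeff_lsum]
  simp [AddMonoidAlgebra.coeff_sum]

lemma X_pow_dvd_slice (m : ℤ) {f : K[T;T⁻¹]⟦X⟧} {N : ℕ} (h : (X : K[T;T⁻¹]⟦X⟧) ^ N ∣ f) :
    (X : K⟦X⟧) ^ N ∣ slice m f := by
  rw [X_pow_dvd_iff] at h ⊢
  intro k hk
  simp [h k hk]

/-- A power series in `X` as a bivariate series. -/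
def ofX : K⟦X⟧ →+* K[T;T⁻¹]⟦X⟧ := PowerSeries.map LaurentPolynomial.C

/-- The monomial `w ^ j`. -/
def wpow (j : ℤ) : K[T;T⁻¹]⟦X⟧ := PowerSeries.C (LaurentPolynomial.T j)

lemma wpow_add (i j : ℤ) : (wpow (i + j) : K[T;T⁻¹]⟦X⟧) = wpow i * wpow j := by
  rw [wpow, LaurentPolynomial.T_add, map_mul]; rfl

@[simp] lemma wpow_zero : (wpow 0 : K[T;T⁻¹]⟦X⟧) = 1 := by simp [wpow]

lemma wpow_mul_wpow_neg (j : ℤ) : (wpow j * wpow (-j) : K[T;T⁻¹]⟦X⟧) = 1 := by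
  rw [← wpow_add]; simp

@[simp] lemma ofX_X : (ofX X : K[T;T⁻¹]⟦X⟧) = X := by simp [ofX]

lemma slice_wpow_mul (m j : ℤ) (f : K[T;T⁻¹]⟦X⟧) :
    slice m (wpow j * f) = slice (m - j) f := by
  ext k
  rw [coeff_slice, coeff_slice, wpow, PowerSeries.coeff_C_mul, LaurentPolynomial.T,
    AddMonoidAlgebra.coeff_single_mul_eq_mul_coeff (m - j) (fun m' _ => by omega), one_mul]

lemma slice_ofX_mul (m : ℤ) (a : K⟦X⟧) (f : K[T;T⁻¹]⟦X⟧) :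
    slice m (ofX a * f) = a * slice m f := by
  ext k
  rw [coeff_slice, coeff_mul, coeff_mul, AddMonoidAlgebra.coeff_sum, Finsupp.finsetSum_apply]
  refine Finset.sum_congr rfl fun i _ => ?_
  rw [ofX, coeff_map, coeff_slice, ← LaurentPolynomial.smul_eq_C_mul]
  simp

lemma slice_one (m : ℤ) : slice m (1 : K[T;T⁻¹]⟦X⟧) = if m = 0 then 1 else 0 := by
  ext k
  rw [coeff_slice, coeff_one]
  split_ifs with h1 h2 h2 <;>
    simp_all [← LaurentPolynomial.T_zero, coeff_one, eq_comm]

lemma slice_X_pow_mul (m : ℤ) (e : ℕ) (f : K[T;T⁻¹]⟦X⟧) :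
    slice m (X ^ e * f) = X ^ e * slice m f := by
  have := slice_ofX_mul m (X ^ e) f
  simpa using this

lemma slice_ofX_mul_wpow (m j : ℤ) (a : K⟦X⟧) :
    slice m (ofX a * wpow j) = if m = j then a else 0 := by
  rw [slice_ofX_mul]
  have := slice_wpow_mul m j (1 : K[T;T⁻¹]⟦X⟧)
  rw [mul_one] at this
  rw [this, slice_one]
  simp [sub_eq_zero]

lemma coeff_mul_eq_finsum (p q : K[T;T⁻¹]) (m : ℤ) :
    (p * q).coeff m = ∑ i ∈ p.coeff.support, p.coeff i * q.coeff (m - i) := by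
  classical
  rw [AddMonoidAlgebra.coeff_mul, Finsupp.sum]
  refine Finset.sum_congr rfl fun i _ => ?_
  rw [Finsupp.sum, Finset.sum_eq_single (m - i)]
  · simp
  · intro b _ hb
    rw [if_neg]
    omega
  · intro h
    simp [Finsupp.notMem_support_iff.1 h]

/-- The finite set of exponents `(m, k)` with `0 ≤ k ≤ n` at which `f` has a nonzero
coefficient. -/
def bsupport (f : K[T;T⁻¹]⟦X⟧) (n : ℕ) : Finset (ℤ × ℤ) :=
  (Finset.range (n + 1)).biUnion fun k =>
    (coeff k f).coeff.support.image fun m => (m, (k : ℤ))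

lemma bcoeff_mul_sum (f g : K[T;T⁻¹]⟦X⟧) (m : ℤ) (n : ℕ) :
    bcoeff (f * g) (m, n) = ∑ a ∈ bsupport f n, bcoeff f a * bcoeff g ((m, (n : ℤ)) - a) := by
  rw [bcoeff_natCast, coeff_slice, coeff_mul, AddMonoidAlgebra.coeff_sum,
    Finsupp.finsetSum_apply, bsupport, Finset.sum_biUnion]
  · rw [Finset.Nat.sum_antidiagonal_eq_sum_range_succ_mk]
    refine Finset.sum_congr rfl fun k hk => ?_
    rw [Finset.mem_range] at hk
    rw [coeff_mul_eq_finsum, Finset.sum_image]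
    · refine Finset.sum_congr rfl fun i _ => ?_
      have : ((m, (n : ℤ)) - (i, (k : ℤ)) : ℤ × ℤ) = (m - i, ((n - k : ℕ) : ℤ)) := by
        ext
        · simp
        · simp; omega
      rw [this, bcoeff_natCast, bcoeff_natCast, coeff_slice, coeff_slice]
    · intro a _ b _ h
      simpa using h
  · intro i _ j _ hij
    rw [Function.onFun, Finset.disjoint_left]
    intro a ha hb
    simp only [Finset.mem_image] at ha hb
    obtain ⟨x, _, rfl⟩ := ha
    obtain ⟨y, _, h⟩ := hb
    simp at h
    omega

lemma support_bcoeff_mul_subset (f g : K[T;T⁻¹]⟦X⟧) (m : ℤ) (n : ℕ) :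
    (Function.support fun a => bcoeff f a * bcoeff g ((m, (n : ℤ)) - a)) ⊆ bsupport f n := by
  rintro ⟨i, k⟩ h
  rw [Function.mem_support] at h
  have h1 : 0 ≤ k := by
    by_contra hk
    exact h (by rw [bcoeff_of_neg f (by simpa using hk), zero_mul])
  have h2 : k ≤ n := by
    by_contra hk
    exact h (by rw [bcoeff_of_neg g (by simp; omega), mul_zero])
  lift k to ℕ using h1
  simp only [bsupport, Finset.coe_biUnion, Set.mem_iUnion, Finset.mem_coe, Finset.mem_image,
    Finset.mem_range]
  refine ⟨k, by omega, i, ?_, rfl⟩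
  rw [Finsupp.mem_support_iff]
  intro h0
  rw [bcoeff_natCast, coeff_slice, h0, zero_mul] at h
  exact h rfl

lemma finite_support_bcoeff_mul (f g : K[T;T⁻¹]⟦X⟧) (p : ℤ × ℤ) :
    (Function.support fun a => bcoeff f a * bcoeff g (p - a)).Finite := by
  obtain ⟨m, k⟩ := p
  rcases lt_or_ge k 0 with hk | hk
  · convert Set.finite_empty
    rw [Function.support_eq_empty_iff]
    funext a
    rcases lt_or_ge a.2 0 with ha | ha
    · simp [bcoeff_of_neg f ha]
    · simp [bcoeff_of_neg g (a := (m, k) - a) (by simp; omega)]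
  · lift k to ℕ using hk
    exact (Finset.finite_toSet _).subset (support_bcoeff_mul_subset f g m k)

/-- A convolution over all of ℤ × ℤ is invariant under the shear (m, k) ↦ (m, k + dm); this is what
makes `Shift` multiplicative. -/
lemma bcoeff_mul (f g : K[T;T⁻¹]⟦X⟧) (p : ℤ × ℤ) :
    bcoeff (f * g) p = ∑ᶠ a, bcoeff f a * bcoeff g (p - a) := by
  obtain ⟨m, k⟩ := p
  rcases lt_or_ge k 0 with hk | hk
  · rw [bcoeff_of_neg _ hk]
    symm
    apply finsum_eq_zero_of_forall_eq_zero
    intro a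
    rcases lt_or_ge a.2 0 with ha | ha
    · simp [bcoeff_of_neg f ha]
    · simp [bcoeff_of_neg g (a := (m, k) - a) (by simp; omega)]
  · lift k to ℕ using hk
    rw [finsum_eq_sum_of_support_subset _ (support_bcoeff_mul_subset f g m k), bcoeff_mul_sum]

lemma bcoeff_add (f g : K[T;T⁻¹]⟦X⟧) (a : ℤ × ℤ) :
    bcoeff (f + g) a = bcoeff f a + bcoeff g a := by
  simp only [bcoeff]; split_ifs <;> simp

lemma bcoeff_neg (f : K[T;T⁻¹]⟦X⟧) (a : ℤ × ℤ) : bcoeff (-f) a = -bcoeff f a := by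
  simp only [bcoeff]; split_ifs <;> simp

lemma bcoeff_eq_of_dvd {f g : K[T;T⁻¹]⟦X⟧} {N : ℕ} (h : (X : K[T;T⁻¹]⟦X⟧) ^ N ∣ f - g)
    {a : ℤ × ℤ} (ha : a.2 < N) : bcoeff f a = bcoeff g a := by
  simp only [bcoeff]
  split_ifs with h0
  · have := X_pow_dvd_iff.1 h a.2.toNat (by omega)
    rw [map_sub, sub_eq_zero] at this
    rw [this]
  · rfl

/-- `g` arises from `f` by the substitution of `X ^ d * w` for `w`. -/
def Shift (d : ℕ) (f g : K[T;T⁻¹]⟦X⟧) : Prop :=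
  ∀ a : ℤ × ℤ, bcoeff g (a.1, a.2 + d * a.1) = bcoeff f a

namespace Shift

variable {d : ℕ} {f f' g g' : K[T;T⁻¹]⟦X⟧}

lemma add (hf : Shift d f f') (hg : Shift d g g') : Shift d (f + g) (f' + g') := fun a => by
  rw [bcoeff_add, bcoeff_add, hf a, hg a]

lemma neg (hf : Shift d f f') : Shift d (-f) (-f') := fun a => by
  rw [bcoeff_neg, bcoeff_neg, hf a]

lemma sub (hf : Shift d f f') (hg : Shift d g g') : Shift d (f - g) (f' - g') := by
  rw [sub_eq_add_neg, sub_eq_add_neg]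
  exact hf.add hg.neg

lemma mul (hf : Shift d f f') (hg : Shift d g g') : Shift d (f * g) (f' * g') := fun p => by
  rw [bcoeff_mul, bcoeff_mul]
  let e : ℤ × ℤ ≃ ℤ × ℤ :=
    { toFun := fun a => (a.1, a.2 + d * a.1)
      invFun := fun a => (a.1, a.2 - d * a.1)
      left_inv := fun a => by simp
      right_inv := fun a => by simp }
  rw [← finsum_comp_equiv e]
  refine finsum_congr fun a => ?_
  have h1 := hf a
  have h2 := hg (p - a)
  have h3 : ((p.1, p.2 + d * p.1) - e a : ℤ × ℤ) =
      ((p - a).1, (p - a).2 + d * (p - a).1) := by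
    ext
    · simp [e]
    · simp [e]; ring
  rw [h3, h2]
  show bcoeff f' (a.1, a.2 + d * a.1) * _ = _
  rw [h1]

lemma eq (hf : Shift d f f') (hg : Shift d f g') : f' = g' :=
  bcoeff_ext fun a => by
    have h1 := hf (a.1, a.2 - d * a.1)
    have h2 := hg (a.1, a.2 - d * a.1)
    simp only [sub_add_cancel] at h1 h2
    exact h1.trans h2.symm

/-- The substitution multiplies the coefficient of w^m by X^{dm}. Placing the factor on the other
side for m ≤ 0 avoids negative powers of X. -/
lemma of_slice (h₁ : ∀ n : ℕ, slice n f' = X ^ (d * n) * slice n f)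
    (h₂ : ∀ n : ℕ, slice (-n) f = X ^ (d * n) * slice (-n) f') : Shift d f f' := by
  rintro ⟨m, k⟩
  rcases le_total 0 m with hm | hm
  · lift m to ℕ using hm
    rcases lt_or_ge k 0 with hk | hk
    · rw [bcoeff_of_neg f hk]
      rcases lt_or_ge (k + d * m) 0 with hk' | hk'
      · rw [bcoeff_of_neg f' hk']
      · obtain ⟨l, hl⟩ := Int.eq_ofNat_of_zero_le hk'
        simp only [hl]
        rw [bcoeff_natCast, h₁, coeff_X_pow_mul', if_neg]
        zify; omega
    · lift k to ℕ using hk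
      have : ((k : ℤ) + d * m) = ((k + d * m : ℕ) : ℤ) := by push_cast; ring
      simp only [this]
      rw [bcoeff_natCast, h₁, bcoeff_natCast, coeff_X_pow_mul]
  · obtain ⟨n, rfl⟩ : ∃ n : ℕ, m = -n := ⟨m.natAbs, by omega⟩
    rcases lt_or_ge (k + d * (-n : ℤ)) 0 with hk | hk
    · rw [bcoeff_of_neg f' (by simpa using hk)]
      rcases lt_or_ge k 0 with hk' | hk'
      · rw [bcoeff_of_neg f hk']
      · lift k to ℕ using hk'
        rw [bcoeff_natCast, h₂, coeff_X_pow_mul', if_neg]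
        zify; linarith
    · obtain ⟨l, hl⟩ := Int.eq_ofNat_of_zero_le hk
      have hk' : k = ((l + d * n : ℕ) : ℤ) := by push_cast; linarith
      simp only [hl]
      rw [hk', bcoeff_natCast f', bcoeff_natCast f, h₂, coeff_X_pow_mul]

lemma slice_natCast (h : Shift d f f') (n : ℕ) : slice n f' = X ^ (d * n) * slice n f := by
  ext k
  rw [← bcoeff_natCast, coeff_X_pow_mul']
  have := h (n, k - d * n)
  simp only [sub_add_cancel] at this
  rw [this]
  split_ifs with hk
  · rw [← bcoeff_natCast]
    congr 2
    push_cast [hk]; ring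
  · exact bcoeff_of_neg f (by simp; zify at hk; linarith)

lemma slice_neg_natCast (h : Shift d f f') (n : ℕ) :
    slice (-n) f = X ^ (d * n) * slice (-n) f' := by
  ext k
  rw [← bcoeff_natCast, coeff_X_pow_mul']
  have := h (-n, k)
  rw [← this]
  split_ifs with hk
  · rw [← bcoeff_natCast]
    congr 2
    push_cast [hk]; ring
  · exact bcoeff_of_neg f' (by simp; zify at hk; linarith)

/-- `Shift` is closed under simultaneous `X`-adic limits, since each instance of it concerns one
coefficient on either side. -/
lemma of_dvd (h : ∀ N : ℕ, ∃ g g', Shift d g g' ∧ (X : K[T;T⁻¹]⟦X⟧) ^ N ∣ f - g ∧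
    (X : K[T;T⁻¹]⟦X⟧) ^ N ∣ f' - g') : Shift d f f' := fun a => by
  obtain ⟨g, g', h1, h2, h3⟩ := h (max a.2.toNat (a.2 + d * a.1).toNat + 1)
  rw [bcoeff_eq_of_dvd h2 (by push_cast; omega), bcoeff_eq_of_dvd h3 (by
    show a.2 + d * a.1 < _
    push_cast; omega), h1 a]

lemma const (a : K⟦X⟧) : Shift d (ofX a) (ofX a) := by
  have key : ∀ m : ℤ, slice m (ofX a) = if m = 0 then a else 0 := fun m => by
    simpa using slice_ofX_mul_wpow m 0 a
  apply of_slice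
  · intro n
    rw [key]
    split_ifs with h
    · have : n = 0 := by omega
      subst this; simp
    · simp
  · intro n
    rw [key]
    split_ifs with h
    · have : n = 0 := by omega
      subst this; simp
    · simp

lemma X_pow (e : ℕ) : Shift d (X ^ e : K[T;T⁻¹]⟦X⟧) (X ^ e) := by
  have h := const (d := d) (X ^ e : K⟦X⟧)
  rw [map_pow, ofX_X] at h
  exact h

lemma one : Shift d (1 : K[T;T⁻¹]⟦X⟧) 1 := by simpa using X_pow (K := K) (d := d) 0

lemma wpow_natCast (n : ℕ) :
    Shift d (wpow n : K[T;T⁻¹]⟦X⟧) (X ^ (d * n) * wpow n) := by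
  have key : ∀ m j : ℤ, slice m (wpow j : K[T;T⁻¹]⟦X⟧) = if m = j then 1 else 0 := fun m j => by
    simpa using slice_ofX_mul_wpow m j (1 : K⟦X⟧)
  apply of_slice
  · intro m
    rw [slice_X_pow_mul, key]
    split_ifs with h
    · have : m = n := by omega
      subst this; rfl
    · simp
  · intro m
    rw [slice_X_pow_mul, key]
    split_ifs with h
    · have : m = 0 ∧ n = 0 := by omega
      simp [this.1, this.2]
    · simp

lemma wpow_neg_natCast (n : ℕ) :
    Shift d (X ^ (d * n) * wpow (-n) : K[T;T⁻¹]⟦X⟧) (wpow (-n)) := by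
  have key : ∀ m j : ℤ, slice m (wpow j : K[T;T⁻¹]⟦X⟧) = if m = j then 1 else 0 := fun m j => by
    simpa using slice_ofX_mul_wpow m j (1 : K⟦X⟧)
  apply of_slice
  · intro m
    rw [slice_X_pow_mul, key]
    split_ifs with h
    · have : m = 0 ∧ n = 0 := by omega
      simp [this.1, this.2]
    · simp
  · intro m
    rw [slice_X_pow_mul, key]
    split_ifs with h
    · have : m = n := by omega
      subst this; rfl
    · simp

lemma pow (hf : Shift d f f') (n : ℕ) : Shift d (f ^ n) (f' ^ n) := by
  induction n with
  | zero => simpa using one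
  | succ n ih => rw [pow_succ, pow_succ]; exact ih.mul hf

lemma sum {ι : Type*} {s : Finset ι} {F F' : ι → K[T;T⁻¹]⟦X⟧} (h : ∀ i ∈ s, Shift d (F i) (F' i)) :
    Shift d (∑ i ∈ s, F i) (∑ i ∈ s, F' i) := by
  induction s using Finset.cons_induction with
  | empty => simpa using const (K := K) (d := d) 0
  | cons a s ha ih =>
    rw [Finset.sum_cons, Finset.sum_cons]
    exact (h a (Finset.mem_cons_self a s)).add (ih fun i hi => h i (Finset.mem_cons_of_mem hi))

lemma prod {ι : Type*} {s : Finset ι} {F F' : ι → K[T;T⁻¹]⟦X⟧}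
    (h : ∀ i ∈ s, Shift d (F i) (F' i)) : Shift d (∏ i ∈ s, F i) (∏ i ∈ s, F' i) := by
  induction s using Finset.cons_induction with
  | empty => simpa using one
  | cons a s ha ih =>
    rw [Finset.prod_cons, Finset.prod_cons]
    exact (h a (Finset.mem_cons_self a s)).mul (ih fun i hi => h i (Finset.mem_cons_of_mem hi))

/-- Inverses of series with constant term `1` can be shifted when both sides have
constant term `1`. -/
lemma inv (hf : Shift d f f') (h : (X : K[T;T⁻¹]⟦X⟧) ∣ 1 - f) (h' : (X : K[T;T⁻¹]⟦X⟧) ∣ 1 - f')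
    (hg : f * g = 1) (hg' : f' * g' = 1) : Shift d g g' := by
  apply of_dvd
  intro N
  -- The inverses are limits of geometric sums, which shift term by term. Both `1 - f` and `1 - f'`
  -- must be divisible by `X`, because a shift does not preserve the `X`-adic order.
  refine ⟨∑ i ∈ Finset.range N, (1 - f) ^ i, ∑ i ∈ Finset.range N, (1 - f') ^ i,
    sum fun i _ => ((one.sub hf).pow i), ?_, ?_⟩
  · have h1 : g - ∑ i ∈ Finset.range N, (1 - f) ^ i = g * (1 - f) ^ N := by
      have := geom_sum_mul_neg (1 - f) N
      rw [sub_sub_cancel] at this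
      linear_combination (∑ i ∈ Finset.range N, (1 - f) ^ i) * hg - g * this
    rw [h1]
    exact Dvd.dvd.mul_left (pow_dvd_pow_of_dvd h N) _
  · have h1 : g' - ∑ i ∈ Finset.range N, (1 - f') ^ i = g' * (1 - f') ^ N := by
      have := geom_sum_mul_neg (1 - f') N
      rw [sub_sub_cancel] at this
      linear_combination (∑ i ∈ Finset.range N, (1 - f') ^ i) * hg' - g' * this
    rw [h1]
    exact Dvd.dvd.mul_left (pow_dvd_pow_of_dvd h' N) _

/-- A solution of `H (X ^ d * w) = c * X ^ e * w ^ (-i) * H w` with `i` vanishing consecutive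
coefficients is zero. -/
lemma eq_zero {H : K[T;T⁻¹]⟦X⟧} {c : K⟦X⟧} (hc : c ≠ 0) {i : ℕ} (hi : 0 < i)
    (h : Shift d H (ofX c * (wpow (-i) * H)))
    (h0 : ∀ m : ℕ, 1 ≤ m → m ≤ i → slice m H = 0) : H = 0 := by
  -- Comparing coefficients links the indices `n` and `n + i`: upwards from `1, …, i` one divides by
  -- `c`, and each index `-n ≤ 0` is a multiple of the one `i` places higher. No division by `X`
  -- occurs.
  have hup : ∀ n : ℕ, c * slice ((n : ℤ) + i) H = X ^ (d * n) * slice n H := fun n => by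
    rw [← h.slice_natCast n, slice_ofX_mul, slice_wpow_mul, sub_neg_eq_add]
  have hdown : ∀ n : ℕ, slice (-n : ℤ) H = X ^ (d * n) * (c * slice (-n + i : ℤ) H) := fun n => by
    conv_lhs => rw [h.slice_neg_natCast n]
    rw [slice_ofX_mul, slice_wpow_mul, sub_neg_eq_add]
  have hpos : ∀ n : ℕ, 1 ≤ n → slice n H = 0 := by
    intro n
    induction n using Nat.strong_induction_on with
    | _ n ih =>
      intro hn
      by_cases hni : n ≤ i
      · exact h0 n hn hni
      · have h1 := hup (n - i)
        rw [ih (n - i) (by omega) (by omega), mul_zero] at h1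
        have h2 : ((n - i : ℕ) : ℤ) + i = n := by omega
        rw [h2] at h1
        exact (mul_eq_zero.1 h1).resolve_left hc
  have hneg : ∀ n : ℕ, slice (-n : ℤ) H = 0 := by
    intro n
    induction n using Nat.strong_induction_on with
    | _ n ih =>
      rw [hdown n]
      have h2 : slice (-n + i : ℤ) H = 0 := by
        by_cases hni : i ≤ n
        · have := ih (n - i) (by omega)
          rwa [show (-((n - i : ℕ) : ℤ)) = -n + i by omega] at this
        · have := hpos (i - n) (by omega)
          rwa [show ((i - n : ℕ) : ℤ) = -n + i by omega] at this
      rw [h2]; simp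
  apply slice_ext
  intro m
  rw [slice_zero]
  rcases le_total 0 m with hm | hm
  · lift m to ℕ using hm
    rcases Nat.eq_zero_or_pos m with rfl | h1
    · simpa using hneg 0
    · exact hpos m h1
  · have := hneg m.natAbs
    rwa [show (-(m.natAbs : ℤ)) = m by omega] at this

end Shift

end Bivariate

/-! ### Derivations, evaluation, and inversion of `w` -/

section Operators

variable {K : Type*} [Field K]

/-- The operator `w * d/dw` on Laurent polynomials. -/
def eulerPoly : K[T;T⁻¹] →+ K[T;T⁻¹] where
  toFun p := .ofCoeff (Finsupp.onFinset p.coeff.support (fun m => (m : K) * p.coeff m)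
    fun m hm => Finsupp.mem_support_iff.2 (right_ne_zero_of_mul hm))
  map_zero' := LaurentPolynomial.ext fun m => by simp
  map_add' p q := LaurentPolynomial.ext fun m => by simp [mul_add]

@[simp] lemma coeff_eulerPoly (p : K[T;T⁻¹]) (m : ℤ) :
    (eulerPoly p).coeff m = (m : K) * p.coeff m := by
  simp [eulerPoly]

/-- The operator `w * d/dw`, as an additive map. -/
def eulerAdd : K[T;T⁻¹]⟦X⟧ →+ K[T;T⁻¹]⟦X⟧ where
  toFun f := PowerSeries.mk fun k => eulerPoly (coeff k f)
  map_zero' := by ext k : 1; simp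
  map_add' f g := by ext k : 1; simp

lemma slice_eulerAdd (m : ℤ) (f : K[T;T⁻¹]⟦X⟧) : slice m (eulerAdd f) = (m : K⟦X⟧) * slice m f := by
  ext k
  have : ((m : ℤ) : K⟦X⟧) = PowerSeries.C (m : K) := by simp
  rw [this, PowerSeries.coeff_C_mul]
  simp [eulerAdd]

lemma bcoeff_eulerAdd (f : K[T;T⁻¹]⟦X⟧) (a : ℤ × ℤ) :
    bcoeff (eulerAdd f) a = (a.1 : K) * bcoeff f a := by
  simp only [bcoeff, eulerAdd]
  split_ifs <;> simp

/-- The derivation `w * d/dw`. -/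
def euler : Derivation ℤ K[T;T⁻¹]⟦X⟧ K[T;T⁻¹]⟦X⟧ :=
  Derivation.mk' (eulerAdd (K := K)).toIntLinearMap fun f g => by
    apply bcoeff_ext
    intro p
    show bcoeff (eulerAdd (f * g)) p = bcoeff (f * eulerAdd g + g * eulerAdd f) p
    rw [bcoeff_eulerAdd, bcoeff_add, bcoeff_mul, bcoeff_mul f, mul_comm g, bcoeff_mul _ g,
      ← finsum_add_distrib (finite_support_bcoeff_mul _ _ _) (finite_support_bcoeff_mul _ _ _),
      mul_finsum]
    -- The weights of `a` and `p - a` add up to the weight of `p`.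
    refine finsum_congr fun a => ?_
    rw [bcoeff_eulerAdd, bcoeff_eulerAdd]
    simp
    ring

lemma slice_euler (m : ℤ) (f : K[T;T⁻¹]⟦X⟧) : slice m (euler f) = (m : K⟦X⟧) * slice m f :=
  slice_eulerAdd m f

lemma euler_eq_of_slice {f g : K[T;T⁻¹]⟦X⟧} (h : ∀ m : ℤ, slice m g = (m : K⟦X⟧) * slice m f) :
    euler f = g := slice_ext fun m => by rw [slice_euler, h]

@[simp] lemma euler_ofX (a : K⟦X⟧) : euler (ofX a : K[T;T⁻¹]⟦X⟧) = 0 := by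
  apply euler_eq_of_slice
  intro m
  have := slice_ofX_mul_wpow m 0 a
  rw [wpow_zero, mul_one] at this
  rw [this]
  split_ifs with h <;> simp [h]

@[simp] lemma euler_X : euler (X : K[T;T⁻¹]⟦X⟧) = 0 := by
  rw [← ofX_X, euler_ofX]

@[simp] lemma euler_wpow (j : ℤ) : euler (wpow j : K[T;T⁻¹]⟦X⟧) = (j : K[T;T⁻¹]⟦X⟧) * wpow j := by
  apply euler_eq_of_slice
  intro m
  have h1 : ∀ c : K⟦X⟧, slice m (ofX c * wpow j) = if m = j then c else 0 := fun c =>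
    slice_ofX_mul_wpow m j c
  have h2 := h1 1
  have h3 := h1 (j : K⟦X⟧)
  rw [map_one, one_mul] at h2
  rw [map_intCast] at h3
  rw [h2, h3]
  split_ifs with h <;> simp [h]

lemma Shift.euler {d : ℕ} {f f' : K[T;T⁻¹]⟦X⟧} (h : Shift d f f') :
    Shift d (euler f) (Kreweras.euler f') := fun a => by
  show bcoeff (eulerAdd f') _ = bcoeff (eulerAdd f) a
  rw [bcoeff_eulerAdd, bcoeff_eulerAdd, h a]

/-- The derivation `X * d/dX`. -/
def xderiv : Derivation ℤ K[T;T⁻¹]⟦X⟧ K[T;T⁻¹]⟦X⟧ :=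
  (X : K[T;T⁻¹]⟦X⟧) • (PowerSeries.derivative K[T;T⁻¹]).restrictScalars ℤ

lemma xderiv_X : xderiv (X : K[T;T⁻¹]⟦X⟧) = X := by
  simp [xderiv]

lemma xderiv_X_pow (n : ℕ) : xderiv (X ^ n : K[T;T⁻¹]⟦X⟧) =
    (n : K[T;T⁻¹]⟦X⟧) * (X : K[T;T⁻¹]⟦X⟧) ^ n := by
  rcases n with _ | n
  · simp
  · rw [Derivation.leibniz_pow, xderiv_X]
    simp [pow_succ]

@[simp] lemma xderiv_wpow (j : ℤ) : xderiv (wpow j : K[T;T⁻¹]⟦X⟧) = 0 := by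
  simp [xderiv, wpow]

lemma slice_xderiv (m : ℤ) (f : K[T;T⁻¹]⟦X⟧) :
    slice m (xderiv f) = X * PowerSeries.derivative K (slice m f) := by
  ext k
  rcases k with _ | k
  · simp [xderiv]
  · rw [coeff_slice, xderiv]
    simp only [Derivation.smul_apply, Derivation.restrictScalars_apply, smul_eq_mul]
    rw [coeff_succ_X_mul, coeff_succ_X_mul, PowerSeries.coeff_derivative,
      PowerSeries.coeff_derivative, coeff_slice]
    have : ((k : K[T;T⁻¹]) + 1) = LaurentPolynomial.C ((k : K) + 1) := by simp
    rw [this, mul_comm, ← LaurentPolynomial.smul_eq_C_mul]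
    simp [mul_comm]

/-- Derivations with `X ∣ D X` are `X`-adically continuous. This covers both `euler`, where `D X =
0`, and `xderiv`, where `D X = X`. -/
lemma derivation_dvd {D : Derivation ℤ K[T;T⁻¹]⟦X⟧ K[T;T⁻¹]⟦X⟧} (hD : (X : K[T;T⁻¹]⟦X⟧) ∣ D X)
    {f : K[T;T⁻¹]⟦X⟧} {N : ℕ} (h : (X : K[T;T⁻¹]⟦X⟧) ^ N ∣ f) :
    (X : K[T;T⁻¹]⟦X⟧) ^ N ∣ D f := by
  obtain ⟨g, rfl⟩ := h
  rw [Derivation.leibniz]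
  refine dvd_add (Dvd.intro _ rfl) ?_
  rw [smul_eq_mul]
  apply Dvd.dvd.mul_left
  rcases N with _ | N
  · simp
  · rw [Derivation.leibniz_pow, Nat.add_sub_cancel, smul_eq_mul, pow_succ]
    rw [nsmul_eq_mul]
    exact Dvd.dvd.mul_left (mul_dvd_mul_left _ hD) _

/-- A derivation applied to an infinite product. -/
lemma derivation_lim_prod {D : Derivation ℤ K[T;T⁻¹]⟦X⟧ K[T;T⁻¹]⟦X⟧} (hD : (X : K[T;T⁻¹]⟦X⟧) ∣ D X)
    {f g : ℕ → K[T;T⁻¹]⟦X⟧} (hf : ∀ n, (X : K[T;T⁻¹]⟦X⟧) ^ n ∣ f n - 1)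
    (hg : ∀ n, (X : K[T;T⁻¹]⟦X⟧) ^ n ∣ g n) (h : ∀ n, D (f n) = f n * g n) :
    D (lim fun N => ∏ n ∈ Finset.range N, f n) =
      lim (fun N => ∏ n ∈ Finset.range N, f n) * lsum g := by
  have hl : ∀ N, (X : K[T;T⁻¹]⟦X⟧) ^ N ∣
      ∏ n ∈ Finset.range (N + 1), f n - ∏ n ∈ Finset.range N, f n := fun N => by
    rw [Finset.prod_range_succ]
    have : ∀ a b : K[T;T⁻¹]⟦X⟧, a * b - a = a * (b - 1) := fun a b => by ring
    rw [this]
    exact Dvd.dvd.mul_left (hf N) _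
  have hfin : ∀ N, D (∏ n ∈ Finset.range N, f n) =
      (∏ n ∈ Finset.range N, f n) * ∑ n ∈ Finset.range N, g n := fun N => by
    induction N with
    | zero => simp
    | succ N ih =>
      rw [Finset.prod_range_succ, Finset.sum_range_succ, Derivation.leibniz, ih, h]
      simp only [smul_eq_mul]; ring
  refine eq_of_tendsto_eq (fun N => ?_) (fun N => ?_) hfin
  · rw [← map_sub]
    exact derivation_dvd hD (lim_spec hl N)
  · exact X_pow_dvd_mul_sub_mul (lim_spec hl N) (lsum_spec hg N)

/-- Evaluation at a nonzero constant `w = c`. -/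
def evalW (c : Kˣ) : K[T;T⁻¹]⟦X⟧ →+* K⟦X⟧ :=
  PowerSeries.map (LaurentPolynomial.eval₂ (RingHom.id K) c)

@[simp] lemma evalW_ofX (c : Kˣ) (a : K⟦X⟧) : evalW c (ofX a) = a := by
  ext k; simp [evalW, ofX]

@[simp] lemma evalW_X (c : Kˣ) : evalW c (X : K[T;T⁻¹]⟦X⟧) = X := by
  simp [evalW]

@[simp] lemma evalW_wpow (c : Kˣ) (j : ℤ) :
    evalW c (wpow j : K[T;T⁻¹]⟦X⟧) = PowerSeries.C ((c ^ j : Kˣ) : K) := by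
  rw [evalW, wpow, PowerSeries.map_C, LaurentPolynomial.eval₂_T]

lemma evalW_one_wpow (j : ℤ) : evalW 1 (wpow j : K[T;T⁻¹]⟦X⟧) = 1 := by simp

lemma evalW_lsum (c : Kˣ) (f : ℕ → K[T;T⁻¹]⟦X⟧) :
    evalW c (lsum f) = lsum fun n => evalW c (f n) := map_lsum _ _

/-- The substitution of `w⁻¹` for `w`. -/
def flip : K[T;T⁻¹]⟦X⟧ →+* K[T;T⁻¹]⟦X⟧ :=
  PowerSeries.map (LaurentPolynomial.invert (R := K) : K[T;T⁻¹] →+* K[T;T⁻¹])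

lemma slice_flip (m : ℤ) (f : K[T;T⁻¹]⟦X⟧) : slice m (flip f) = slice (-m) f := by
  ext k; simp [flip]

lemma evalW_flip (f : K[T;T⁻¹]⟦X⟧) : evalW 1 (flip f) = evalW 1 f := by
  have h : ∀ p : K[T;T⁻¹], LaurentPolynomial.eval₂ (RingHom.id K) 1 (LaurentPolynomial.invert p) =
      LaurentPolynomial.eval₂ (RingHom.id K) 1 p := fun p => by
    induction p using LaurentPolynomial.induction_on' with
    | add p q hp hq => rw [map_add, map_add, map_add, hp, hq]
    | C_mul_T n a => simp [LaurentPolynomial.eval₂_C_mul_T]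
  ext k
  simp [evalW, flip, h]

lemma euler_flip (f : K[T;T⁻¹]⟦X⟧) : euler (flip f) = -flip (euler f) :=
  slice_ext fun m => by
    rw [slice_euler, slice_flip, slice_neg, slice_flip, slice_euler]
    push_cast; ring

/-- The series with given coefficients of the powers of `w`. -/
def collect (g : ℤ → K⟦X⟧) : K[T;T⁻¹]⟦X⟧ :=
  ofX (g 0) + lsum fun n : ℕ =>
    ofX (g ((n : ℤ) + 1)) * wpow ((n : ℤ) + 1) + ofX (g (-((n : ℤ) + 1))) * wpow (-((n : ℤ) + 1))

lemma X_pow_dvd_ofX {a : K⟦X⟧} {N : ℕ} (h : (X : K⟦X⟧) ^ N ∣ a) :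
    (X : K[T;T⁻¹]⟦X⟧) ^ N ∣ ofX a := by
  obtain ⟨b, rfl⟩ := h
  rw [map_mul, map_pow, ofX_X]
  exact Dvd.intro _ rfl

lemma slice_collect {g : ℤ → K⟦X⟧} (hg : ∀ m : ℤ, (X : K⟦X⟧) ^ m.natAbs ∣ g m) (m : ℤ) :
    slice m (collect g) = g m := by
  have hd : ∀ n : ℕ, (X : K⟦X⟧) ^ n ∣ slice m (ofX (g ((n : ℤ) + 1)) * wpow ((n : ℤ) + 1) +
      ofX (g (-((n : ℤ) + 1))) * wpow (-((n : ℤ) + 1))) := fun n => by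
    apply X_pow_dvd_slice
    refine dvd_add (Dvd.dvd.mul_right (X_pow_dvd_ofX ?_) _)
      (Dvd.dvd.mul_right (X_pow_dvd_ofX ?_) _)
    · exact (pow_dvd_pow _ (by omega)).trans (hg _)
    · exact (pow_dvd_pow _ (by omega)).trans (hg _)
  have h0 := slice_ofX_mul_wpow m 0 (g 0)
  rw [wpow_zero, mul_one] at h0
  rw [collect, slice_add, slice_lsum, h0]
  rcases lt_trichotomy m 0 with hm | rfl | hm
  · rw [lsum_eq_single' hd (m.natAbs - 1)]
    · rw [slice_add, slice_ofX_mul_wpow, slice_ofX_mul_wpow, if_neg (by omega), if_neg (by omega),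
        if_pos (by omega), zero_add, zero_add]
      congr 1; omega
    · intro n hn
      rw [slice_add, slice_ofX_mul_wpow, slice_ofX_mul_wpow, if_neg (by omega), if_neg (by omega),
        add_zero]
  · rw [if_pos rfl]
    have : (fun n : ℕ => slice 0 (ofX (g ((n : ℤ) + 1)) * wpow ((n : ℤ) + 1) +
      ofX (g (-((n : ℤ) + 1))) * wpow (-((n : ℤ) + 1)))) = fun _ => (0 : K⟦X⟧) := by
      funext n
      rw [slice_add, slice_ofX_mul_wpow, slice_ofX_mul_wpow, if_neg (by omega), if_neg (by omega),
        add_zero]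
    rw [this, lsum_zero, add_zero]
  · rw [lsum_eq_single' hd (m.natAbs - 1)]
    · rw [slice_add, slice_ofX_mul_wpow, slice_ofX_mul_wpow, if_neg (by omega), if_pos (by omega),
        if_neg (by omega), zero_add, add_zero]
      congr 1; omega
    · intro n hn
      rw [slice_add, slice_ofX_mul_wpow, slice_ofX_mul_wpow, if_neg (by omega), if_neg (by omega),
        add_zero]

lemma evalW_one_collect (g : ℤ → K⟦X⟧) :
    evalW 1 (collect g) = g 0 + lsum fun n : ℕ => g ((n : ℤ) + 1) + g (-((n : ℤ) + 1)) := by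
  rw [collect, map_add, evalW_lsum, evalW_ofX]
  simp only [map_add, map_mul, evalW_ofX, evalW_one_wpow, mul_one]

end Operators

/-! ### Theta series and their quasi-periodicity -/

section Theta

variable {K : Type*} [Field K]

/-- The triangular numbers. -/
def tri (n : ℕ) : ℕ := n * (n + 1) / 2

lemma tri_succ (n : ℕ) : tri (n + 1) = tri n + (n + 1) := by
  have h : (n + 1) * (n + 1 + 1) = n * (n + 1) + 2 * (n + 1) := by ring
  rw [tri, tri, h, Nat.add_mul_div_left _ _ (by norm_num)]

lemma le_tri (n : ℕ) : n ≤ tri n := by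
  induction n with
  | zero => simp
  | succ n ih => rw [tri_succ]; omega

lemma mul_le_mul_tri {a b : ℕ} (h : a ≤ b) (n : ℕ) : a * n ≤ b * tri n :=
  Nat.mul_le_mul h (le_tri n)

/-- The summands of the theta series. -/
def thetaTerm (K : Type*) [Field K] (k a b n : ℕ) : K[T;T⁻¹]⟦X⟧ :=
  ofX ((-1) ^ n * (2 * (n : K⟦X⟧) + 1) ^ k * X ^ (b * tri n + a * (n + 1))) * wpow ((n : ℤ) + 1) -
    ofX ((-1) ^ n * (2 * (n : K⟦X⟧) + 1) ^ k * (-1) ^ k * X ^ (b * tri n - a * n)) * wpow (-(n : ℤ))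

/-- The series `T_k` with first argument `X ^ a * w` and second argument `X ^ b`. -/
def theta (K : Type*) [Field K] (k a b : ℕ) : K[T;T⁻¹]⟦X⟧ := lsum (thetaTerm K k a b)

/-- For a < b one has (a + 1)n ≤ b · tri n, so the truncated subtraction in `thetaTerm` is a genuine
one and leaves at least n. -/
lemma X_pow_dvd_thetaTerm {a b : ℕ} (h : a < b) (k n : ℕ) :
    (X : K[T;T⁻¹]⟦X⟧) ^ n ∣ thetaTerm K k a b n := by
  have h1 := le_tri n
  have h2 : (a + 1) * n ≤ b * tri n := mul_le_mul_tri h n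
  rw [add_mul] at h2
  have h3 : ∀ (c : K⟦X⟧) (e : ℕ) (j : ℤ), n ≤ e →
      (X : K[T;T⁻¹]⟦X⟧) ^ n ∣ ofX (c * X ^ e) * wpow j := fun c e j he =>
    Dvd.dvd.mul_right (X_pow_dvd_ofX (Dvd.dvd.mul_left (pow_dvd_pow _ he) _)) _
  refine dvd_sub (h3 _ _ _ ?_) (h3 _ _ _ ?_)
  · omega
  · omega

lemma slice_theta_succ {a b : ℕ} (h : a < b) (k n : ℕ) :
    slice ((n : ℤ) + 1) (theta K k a b) =
      (-1) ^ n * (2 * (n : K⟦X⟧) + 1) ^ k * X ^ (b * tri n + a * (n + 1)) := by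
  rw [theta, slice_lsum, lsum_eq_single' (fun i => X_pow_dvd_slice _ (X_pow_dvd_thetaTerm h k i)) n]
  · rw [thetaTerm, slice_sub, slice_ofX_mul_wpow, slice_ofX_mul_wpow, if_pos rfl,
      if_neg (by omega), sub_zero]
  · intro i hi
    rw [thetaTerm, slice_sub, slice_ofX_mul_wpow, slice_ofX_mul_wpow, if_neg (by omega),
      if_neg (by omega), sub_zero]

lemma slice_theta_neg {a b : ℕ} (h : a < b) (k n : ℕ) :
    slice (-(n : ℤ)) (theta K k a b) =
      -((-1) ^ n * (2 * (n : K⟦X⟧) + 1) ^ k * (-1) ^ k * X ^ (b * tri n - a * n)) := by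
  rw [theta, slice_lsum, lsum_eq_single' (fun i => X_pow_dvd_slice _ (X_pow_dvd_thetaTerm h k i)) n]
  · rw [thetaTerm, slice_sub, slice_ofX_mul_wpow, slice_ofX_mul_wpow, if_neg (by omega),
      if_pos rfl, zero_sub]
  · intro i hi
    rw [thetaTerm, slice_sub, slice_ofX_mul_wpow, slice_ofX_mul_wpow, if_neg (by omega),
      if_neg (by omega), sub_zero]

/-- The exponents of w in a theta series come in the two families n + 1 and -n, which together
exhaust ℤ. -/
lemma int_cases (P : ℤ → Prop) (h1 : ∀ n : ℕ, P ((n : ℤ) + 1)) (h2 : ∀ n : ℕ, P (-(n : ℤ))) (m : ℤ) : P m := by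
  rcases le_or_gt m 0 with h | h
  · have := h2 m.natAbs
    rwa [show (-(m.natAbs : ℤ)) = m by omega] at this
  · have := h1 (m.natAbs - 1)
    rwa [show (((m.natAbs - 1 : ℕ) : ℤ) + 1) = m by omega] at this

/-- The operator 2 w d/dw - 1 multiplies w^{n+1} by 2n + 1 and w^{-n} by -(2n + 1); this explains
the sign (-1)^k in T_k. -/
lemma theta_succ {a b : ℕ} (h : a < b) (k : ℕ) :
    theta K (k + 1) a b = 2 * euler (theta K k a b) - theta K k a b := by
  have h2 : ∀ m (f : K[T;T⁻¹]⟦X⟧), slice m (2 * f) = 2 * slice m f := fun m f => by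
    have := slice_ofX_mul m 2 f
    rwa [map_ofNat] at this
  apply slice_ext
  intro m
  rw [slice_sub, h2, slice_euler]
  induction m using int_cases with
  | h1 n => rw [slice_theta_succ h, slice_theta_succ h]; push_cast; ring
  | h2 n => rw [slice_theta_neg h, slice_theta_neg h]; push_cast; ring

lemma shift_theta {a b d : ℕ} (h : a + d < b) (k : ℕ) :
    Shift d (theta K k a b) (theta K k (a + d) b) := by
  have ha : a < b := by omega
  apply Shift.of_slice
  · intro n
    rcases n with _ | n
    · have h1 := slice_theta_neg (K := K) h k 0
      have h2 := slice_theta_neg (K := K) ha k 0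
      simp only [Nat.cast_zero, neg_zero] at h1 h2 ⊢
      rw [h1, h2]; simp
    · push_cast
      rw [slice_theta_succ h, slice_theta_succ ha]
      rw [show b * tri n + (a + d) * (n + 1) = d * (n + 1) + (b * tri n + a * (n + 1)) by ring,
        pow_add]
      ring
  · intro n
    rw [slice_theta_neg h, slice_theta_neg ha]
    have h1 : (a + d) * n ≤ b * tri n := mul_le_mul_tri h.le n
    rw [show b * tri n - a * n = d * n + (b * tri n - (a + d) * n) by rw [add_mul] at *; omega,
      pow_add]
    ring

/-- Once the shifts add up to the full nome X^b, the quasi-periodicity θ(X^b w) = -w⁻¹θ(w) appears: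
re-indexing by one uses tri (n + 1) = tri n + n + 1. -/
lemma shift_theta_last {a b d : ℕ} (h : a + d = b) (hd : 0 < d) :
    Shift d (theta K 0 a b) (-(wpow (-1) * theta K 0 0 b)) := by
  have ha : a < b := by omega
  have h0 : 0 < b := by omega
  have hz : slice (0 : ℤ) (theta K 0 a b) = -1 := by
    simpa [tri] using slice_theta_neg (K := K) ha 0 0
  have hz' : slice (0 : ℤ) (theta K 0 0 b) = -1 := by
    simpa [tri] using slice_theta_neg (K := K) h0 0 0
  have ho : slice (1 : ℤ) (theta K 0 0 b) = 1 := by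
    simpa [tri] using slice_theta_succ (K := K) h0 0 0
  apply Shift.of_slice
  · intro n
    rw [slice_neg, slice_wpow_mul, sub_neg_eq_add]
    rcases n with _ | n
    · simp [ho, hz]
    · have e : ((n + 1 : ℕ) : ℤ) = (n : ℤ) + 1 := by push_cast; rfl
      rw [slice_theta_succ h0, e, slice_theta_succ ha, tri_succ, ← h]
      have : (a + d) * (tri n + (n + 1)) + 0 * (n + 1 + 1) =
        d * (n + 1) + ((a + d) * tri n + a * (n + 1)) := by ring
      rw [this, pow_add]; ring
  · intro n
    rw [slice_neg, slice_wpow_mul, sub_neg_eq_add]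
    rcases n with _ | n
    · simp [ho, hz]
    · rw [slice_theta_neg ha, show (-((n + 1 : ℕ) : ℤ) + 1) = -n by push_cast; ring,
        slice_theta_neg h0, tri_succ, ← h]
      have : (a + d) * (tri n + (n + 1)) - a * (n + 1) = d * (n + 1) + (a + d) * tri n := by
        rw [show (a + d) * (tri n + (n + 1)) = d * (n + 1) + (a + d) * tri n + a * (n + 1) by ring]
        omega
      rw [this]; simp only [zero_mul, Nat.sub_zero]; rw [pow_add]; ring

lemma slice_one_theta {b : ℕ} (h : 0 < b) : slice (1 : ℤ) (theta K 0 0 b) = 1 := by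
  simpa [tri] using slice_theta_succ (K := K) h 0 0

end Theta

/-! ### Geometric series -/

section Geometric

variable {R : Type*} [CommRing R]

/-- The series `1 / (1 - y)`. -/
def ginv (y : R⟦X⟧) : R⟦X⟧ := invOfUnit (1 - y) 1

lemma one_sub_mul_ginv {y : R⟦X⟧} (hy : constantCoeff y = 0) : (1 - y) * ginv y = 1 :=
  mul_invOfUnit _ _ (by simp [hy])

lemma eq_ginv {y g : R⟦X⟧} (hy : constantCoeff y = 0) (h : (1 - y) * g = 1) : g = ginv y := by
  linear_combination (ginv y) * h - g * one_sub_mul_ginv hy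

lemma map_ginv {S : Type*} [CommRing S] (φ : R →+* S) {y : R⟦X⟧} (hy : constantCoeff y = 0) :
    PowerSeries.map φ (ginv y) = ginv (PowerSeries.map φ y) := by
  apply eq_ginv
  · rw [← coeff_zero_eq_constantCoeff_apply, coeff_map, coeff_zero_eq_constantCoeff_apply, hy,
      map_zero]
  · rw [← map_one (PowerSeries.map φ), ← map_sub, ← map_mul, one_sub_mul_ginv hy, map_one]

lemma constantCoeff_X_pow_mul {e : ℕ} (he : 0 < e) (u : R⟦X⟧) :
    constantCoeff ((X : R⟦X⟧) ^ e * u) = 0 := by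
  simp [he.ne']

lemma constantCoeff_X_pow {e : ℕ} (he : 0 < e) : constantCoeff ((X : R⟦X⟧) ^ e) = 0 := by
  simp [he.ne']

lemma lsum_pow {y : R⟦X⟧} (hy : constantCoeff y = 0) : lsum (fun n => y ^ n) = ginv y := by
  have hd : ∀ n, (X : R⟦X⟧) ^ n ∣ y ^ n := fun n => pow_dvd_pow_of_dvd (X_dvd_iff.2 hy) n
  apply lsum_eq
  intro N
  have h1 := geom_sum_mul_neg y N
  have h2 : ginv y - ∑ n ∈ Finset.range N, y ^ n = ginv y * y ^ N := by
    linear_combination (∑ i ∈ Finset.range N, y ^ i) * one_sub_mul_ginv hy - ginv y * h1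
  rw [h2]
  exact Dvd.dvd.mul_left (hd N) _

end Geometric

/-! ### Jacobi's triple product identity -/

section TripleProduct

variable {K : Type*} [Field K]

/-- The factors of the triple product with `u = X ^ a * w` and nome `X ^ b`. -/
def jacobiFactor (K : Type*) [Field K] (a b n : ℕ) : K[T;T⁻¹]⟦X⟧ :=
  (1 - X ^ (b * (n + 1))) * (1 - X ^ (b * (n + 1) + a) * wpow 1) *
    (1 - X ^ (b * (n + 1) - a) * wpow (-1))

/-- The infinite product in Jacobi's triple product identity, without its first factor. -/
def jacobiProd (K : Type*) [Field K] (a b : ℕ) : K[T;T⁻¹]⟦X⟧ :=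
  lim fun N => ∏ n ∈ Finset.range N, jacobiFactor K a b n

lemma X_pow_dvd_mul_sub_one {R : Type*} [CommRing R] {f g : R⟦X⟧} {N : ℕ}
    (hf : (X : R⟦X⟧) ^ N ∣ f - 1) (hg : (X : R⟦X⟧) ^ N ∣ g - 1) : (X : R⟦X⟧) ^ N ∣ f * g - 1 := by
  simpa using X_pow_dvd_mul_sub_mul hf hg

lemma X_pow_dvd_one_sub_sub_one {R : Type*} [CommRing R] (u : R⟦X⟧) {N e : ℕ} (h : N ≤ e) :
    (X : R⟦X⟧) ^ N ∣ (1 - X ^ e * u) - 1 := by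
  rw [show (1 - X ^ e * u) - 1 = -(X ^ e * u) by ring, dvd_neg]
  exact Dvd.dvd.mul_right (pow_dvd_pow _ h) _

lemma le_mul_succ_sub {a b : ℕ} (h : a ≤ b) (hb : 0 < b) (n : ℕ) : n ≤ b * (n + 1) - a := by
  have : n ≤ b * n := Nat.le_mul_of_pos_left n hb
  rw [mul_add, mul_one]; omega

lemma jacobiFactor_sub_one {a b : ℕ} (h : a ≤ b) (hb : 0 < b) (n : ℕ) :
    (X : K[T;T⁻¹]⟦X⟧) ^ n ∣ jacobiFactor K a b n - 1 := by
  have h1 := le_mul_succ_sub h hb n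
  refine X_pow_dvd_mul_sub_one (X_pow_dvd_mul_sub_one ?_ ?_) ?_
  · have := X_pow_dvd_one_sub_sub_one (1 : K[T;T⁻¹]⟦X⟧) (N := n) (e := b * (n + 1)) (by omega)
    rwa [mul_one] at this
  · exact X_pow_dvd_one_sub_sub_one _ (by omega)
  · exact X_pow_dvd_one_sub_sub_one _ h1

lemma X_pow_dvd_prod_succ_sub {R : Type*} [CommRing R] {f : ℕ → R⟦X⟧}
    (hf : ∀ n, (X : R⟦X⟧) ^ n ∣ f n - 1) (N : ℕ) :
    (X : R⟦X⟧) ^ N ∣ ∏ n ∈ Finset.range (N + 1), f n - ∏ n ∈ Finset.range N, f n := by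
  rw [Finset.prod_range_succ]
  have : ∀ a b : R⟦X⟧, a * b - a = a * (b - 1) := fun a b => by ring
  rw [this]
  exact Dvd.dvd.mul_left (hf N) _

lemma jacobiProd_spec {a b : ℕ} (h : a ≤ b) (hb : 0 < b) (N : ℕ) :
    (X : K[T;T⁻¹]⟦X⟧) ^ N ∣ jacobiProd K a b - ∏ n ∈ Finset.range N, jacobiFactor K a b n :=
  lim_spec (X_pow_dvd_prod_succ_sub (jacobiFactor_sub_one h hb)) N

lemma shift_X_pow_mul_wpow_one (d e : ℕ) :
    Shift d (X ^ e * wpow 1 : K[T;T⁻¹]⟦X⟧) (X ^ (e + d) * wpow 1) := by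
  have := (Shift.X_pow (K := K) (d := d) e).mul (Shift.wpow_natCast 1)
  simpa [pow_add, mul_assoc] using this

lemma shift_X_pow_mul_wpow_neg_one {d e : ℕ} (h : d ≤ e) :
    Shift d (X ^ e * wpow (-1) : K[T;T⁻¹]⟦X⟧) (X ^ (e - d) * wpow (-1)) := by
  have := (Shift.X_pow (K := K) (d := d) (e - d)).mul (Shift.wpow_neg_natCast 1)
  rw [mul_one, ← mul_assoc, ← pow_add, Nat.sub_add_cancel h] at this
  simpa using this

lemma shift_jacobiFactor {a b : ℕ} (h : a ≤ b) (n : ℕ) :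
    Shift a (jacobiFactor K 0 b n) (jacobiFactor K a b n) := by
  have h1 : a ≤ b * (n + 1) := h.trans (Nat.le_mul_of_pos_right _ (Nat.succ_pos n))
  exact ((Shift.one.sub (Shift.X_pow _)).mul
    (Shift.one.sub (shift_X_pow_mul_wpow_one _ _))).mul
      (Shift.one.sub (shift_X_pow_mul_wpow_neg_one h1))

lemma shift_jacobiProd {a b : ℕ} (h : a ≤ b) (hb : 0 < b) :
    Shift a (jacobiProd K 0 b) (jacobiProd K a b) :=
  Shift.of_dvd fun N => ⟨_, _, Shift.prod fun n _ => shift_jacobiFactor h n,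
    jacobiProd_spec (Nat.zero_le b) hb N, jacobiProd_spec h hb N⟩

/-- The shift w ↦ X^b w moves the factors of the truncated product to their neighbours, so only the
factors at the two ends change. -/
lemma prod_jacobiFactor_shifted (b N : ℕ) :
    (X ^ b * wpow 1 - 1) * (∏ n ∈ Finset.range N, jacobiFactor K b b n) *
        (wpow 1 - X ^ (b * N)) =
      -((1 - X ^ (b * (N + 1)) * wpow 1) *
        ((wpow 1 - 1) * ∏ n ∈ Finset.range N, jacobiFactor K 0 b n)) := by
  have hw := wpow_mul_wpow_neg (K := K) 1
  induction N with
  | zero => simp; ring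
  | succ N ih =>
    rw [Finset.prod_range_succ, Finset.prod_range_succ]
    have h1 : b * (N + 1) - b = b * N := by rw [mul_add, mul_one, Nat.add_sub_cancel]
    have h2 : jacobiFactor K b b N * wpow 1 =
        (1 - X ^ (b * (N + 1))) * (1 - X ^ (b * (N + 1 + 1)) * wpow 1) *
          (wpow 1 - X ^ (b * N)) := by
      rw [jacobiFactor, h1, show b * (N + 1) + b = b * (N + 1 + 1) by ring]
      linear_combination (-(1 - X ^ (b * (N + 1))) * (1 - X ^ (b * (N + 1 + 1)) * wpow 1) *
        X ^ (b * N)) * hw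
    have h3 : jacobiFactor K 0 b N * wpow 1 =
        (1 - X ^ (b * (N + 1))) * (1 - X ^ (b * (N + 1)) * wpow 1) *
          (wpow 1 - X ^ (b * (N + 1))) := by
      rw [jacobiFactor, Nat.sub_zero, add_zero]
      linear_combination (-(1 - X ^ (b * (N + 1))) * (1 - X ^ (b * (N + 1)) * wpow 1) *
        X ^ (b * (N + 1))) * hw
    have hu : IsUnit (wpow 1 : K[T;T⁻¹]⟦X⟧) := IsUnit.of_mul_eq_one _ hw
    apply hu.mul_right_cancel
    linear_combination (wpow 1 - X ^ (b * (N + 1))) * (1 - X ^ (b * (N + 1))) *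
      (1 - X ^ (b * (N + 1 + 1)) * wpow 1) * ih +
      (X ^ b * wpow 1 - 1) * (∏ n ∈ Finset.range N, jacobiFactor K b b n) *
        (wpow 1 - X ^ (b * (N + 1))) * h2 +
      (1 - X ^ (b * (N + 1 + 1)) * wpow 1) *
        ((wpow 1 - 1) * ∏ n ∈ Finset.range N, jacobiFactor K 0 b n) * h3

/-- The functional equation, read at w and w², expresses the coefficients of w⁰ and w² through that
of w. These are the only ones that the next factor of the product mixes into the coefficient of w.
-/
lemma slice_jacobi_finite_recursion {b : ℕ} (hb : 0 < b) (N : ℕ) {P P' : K[T;T⁻¹]⟦X⟧}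
    (hs : Shift b P P')
    (h : P' * (wpow 1 - X ^ (b * N)) = -((1 - X ^ (b * (N + 1)) * wpow 1) * P)) :
    slice 1 ((1 - X ^ (b * (N + 1))) * (1 - X ^ (b * (N + 1)) * wpow 1) *
      (1 - X ^ (b * (N + 1)) * wpow (-1)) * P) * (1 - X ^ (b * (N + 2))) =
    slice 1 P * ((1 - X ^ (b * (2 * N + 2))) * (1 - X ^ (b * (2 * N + 3)))) := by
  have hw := wpow_mul_wpow_neg (K := K) 1
  have hx : ∀ (m : ℤ) (e : ℕ) (f : K[T;T⁻¹]⟦X⟧), slice m (X ^ e * f) = X ^ e * slice m f :=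
    fun m e f => slice_X_pow_mul m e f
  have hrec : ∀ m : ℤ, slice m P' - X ^ (b * N) * slice (m + 1) P' =
      -(slice (m + 1) P - X ^ (b * (N + 1)) * slice m P) := fun m => by
    have h1 := congrArg (slice (m + 1)) h
    rw [show P' * (wpow 1 - X ^ (b * N)) = wpow 1 * P' - X ^ (b * N) * P' by ring,
      show (1 - X ^ (b * (N + 1)) * wpow 1) * P = P - X ^ (b * (N + 1)) * (wpow 1 * P) by ring,
      slice_neg, slice_sub, slice_sub, hx, hx, slice_wpow_mul, slice_wpow_mul,
      add_sub_cancel_right] at h1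
    exact h1
  have e0 : slice (0 : ℤ) P' = slice (0 : ℤ) P := by simpa using hs.slice_natCast 0
  have e1 : slice (1 : ℤ) P' = X ^ b * slice (1 : ℤ) P := by simpa using hs.slice_natCast 1
  have e2 : slice (2 : ℤ) P' = X ^ (b * 2) * slice (2 : ℤ) P := by simpa using hs.slice_natCast 2
  have r0 := hrec 0
  have r1 := hrec 1
  rw [zero_add, e0, e1] at r0
  rw [show (1 + 1 : ℤ) = 2 by norm_num, e1, e2] at r1
  set Y : K⟦X⟧ := X ^ b with hY
  have hpow : ∀ n, (X : K⟦X⟧) ^ (b * n) = Y ^ n := fun n => by rw [hY, ← pow_mul]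
  simp only [hpow] at r0 r1
  have hne : (1 - Y ^ (N + 1) : K⟦X⟧) ≠ 0 := by
    intro h0
    have := congrArg constantCoeff h0
    rw [← hpow] at this
    simp [hb.ne'] at this
  have hp0 : slice (0 : ℤ) P = -slice (1 : ℤ) P := by
    apply mul_left_cancel₀ hne
    linear_combination r0
  have hexp : (1 - X ^ (b * (N + 1))) * (1 - X ^ (b * (N + 1)) * wpow 1) *
      (1 - X ^ (b * (N + 1)) * wpow (-1)) * P =
      (P + X ^ (b * (N + 1)) * (X ^ (b * (N + 1)) * P) - X ^ (b * (N + 1)) * (wpow 1 * P)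
        - X ^ (b * (N + 1)) * (wpow (-1) * P)) -
      X ^ (b * (N + 1)) * (P + X ^ (b * (N + 1)) * (X ^ (b * (N + 1)) * P)
        - X ^ (b * (N + 1)) * (wpow 1 * P) - X ^ (b * (N + 1)) * (wpow (-1) * P)) := by
    linear_combination ((1 - X ^ (b * (N + 1))) * X ^ (b * (N + 1)) * X ^ (b * (N + 1)) * P) * hw
  rw [hexp]
  simp only [slice_sub, slice_add, hx, slice_wpow_mul, sub_self, sub_neg_eq_add]
  rw [show (1 + 1 : ℤ) = 2 by norm_num, hp0]
  simp only [hpow]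
  linear_combination (-(1 - Y ^ (N + 1)) * Y ^ (N + 1)) * r1

/-- With D(M) the product of 1 - X^{bk} over 1 ≤ k ≤ M, the recursion gives the coefficient exactly
as D(2N + 1)/D(N + 1), which tends to 1. -/
lemma X_pow_dvd_slice_jacobi_sub_one {b : ℕ} (hb : 0 < b) (N : ℕ) :
    (X : K⟦X⟧) ^ N ∣ slice 1 ((wpow 1 - 1) * ∏ n ∈ Finset.range N, jacobiFactor K 0 b n) - 1 := by
  set D : ℕ → K⟦X⟧ := fun M => ∏ k ∈ Finset.range M, (1 - X ^ (b * (k + 1))) with hD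
  have key : slice 1 ((wpow 1 - 1) * ∏ n ∈ Finset.range N, jacobiFactor K 0 b n) * D (N + 1) =
      D (2 * N + 1) := by
    induction N with
    | zero =>
      have h1 : slice (1 : ℤ) ((wpow 1 - 1) * 1 : K[T;T⁻¹]⟦X⟧) = 1 := by
        have := slice_wpow_mul 1 1 (1 : K[T;T⁻¹]⟦X⟧)
        rw [mul_one] at this ⊢
        rw [slice_sub, this, slice_one, slice_one]; simp
      rw [Finset.prod_range_zero, h1, one_mul]
    | succ N ih =>
      have hr := slice_jacobi_finite_recursion hb N
        (P := (wpow 1 - 1) * ∏ n ∈ Finset.range N, jacobiFactor K 0 b n)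
        (P' := (X ^ b * wpow 1 - 1) * ∏ n ∈ Finset.range N, jacobiFactor K b b n)
        (by
          have h1 := shift_X_pow_mul_wpow_one (K := K) b 0
          rw [pow_zero, one_mul, zero_add] at h1
          exact (h1.sub Shift.one).mul (Shift.prod fun n _ => shift_jacobiFactor le_rfl n))
        (prod_jacobiFactor_shifted b N)
      have hfac : (wpow 1 - 1) * ∏ n ∈ Finset.range (N + 1), jacobiFactor K 0 b n =
          (1 - X ^ (b * (N + 1))) * (1 - X ^ (b * (N + 1)) * wpow 1) *
      (1 - X ^ (b * (N + 1)) * wpow (-1)) *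
        ((wpow 1 - 1) * ∏ n ∈ Finset.range N, jacobiFactor K 0 b n) := by
        rw [Finset.prod_range_succ]
        simp only [jacobiFactor, Nat.sub_zero, add_zero]
        ring
      rw [hfac]
      have hd1 : D (N + 1 + 1) = D (N + 1) * (1 - X ^ (b * (N + 2))) := by
        simp only [hD]; rw [Finset.prod_range_succ]
      have hd2 : D (2 * (N + 1) + 1) =
          D (2 * N + 1) * (1 - X ^ (b * (2 * N + 2))) * (1 - X ^ (b * (2 * N + 3))) := by
        simp only [hD]
        rw [show 2 * (N + 1) + 1 = 2 * N + 1 + 1 + 1 by ring, Finset.prod_range_succ,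
          Finset.prod_range_succ]
      rw [hd1, hd2, ← ih]
      linear_combination D (N + 1) * hr
  have hf : ∀ n, (X : K⟦X⟧) ^ n ∣ (1 - X ^ (b * (n + 1))) - 1 := fun n => by
    have h1 : n ≤ b * (n + 1) := by
      have := Nat.le_mul_of_pos_left (n + 1) hb
      omega
    simpa using X_pow_dvd_one_sub_sub_one (1 : K⟦X⟧) h1
  have hl := fun M => lim_spec (F := D) (X_pow_dvd_prod_succ_sub hf) M
  have hdiff : (X : K⟦X⟧) ^ N ∣ D (2 * N + 1) - D (N + 1) :=
    X_pow_dvd_sub_trans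
      (X_pow_dvd_sub_symm ((pow_dvd_pow _ (by omega)).trans (hl (2 * N + 1))))
      ((pow_dvd_pow _ (by omega)).trans (hl (N + 1)))
  have hu : IsUnit (D (N + 1)) := by
    rw [PowerSeries.isUnit_iff_constantCoeff]
    simp [hD, map_prod, hb.ne']
  rw [← key] at hdiff
  rw [← hu.dvd_mul_right]
  convert hdiff using 1
  ring

/-- Both sides satisfy f(X^b w) = -w⁻¹f(w), which determines f by its coefficient of w, and that
coefficient is 1 on both sides. -/
lemma theta_zero_eq_prod {b : ℕ} (hb : 0 < b) :
    theta K 0 0 b = (wpow 1 - 1) * jacobiProd K 0 b := by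
  have hw := wpow_mul_wpow_neg (K := K) 1
  have hS0 : Shift b (wpow 1 : K[T;T⁻¹]⟦X⟧) (X ^ b * wpow 1) := by
    have h1 := shift_X_pow_mul_wpow_one (K := K) b 0
    rwa [pow_zero, one_mul, zero_add] at h1
  have hlim : (X ^ b * wpow 1 - 1) * jacobiProd K b b * wpow 1 =
      -((wpow 1 - 1) * jacobiProd K 0 b) := by
    refine eq_of_tendsto_eq (fun N => ?_) (fun N => ?_) (fun N => prod_jacobiFactor_shifted b N)
    · refine X_pow_dvd_mul_sub_mul ?_ ?_
      · rw [← mul_sub]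
        exact Dvd.dvd.mul_left (jacobiProd_spec le_rfl hb N) _
      · rw [sub_sub_cancel]
        exact pow_dvd_pow _ (Nat.le_mul_of_pos_left N hb)
    · rw [neg_sub_neg, ← one_mul ((wpow 1 - 1) * jacobiProd K 0 b)]
      refine X_pow_dvd_mul_sub_mul ?_ ?_
      · have : N ≤ b * (N + 1) := by
          have := Nat.le_mul_of_pos_left (N + 1) hb
          omega
        exact X_pow_dvd_one_sub_sub_one _ this
      · rw [← mul_sub]
        exact Dvd.dvd.mul_left (X_pow_dvd_sub_symm (jacobiProd_spec (Nat.zero_le b) hb N)) _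
  have hs : Shift b ((wpow 1 - 1) * jacobiProd K 0 b)
      (-(wpow (-1) * ((wpow 1 - 1) * jacobiProd K 0 b))) := by
    have h1 := (hS0.sub Shift.one).mul (shift_jacobiProd (K := K) le_rfl hb)
    convert h1 using 1
    linear_combination -wpow (-1) * hlim +
      ((X ^ b * wpow 1 - 1) * jacobiProd K b b) * hw
  have ht := shift_theta_last (K := K) (zero_add b) hb
  rw [← sub_eq_zero]
  refine Shift.eq_zero (d := b) (c := -1) (by simp) one_pos (i := 1) ?_ ?_
  · convert ht.sub hs using 1
    simp only [map_neg, map_one, Nat.cast_one]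
    ring
  · intro m h1 h2
    obtain rfl : m = 1 := le_antisymm h2 h1
    rw [slice_sub, sub_eq_zero, Nat.cast_one, slice_one_theta hb]
    refine (eq_of_forall_X_pow_dvd_sub fun N => ?_).symm
    refine X_pow_dvd_sub_trans ?_ (X_pow_dvd_slice_jacobi_sub_one hb N)
    rw [← slice_sub, ← mul_sub]
    exact X_pow_dvd_slice _ (Dvd.dvd.mul_left (jacobiProd_spec (Nat.zero_le b) hb N) _)

/-- Jacobi's triple product identity. -/
theorem theta_eq_prod {a b : ℕ} (h : a < b) :
    theta K 0 a b = (X ^ a * wpow 1 - 1) * jacobiProd K a b := by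
  have h1 := shift_theta (K := K) (a := 0) (d := a) (b := b) (by omega) 0
  rw [zero_add, theta_zero_eq_prod (by omega)] at h1
  have h2 := shift_X_pow_mul_wpow_one (K := K) a 0
  rw [pow_zero, one_mul, zero_add] at h2
  exact h1.eq ((h2.sub Shift.one).mul (shift_jacobiProd h.le (by omega)))

end TripleProduct

/-! ### Logarithmic derivatives of theta series and Lambert series -/

section LogDerivative

variable {K : Type*} [Field K]

lemma slice_natCast_mul (m : ℤ) (n : ℕ) (f : K[T;T⁻¹]⟦X⟧) :
    slice m ((n : K[T;T⁻¹]⟦X⟧) * f) = (n : K⟦X⟧) * slice m f := by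
  have := slice_ofX_mul m (n : K⟦X⟧) f
  rwa [map_natCast] at this

lemma map_evalW_ginv (c : Kˣ) {y : K[T;T⁻¹]⟦X⟧} (hy : constantCoeff y = 0) :
    evalW c (ginv y) = ginv (evalW c y) := map_ginv _ hy

/-- The heat equation: 8 tri n + 1 = (2n + 1)², so the exponent of X is governed by the square of
the weight that defines T_2. -/
lemma xderiv_theta {b : ℕ} (hb : 0 < b) :
    8 * xderiv (theta K 0 0 b) = (b : K[T;T⁻¹]⟦X⟧) * (theta K 2 0 b - theta K 0 0 b) := by
  have hx : ∀ e : ℕ, X * PowerSeries.derivative K (X ^ e : K⟦X⟧) = (e : K⟦X⟧) * X ^ e := fun e => by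
    rcases e with _ | e
    · simp
    · rw [Derivation.leibniz_pow]
      simp [pow_succ]
      ring
  have htri : ∀ n : ℕ, (8 * tri n + 1 : K⟦X⟧) = (2 * n + 1) ^ 2 := fun n => by
    have : 8 * tri n + 1 = (2 * n + 1) ^ 2 := by
      induction n with
      | zero => rfl
      | succ n ih => rw [tri_succ, mul_add, add_right_comm, ih]; ring
    exact_mod_cast congrArg (Nat.cast : ℕ → K⟦X⟧) this
  apply slice_ext
  intro m
  have h8 := slice_natCast_mul m 8 (xderiv (theta K 0 0 b))
  rw [Nat.cast_ofNat, Nat.cast_ofNat] at h8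
  rw [h8, slice_natCast_mul, slice_sub, slice_xderiv]
  have hsgn : ∀ (n : ℕ) (f : K⟦X⟧), PowerSeries.derivative K ((-1) ^ n * f) =
      (-1) ^ n * PowerSeries.derivative K f := fun n f => by
    rcases neg_one_pow_eq_or K⟦X⟧ n with h | h <;> simp [h]
  induction m using int_cases with
  | h1 n =>
    rw [slice_theta_succ hb, slice_theta_succ hb, zero_mul, add_zero, pow_zero, mul_one, hsgn]
    have := hx (b * tri n)
    push_cast at this
    linear_combination 8 * (-1) ^ n * this + (-1) ^ n * b * X ^ (b * tri n) * htri n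
  | h2 n =>
    rw [slice_theta_neg hb, slice_theta_neg hb, zero_mul, Nat.sub_zero, pow_zero, mul_one, pow_zero,
      mul_one, map_neg, hsgn]
    have := hx (b * tri n)
    push_cast at this
    linear_combination -8 * (-1) ^ n * this - (-1) ^ n * b * X ^ (b * tri n) * htri n

/-- The summands of the logarithmic derivative of a theta series with respect to the nome. -/
def lambertTerm (b n : ℕ) : K[T;T⁻¹]⟦X⟧ :=
  ((n : K[T;T⁻¹]⟦X⟧) + 1) * (X ^ (b * (n + 1)) * ginv (X ^ (b * (n + 1))) +
    X ^ (b * (n + 1)) * wpow 1 * ginv (X ^ (b * (n + 1)) * wpow 1) +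
    X ^ (b * (n + 1)) * wpow (-1) * ginv (X ^ (b * (n + 1)) * wpow (-1)))

lemma X_pow_dvd_lambertTerm {b : ℕ} (hb : 0 < b) (n : ℕ) :
    (X : K[T;T⁻¹]⟦X⟧) ^ n ∣ lambertTerm b n := by
  have h : n ≤ b * (n + 1) := by
    have := Nat.le_mul_of_pos_left (n + 1) hb
    omega
  have h1 := pow_dvd_pow (X : K[T;T⁻¹]⟦X⟧) h
  exact Dvd.dvd.mul_left (dvd_add (dvd_add (Dvd.dvd.mul_right h1 _)
    (Dvd.dvd.mul_right (Dvd.dvd.mul_right h1 _) _))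
    (Dvd.dvd.mul_right (Dvd.dvd.mul_right h1 _) _)) _

lemma xderiv_jacobiFactor {b : ℕ} (hb : 0 < b) (n : ℕ) :
    xderiv (jacobiFactor K 0 b n) =
      jacobiFactor K 0 b n * (-((b : K[T;T⁻¹]⟦X⟧) * lambertTerm b n)) := by
  have he : 0 < b * (n + 1) := by positivity
  set e := b * (n + 1) with hdef
  have hc : (e : K[T;T⁻¹]⟦X⟧) = b * (n + 1) := by rw [hdef]; push_cast; ring
  have g1 := one_sub_mul_ginv (constantCoeff_X_pow (R := K[T;T⁻¹]) he)
  have g2 := one_sub_mul_ginv (constantCoeff_X_pow_mul (R := K[T;T⁻¹]) he (wpow 1))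
  have g3 := one_sub_mul_ginv (constantCoeff_X_pow_mul (R := K[T;T⁻¹]) he (wpow (-1)))
  have hfac : jacobiFactor K 0 b n = (1 - X ^ e) * (1 - X ^ e * wpow 1) * (1 - X ^ e * wpow (-1)) := by
    rw [jacobiFactor, Nat.sub_zero, add_zero]
  have d1 : ∀ j : ℤ, xderiv (X ^ e * wpow j : K[T;T⁻¹]⟦X⟧) =
      (e : K[T;T⁻¹]⟦X⟧) * (X ^ e * wpow j) := fun j => by
    rw [Derivation.leibniz, xderiv_wpow, xderiv_X_pow]
    simp only [smul_eq_mul]; ring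
  rw [hfac, Derivation.leibniz, Derivation.leibniz, map_sub, map_sub, map_sub, d1, d1, xderiv_X_pow,
    Derivation.map_one_eq_zero]
  simp only [smul_eq_mul, lambertTerm, ← hdef]
  rw [hc]
  set A := ginv (X ^ e : K[T;T⁻¹]⟦X⟧)
  set B := ginv (X ^ e * wpow 1 : K[T;T⁻¹]⟦X⟧)
  set C := ginv (X ^ e * wpow (-1) : K[T;T⁻¹]⟦X⟧)
  linear_combination (b * (n + 1) * X ^ e * (1 - X ^ e * wpow 1) * (1 - X ^ e * wpow (-1))) * g1 +
    (b * (n + 1) * X ^ e * wpow 1 * (1 - X ^ e) * (1 - X ^ e * wpow (-1))) * g2 +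
    (b * (n + 1) * X ^ e * wpow (-1) * (1 - X ^ e) * (1 - X ^ e * wpow 1)) * g3

/-- The logarithmic derivative of a theta series with respect to the nome. -/
theorem theta_two_eq [CharZero K] {b : ℕ} (hb : 0 < b) :
    theta K 2 0 b = theta K 0 0 b * (1 - 8 * lsum (lambertTerm b)) := by
  have hX : (X : K[T;T⁻¹]⟦X⟧) ∣ xderiv X := by rw [xderiv_X]
  have hd := derivation_lim_prod hX (jacobiFactor_sub_one (K := K) (Nat.zero_le b) hb)
    (g := fun n => -((b : K[T;T⁻¹]⟦X⟧) * lambertTerm b n))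
    (fun n => (dvd_neg.2 (Dvd.dvd.mul_left (X_pow_dvd_lambertTerm hb n) _)))
    (xderiv_jacobiFactor hb)
  rw [lsum_neg, lsum_mul_left _ (X_pow_dvd_lambertTerm hb)] at hd
  -- The heat equation and the product formula give two expressions for the same derivative; the
  -- factor `wpow 1 - 1` of the product is constant in `X`.
  have ht := xderiv_theta (K := K) hb
  have hp := theta_zero_eq_prod (K := K) hb
  have hd' : xderiv (theta K 0 0 b) =
      theta K 0 0 b * -((b : K[T;T⁻¹]⟦X⟧) * lsum (lambertTerm b)) := by
    rw [hp, Derivation.leibniz, map_sub, xderiv_wpow, Derivation.map_one_eq_zero, sub_zero,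
      smul_zero, add_zero, smul_eq_mul]
    rw [show xderiv (jacobiProd K 0 b) = jacobiProd K 0 b *
      -((b : K[T;T⁻¹]⟦X⟧) * lsum (lambertTerm b)) from hd]
    ring
  have hb0 : (b : K[T;T⁻¹]⟦X⟧) ≠ 0 := by
    intro h0
    have h1 := slice_natCast_mul (K := K) 0 b 1
    rw [h0, zero_mul, slice_zero, slice_one, if_pos rfl, mul_one] at h1
    have h2 := congrArg constantCoeff h1
    rw [map_natCast, map_zero] at h2
    exact hb.ne' (by exact_mod_cast h2.symm)
  apply mul_left_cancel₀ hb0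
  linear_combination -ht + 8 * hd'

lemma evalW_one_theta_even {b : ℕ} (k : ℕ) (hk : Even k) : evalW 1 (theta K k 0 b) = 0 := by
  rw [theta, evalW_lsum]
  have : (fun n => evalW 1 (thetaTerm K k 0 b n)) = fun _ => 0 := by
    funext n
    simp [thetaTerm, hk.neg_one_pow]
  rw [this, lsum_zero]

/-- The Lambert series `∑ n ≥ 1, n * y ^ n / (1 - y ^ n)` with `y = X ^ b`. -/
def lambertP (K : Type*) [Field K] (b : ℕ) : K⟦X⟧ :=
  lsum fun n : ℕ => ((n : K⟦X⟧) + 1) * (X ^ (b * (n + 1)) * ginv (X ^ (b * (n + 1))))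

lemma evalW_one_lambertTerm {b : ℕ} (hb : 0 < b) :
    evalW 1 (lsum (lambertTerm (K := K) b)) = 3 * lambertP K b := by
  have hd : ∀ n : ℕ, (X : K⟦X⟧) ^ n ∣
      ((n : K⟦X⟧) + 1) * (X ^ (b * (n + 1)) * ginv (X ^ (b * (n + 1)))) := fun n => by
    have h : n ≤ b * (n + 1) := by
      have := Nat.le_mul_of_pos_left (n + 1) hb
      omega
    exact Dvd.dvd.mul_left (Dvd.dvd.mul_right (pow_dvd_pow _ h) _) _
  rw [evalW_lsum, lambertP, ← lsum_mul_left _ hd]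
  congr 1
  funext n
  have he : 0 < b * (n + 1) := by positivity
  simp only [lambertTerm, map_mul, map_add, map_natCast, map_one, map_pow, evalW_X,
    evalW_one_wpow, mul_one, map_evalW_ginv 1 (constantCoeff_X_pow (R := K[T;T⁻¹]) he),
    map_evalW_ginv 1 (constantCoeff_X_pow_mul (R := K[T;T⁻¹]) he _)]
  ring

/-- Apply w d/dw to `theta_two_eq` and set w = 1. Since T_0 and T_2 vanish there, the Lambert factor
is not differentiated, and 24 = 8 · 3 because its three parts coincide at w = 1. -/
theorem evalW_one_theta_three [CharZero K] {b : ℕ} (hb : 0 < b) :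
    evalW 1 (theta K 3 0 b) = evalW 1 (theta K 1 0 b) * (1 - 24 * lambertP K b) := by
  have h := congrArg (fun f => evalW 1 (euler f)) (theta_two_eq (K := K) hb)
  simp only [Derivation.leibniz, smul_eq_mul, map_add, map_mul, map_sub, map_one, map_ofNat,
    evalW_one_lambertTerm hb, evalW_one_theta_even (K := K) (b := b) 0 (by simp)] at h
  rw [theta_succ hb 2, theta_succ hb 0]
  simp only [map_sub, map_mul, map_ofNat, evalW_one_theta_even (K := K) (b := b) 0 (by simp),
    evalW_one_theta_even (K := K) (b := b) 2 (by simp)]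
  linear_combination 2 * h

lemma derivation_lsum {D : Derivation ℤ K[T;T⁻¹]⟦X⟧ K[T;T⁻¹]⟦X⟧}
    (hD : (X : K[T;T⁻¹]⟦X⟧) ∣ D X) {f : ℕ → K[T;T⁻¹]⟦X⟧}
    (hf : ∀ n, (X : K[T;T⁻¹]⟦X⟧) ^ n ∣ f n) : D (lsum f) = lsum fun n => D (f n) := by
  symm
  apply lsum_eq
  intro N
  rw [← map_sum, ← map_sub]
  exact derivation_dvd hD (lsum_spec hf N)

lemma euler_X_pow (e : ℕ) : euler (X ^ e : K[T;T⁻¹]⟦X⟧) = 0 := by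
  have := euler_ofX (X ^ e : K⟦X⟧)
  rwa [map_pow, ofX_X] at this

lemma euler_X_pow_mul_wpow (e : ℕ) (j : ℤ) :
    euler (X ^ e * wpow j : K[T;T⁻¹]⟦X⟧) = (j : K[T;T⁻¹]⟦X⟧) * (X ^ e * wpow j) := by
  rw [Derivation.leibniz, euler_wpow, euler_X_pow]
  simp only [smul_eq_mul]; ring

/-- With y = X^e w^j, the operator w d/dw acts as j · y d/dy, and y d/dy sends y/(1 - y) to y/(1 -
y)². -/
lemma euler_mul_ginv {e : ℕ} (he : 0 < e) (j : ℤ) :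
    euler (X ^ e * wpow j * ginv (X ^ e * wpow j) : K[T;T⁻¹]⟦X⟧) =
      (j : K[T;T⁻¹]⟦X⟧) * (X ^ e * wpow j * ginv (X ^ e * wpow j) ^ 2) := by
  have hg := one_sub_mul_ginv (constantCoeff_X_pow_mul (R := K[T;T⁻¹]) he (wpow j))
  have h1 := congrArg euler hg
  have h2 := euler_X_pow_mul_wpow (K := K) e j
  set y := (X ^ e * wpow j : K[T;T⁻¹]⟦X⟧)
  rw [Derivation.leibniz, map_sub, Derivation.map_one_eq_zero, h2] at h1
  simp only [smul_eq_mul] at h1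
  rw [Derivation.leibniz, h2]
  simp only [smul_eq_mul]
  linear_combination y * ginv y * h1 + (-y * euler (ginv y) - (j : K[T;T⁻¹]⟦X⟧) * y * ginv y) * hg

/-- Minus the second logarithmic derivative of a theta series with respect to `w`. -/
def weierstrass (K : Type*) [Field K] (a b : ℕ) : K[T;T⁻¹]⟦X⟧ :=
  X ^ a * wpow 1 * ginv (X ^ a * wpow 1) ^ 2 + lsum fun n : ℕ =>
    X ^ (b * (n + 1) + a) * wpow 1 * ginv (X ^ (b * (n + 1) + a) * wpow 1) ^ 2 +
    X ^ (b * (n + 1) - a) * wpow (-1) * ginv (X ^ (b * (n + 1) - a) * wpow (-1)) ^ 2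

lemma lt_mul_succ_sub {a b : ℕ} (h : a < b) (n : ℕ) : n < b * (n + 1) - a := by
  have : n ≤ b * n := Nat.le_mul_of_pos_left n (by omega)
  rw [mul_add, mul_one]; omega

lemma X_pow_dvd_of_le {R : Type*} [CommRing R] {n e : ℕ} (h : n ≤ e) (f g : R⟦X⟧) :
    (X : R⟦X⟧) ^ n ∣ X ^ e * f * g :=
  Dvd.dvd.mul_right (Dvd.dvd.mul_right (pow_dvd_pow _ h) _) _

/-- Writing z for T_0 and ′ for w d/dw, one has T_1 = 2z′ - z and T_2 = 4z″ - 4z′ + z, so the left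
side is 4(z′² - zz″) = -4z²(z′/z)′. The triple product gives z′/z as a sum. -/
theorem theta_one_sq_sub {a b : ℕ} (ha : 0 < a) (hab : a < b) :
    theta K 1 a b ^ 2 - theta K 0 a b * theta K 2 a b =
      4 * theta K 0 a b ^ 2 * weierstrass K a b := by
  have hb : 0 < b := by omega
  have hX : (X : K[T;T⁻¹]⟦X⟧) ∣ euler X := by rw [euler_X]; exact dvd_zero _
  set g : ℕ → K[T;T⁻¹]⟦X⟧ := fun n =>
    -(X ^ (b * (n + 1) + a) * wpow 1 * ginv (X ^ (b * (n + 1) + a) * wpow 1)) +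
    X ^ (b * (n + 1) - a) * wpow (-1) * ginv (X ^ (b * (n + 1) - a) * wpow (-1)) with hgdef
  have hg : ∀ n, (X : K[T;T⁻¹]⟦X⟧) ^ n ∣ g n := fun n => by
    have := lt_mul_succ_sub hab n
    exact dvd_add (dvd_neg.2 (X_pow_dvd_of_le (by omega) _ _)) (X_pow_dvd_of_le (by omega) _ _)
  have hfac : ∀ n, euler (jacobiFactor K a b n) = jacobiFactor K a b n * g n := fun n => by
    have h0 := lt_mul_succ_sub hab n
    have g2 := one_sub_mul_ginv (constantCoeff_X_pow_mul (R := K[T;T⁻¹])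
      (e := b * (n + 1) + a) (by omega) (wpow 1))
    have g3 := one_sub_mul_ginv (constantCoeff_X_pow_mul (R := K[T;T⁻¹])
      (e := b * (n + 1) - a) (by omega) (wpow (-1)))
    rw [jacobiFactor, Derivation.leibniz, Derivation.leibniz, map_sub, map_sub, map_sub,
      euler_X_pow_mul_wpow, euler_X_pow_mul_wpow, euler_X_pow, Derivation.map_one_eq_zero]
    simp only [smul_eq_mul, hgdef]
    push_cast
    set y := (X ^ (b * (n + 1) + a) * wpow 1 : K[T;T⁻¹]⟦X⟧)
    set z := (X ^ (b * (n + 1) - a) * wpow (-1) : K[T;T⁻¹]⟦X⟧)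
    set c := (X ^ (b * (n + 1)) : K[T;T⁻¹]⟦X⟧)
    linear_combination ((1 - c) * (1 - z) * y) * g2 - ((1 - c) * (1 - y) * z) * g3
  have hd : euler (jacobiProd K a b) = jacobiProd K a b * lsum g :=
    derivation_lim_prod hX (jacobiFactor_sub_one (K := K) hab.le hb) hg hfac
  have hp := theta_eq_prod (K := K) hab
  have g1 := one_sub_mul_ginv (constantCoeff_X_pow_mul (R := K[T;T⁻¹]) ha (wpow 1))
  -- `M` is the logarithmic derivative of `theta K 0 a b`; its first summand comes from the factor
  -- `X ^ a * wpow 1 - 1`.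
  set M := -(X ^ a * wpow 1 * ginv (X ^ a * wpow 1)) + lsum g with hM
  have h0 : euler (theta K 0 a b) = theta K 0 a b * M := by
    rw [hp, Derivation.leibniz, hd, map_sub, euler_X_pow_mul_wpow, Derivation.map_one_eq_zero]
    simp only [smul_eq_mul, hM]
    push_cast
    linear_combination -(jacobiProd K a b * (X ^ a * wpow 1)) * g1
  have hW : euler M = -weierstrass K a b := by
    rw [hM, map_add, map_neg, euler_mul_ginv ha, derivation_lsum hX hg, weierstrass, neg_add,
      ← lsum_neg]
    have e2 : (fun n => euler (g n)) = fun n : ℕ =>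
        -(X ^ (b * (n + 1) + a) * wpow 1 * ginv (X ^ (b * (n + 1) + a) * wpow 1) ^ 2 +
          X ^ (b * (n + 1) - a) * wpow (-1) * ginv (X ^ (b * (n + 1) - a) * wpow (-1)) ^ 2 :
            K[T;T⁻¹]⟦X⟧) := by
      funext n
      have := lt_mul_succ_sub hab n
      simp only [hgdef]
      rw [map_add, map_neg, euler_mul_ginv (by omega), euler_mul_ginv (by omega)]
      push_cast; ring
    rw [e2]
    push_cast
    rw [one_mul]
  rw [theta_succ hab 1, theta_succ hab 0, map_sub, Derivation.leibniz, h0]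
  simp only [smul_eq_mul]
  have h2 : euler (2 : K[T;T⁻¹]⟦X⟧) = 0 := by
    have := euler_ofX (2 : K⟦X⟧)
    rwa [map_ofNat] at this
  rw [h2, Derivation.leibniz, h0, hW]
  simp only [smul_eq_mul]
  clear_value M g
  generalize theta K 0 a b = z
  generalize weierstrass K a b = y
  ring

/-- `∑ m ≥ 1, m * (X ^ e * w) ^ m`. -/
def wseries (K : Type*) [Field K] (e : ℕ) : K[T;T⁻¹]⟦X⟧ :=
  collect fun m => if 0 < m then (m : K⟦X⟧) * X ^ (e * m.natAbs) else 0

lemma slice_wseries {e : ℕ} (he : 0 < e) (m : ℤ) :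
    slice m (wseries K e) = if 0 < m then (m : K⟦X⟧) * X ^ (e * m.natAbs) else 0 := by
  rw [wseries, slice_collect]
  intro m
  split_ifs
  · exact Dvd.dvd.mul_left (pow_dvd_pow _ (Nat.le_mul_of_pos_left _ he)) _
  · exact dvd_zero _

lemma wseries_eq {e : ℕ} (he : 0 < e) :
    wseries K e = X ^ e * wpow 1 * ginv (X ^ e * wpow 1) ^ 2 := by
  have hg := one_sub_mul_ginv (constantCoeff_X_pow_mul (R := K[T;T⁻¹]) he (wpow 1))
  have key : (1 - X ^ e * wpow 1) ^ 2 * wseries K e = X ^ e * wpow 1 := by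
    have h1 : (1 - X ^ e * wpow 1) ^ 2 * wseries K e =
        wseries K e - X ^ e * (wpow 1 * wseries K e) - X ^ e * (wpow 1 * wseries K e) +
          X ^ e * (X ^ e * (wpow 1 * (wpow 1 * wseries K e))) := by ring
    rw [h1]
    apply slice_ext
    intro m
    have h2 := slice_ofX_mul_wpow m 1 (X ^ e : K⟦X⟧)
    rw [map_pow, ofX_X] at h2
    simp only [slice_add, slice_sub, slice_X_pow_mul, slice_wpow_mul, slice_wseries he, h2]
    rcases lt_trichotomy m 1 with hm | rfl | hm
    · rw [if_neg (by omega), if_neg (by omega), if_neg (by omega), if_neg (by omega)]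
      simp
    · simp
    · obtain ⟨n, rfl⟩ : ∃ n : ℕ, m = n + 2 := ⟨(m - 2).toNat, by omega⟩
      rw [if_pos (by omega), if_pos (by omega), if_neg (show ¬ ((n : ℤ) + 2 = 1) by omega)]
      have e2 : ((n : ℤ) + 2).natAbs = n + 2 := by omega
      have e1 : ((n : ℤ) + 2 - 1).natAbs = n + 1 := by omega
      have e0 : ((n : ℤ) + 2 - 1 - 1).natAbs = n := by omega
      rw [e2, e1, e0]
      have h3 : (if (0 : ℤ) < (n : ℤ) + 2 - 1 - 1 then
          (((n : ℤ) + 2 - 1 - 1 : ℤ) : K⟦X⟧) * X ^ (e * n) else 0) = (n : K⟦X⟧) * X ^ (e * n) := by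
        split_ifs with h
        · push_cast; ring
        · obtain rfl : n = 0 := by omega
          simp
      rw [h3]
      push_cast
      ring
  linear_combination ginv (X ^ e * wpow 1) ^ 2 * key -
    wseries K e * (1 + (1 - X ^ e * wpow 1) * ginv (X ^ e * wpow 1)) * hg

lemma flip_wseries {e : ℕ} (he : 0 < e) :
    flip (wseries K e) = X ^ e * wpow (-1) * ginv (X ^ e * wpow (-1)) ^ 2 := by
  have hX : flip (X : K[T;T⁻¹]⟦X⟧) = X := by simp [flip]
  have hw : flip (wpow 1 : K[T;T⁻¹]⟦X⟧) = wpow (-1) := by simp [flip, wpow]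
  have hg : flip (ginv (X ^ e * wpow 1) : K[T;T⁻¹]⟦X⟧) = ginv (X ^ e * wpow (-1)) := by
    have h1 := map_ginv (R := K[T;T⁻¹])
      (LaurentPolynomial.invert (R := K) : K[T;T⁻¹] →+* K[T;T⁻¹])
      (constantCoeff_X_pow_mul (R := K[T;T⁻¹]) he (wpow 1))
    have h2 : flip (X ^ e * wpow 1 : K[T;T⁻¹]⟦X⟧) = X ^ e * wpow (-1) := by
      rw [map_mul, map_pow, hX, hw]
    rw [← h2]
    exact h1
  rw [wseries_eq he, map_mul, map_mul, map_pow, map_pow, hX, hw, hg]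

lemma weierstrass_eq {a b : ℕ} (ha : 0 < a) (hab : a < b) :
    weierstrass K a b = wseries K a + lsum fun n : ℕ =>
      wseries K (b * (n + 1) + a) + flip (wseries K (b * (n + 1) - a)) := by
  rw [weierstrass, wseries_eq ha]
  congr 2
  funext n
  have := lt_mul_succ_sub hab n
  rw [wseries_eq (by omega), flip_wseries (by omega)]

/-- Expanding each y/(1 - y)² as ∑ m y^m and collecting a fixed power of w leaves a geometric series
in the nome. The coefficients of x(w), and hence the solution, come from here. -/
lemma slice_weierstrass_succ {a b : ℕ} (ha : 0 < a) (hab : a < b) (n : ℕ) :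
    slice ((n : ℤ) + 1) (weierstrass K a b) =
      ((n : K⟦X⟧) + 1) * X ^ (a * (n + 1)) * ginv (X ^ (b * (n + 1))) := by
  have hb : 0 < b * (n + 1) := by
    have : 0 < b := by omega
    positivity
  have hna : ((n : ℤ) + 1).natAbs = n + 1 := by omega
  rw [weierstrass_eq ha hab, slice_add, slice_lsum, slice_wseries ha, if_pos (by omega)]
  have h1 : (fun i : ℕ => slice ((n : ℤ) + 1)
      (wseries K (b * (i + 1) + a) + flip (wseries K (b * (i + 1) - a)))) = fun i : ℕ =>
      (((n : K⟦X⟧) + 1) * X ^ ((a + b) * (n + 1))) * (X ^ (b * (n + 1))) ^ i := by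
    funext i
    have := lt_mul_succ_sub hab i
    rw [slice_add, slice_flip, slice_wseries (by omega), slice_wseries (by omega),
      if_pos (by omega), if_neg (by omega), hna, add_zero, ← pow_mul, mul_assoc, ← pow_add]
    push_cast
    congr 2
    ring
  have hd : ∀ i, (X : K⟦X⟧) ^ i ∣ (X ^ (b * (n + 1))) ^ i := fun i => by
    rw [← pow_mul]
    exact pow_dvd_pow _ (Nat.le_mul_of_pos_left i hb)
  rw [h1, lsum_mul_left _ hd, lsum_pow (constantCoeff_X_pow hb), hna]
  have hg := one_sub_mul_ginv (constantCoeff_X_pow (R := K) hb)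
  rw [add_mul a b, pow_add]
  push_cast
  linear_combination -(((n : K⟦X⟧) + 1) * X ^ (a * (n + 1))) * hg

lemma slice_weierstrass_neg {a b : ℕ} (ha : 0 < a) (hab : a < b) (n : ℕ) :
    slice (-((n : ℤ) + 1)) (weierstrass K a b) =
      ((n : K⟦X⟧) + 1) * X ^ ((b - a) * (n + 1)) * ginv (X ^ (b * (n + 1))) := by
  have hb : 0 < b * (n + 1) := by
    have : 0 < b := by omega
    positivity
  have hna : (-(-((n : ℤ) + 1))).natAbs = n + 1 := by omega
  rw [weierstrass_eq ha hab, slice_add, slice_lsum, slice_wseries ha, if_neg (by omega), zero_add]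
  have h1 : (fun i : ℕ => slice (-((n : ℤ) + 1))
      (wseries K (b * (i + 1) + a) + flip (wseries K (b * (i + 1) - a)))) = fun i : ℕ =>
      (((n : K⟦X⟧) + 1) * X ^ ((b - a) * (n + 1))) * (X ^ (b * (n + 1))) ^ i := by
    funext i
    have := lt_mul_succ_sub hab i
    rw [slice_add, slice_flip, slice_wseries (by omega), slice_wseries (by omega),
      if_neg (by omega), if_pos (by omega), hna, zero_add, ← pow_mul, mul_assoc, ← pow_add]
    push_cast
    congr 2
    · ring
    · have e1 : b * (i + 1) - a = (b - a) + b * i := by rw [mul_add, mul_one]; omega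
      rw [e1]; ring
  have hd : ∀ i, (X : K⟦X⟧) ^ i ∣ (X ^ (b * (n + 1))) ^ i := fun i => by
    rw [← pow_mul]
    exact pow_dvd_pow _ (Nat.le_mul_of_pos_left i hb)
  rw [h1, lsum_mul_left _ hd, lsum_pow (constantCoeff_X_pow hb)]

lemma slice_weierstrass_zero {a b : ℕ} (ha : 0 < a) (hab : a < b) :
    slice 0 (weierstrass K a b) = 0 := by
  rw [weierstrass_eq ha hab, slice_add, slice_lsum, slice_wseries ha, if_neg (by omega), zero_add]
  have h1 : (fun i : ℕ => slice 0
      (wseries K (b * (i + 1) + a) + flip (wseries K (b * (i + 1) - a)))) = fun _ => 0 := by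
    funext i
    have := lt_mul_succ_sub hab i
    rw [slice_add, slice_flip, slice_wseries (by omega), slice_wseries (by omega)]
    simp
  rw [h1, lsum_zero]

end LogDerivative

/-! ### Parametrization of the kernel by theta functions -/

section Kernel

variable {K : Type*} [Field K]

lemma Shift.trans {d e : ℕ} {f g h : K[T;T⁻¹]⟦X⟧} (h₁ : Shift d f g) (h₂ : Shift e g h) :
    Shift (d + e) f h := fun a => by
  rw [← h₁ a, ← h₂ (a.1, a.2 + d * a.1)]
  congr 2
  push_cast; ring

lemma constantCoeff_slice (m : ℤ) (f : K[T;T⁻¹]⟦X⟧) :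
    constantCoeff (slice m f) = (constantCoeff f).coeff m := by
  rw [← coeff_zero_eq_constantCoeff_apply, coeff_slice, coeff_zero_eq_constantCoeff_apply]

lemma constantCoeff_thetaTerm_zero (a b : ℕ) :
    constantCoeff (thetaTerm K 0 a b 0) = LaurentPolynomial.T 1 * 0 ^ a - 1 := by
  have h : thetaTerm K 0 a b 0 = X ^ a * wpow 1 - 1 := by
    simp [thetaTerm, tri]
  rw [h, map_sub, map_mul, map_pow, constantCoeff_X, map_one, wpow, constantCoeff_C, mul_comm]

lemma coeff_T (m j : ℤ) :
    (LaurentPolynomial.T j : K[T;T⁻¹]).coeff m = if j = m then 1 else 0 := by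
  rw [LaurentPolynomial.T, AddMonoidAlgebra.coeff_single, Finsupp.single_apply]

lemma T_two : (LaurentPolynomial.T 2 : K[T;T⁻¹]) = LaurentPolynomial.T 1 ^ 2 := by
  rw [show (2 : ℤ) = 1 + 1 by norm_num, LaurentPolynomial.T_add, sq]

lemma T_three : (LaurentPolynomial.T 3 : K[T;T⁻¹]) = LaurentPolynomial.T 1 ^ 3 := by
  rw [show (3 : ℤ) = 2 + 1 by norm_num, LaurentPolynomial.T_add, T_two]
  ring

lemma constantCoeff_theta (a b : ℕ) :
    constantCoeff (theta K 0 a b) = LaurentPolynomial.T 1 * 0 ^ a - 1 := by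
  rw [theta, constantCoeff_lsum, constantCoeff_thetaTerm_zero]

variable (K)

/-- The theta series with first argument `w` and nome `q ^ 3 = X ^ 9`. -/
def th0 : K[T;T⁻¹]⟦X⟧ := theta K 0 0 9

/-- The theta series with first argument `q * w` and nome `q ^ 3 = X ^ 9`. -/
def th3 : K[T;T⁻¹]⟦X⟧ := theta K 0 3 9

/-- The theta series with first argument `q ^ 2 * w` and nome `q ^ 3 = X ^ 9`. -/
def th6 : K[T;T⁻¹]⟦X⟧ := theta K 0 6 9

/-- The value of `w * d/dw` of `th0` at `w = 1`. -/
def der0 : K⟦X⟧ := evalW 1 (euler (th0 K))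

/-- The value of `th3` at `w = 1`. -/
def val3 : K⟦X⟧ := evalW 1 (th3 K)

/-- The value of `w * d/dw` of `th3` at `w = 1`. -/
def der3 : K⟦X⟧ := evalW 1 (euler (th3 K))

/-- The inverse of `th3`. -/
def inv3 : K[T;T⁻¹]⟦X⟧ := -ginv (1 + th3 K)

/-- The inverse of `th6`. -/
def inv6 : K[T;T⁻¹]⟦X⟧ := -ginv (1 + th6 K)

lemma shift_th0 : Shift 3 (th0 K) (th3 K) := shift_theta (by norm_num) 0

lemma shift_th3 : Shift 3 (th3 K) (th6 K) := shift_theta (by norm_num) 0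

lemma shift_th6 : Shift 3 (th6 K) (-(wpow (-1) * th0 K)) :=
  shift_theta_last (by norm_num) (by norm_num)

lemma constantCoeff_th0 : constantCoeff (th0 K) = LaurentPolynomial.T 1 - 1 := by
  rw [th0, constantCoeff_theta]; simp

lemma constantCoeff_th3 : constantCoeff (th3 K) = -1 := by
  rw [th3, constantCoeff_theta]; simp

lemma constantCoeff_th6 : constantCoeff (th6 K) = -1 := by
  rw [th6, constantCoeff_theta]; simp

lemma th3_mul_inv3 : th3 K * inv3 K = 1 := by
  have h := one_sub_mul_ginv (y := 1 + th3 K) (by rw [map_add, constantCoeff_th3]; simp)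
  rw [inv3]
  linear_combination h

lemma th6_mul_inv6 : th6 K * inv6 K = 1 := by
  have h := one_sub_mul_ginv (y := 1 + th6 K) (by rw [map_add, constantCoeff_th6]; simp)
  rw [inv6]
  linear_combination h

lemma shift_inv3 : Shift 3 (inv3 K) (inv6 K) := by
  have h3 := th3_mul_inv3 K
  have h6 := th6_mul_inv6 K
  have := (shift_th3 K).neg.inv (g := -inv3 K) (g' := -inv6 K)
    (by rw [X_dvd_iff, map_sub, map_neg, constantCoeff_th3]; simp)
    (by rw [X_dvd_iff, map_sub, map_neg, constantCoeff_th6]; simp)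
    (by linear_combination h3) (by linear_combination h6)
  simpa using this.neg

/-- Because of this symmetry, at w = 1 the series `th3` and `th6` have equal values and opposite
derivatives. -/
lemma flip_th3 : flip (th3 K) = th6 K := by
  apply slice_ext
  intro m
  rw [slice_flip, th3, th6]
  induction m using int_cases with
  | h1 n =>
    have h := slice_theta_neg (K := K) (show 3 < 9 by norm_num) 0 (n + 1)
    push_cast at h
    rw [slice_theta_succ (by norm_num), h, tri_succ, show 9 * (tri n + (n + 1)) - 3 * (n + 1) =
      9 * tri n + 6 * (n + 1) by omega]
    ring
  | h2 n =>
    rcases n with _ | n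
    · have h := slice_theta_neg (K := K) (show 3 < 9 by norm_num) 0 0
      have h' := slice_theta_neg (K := K) (show 6 < 9 by norm_num) 0 0
      simp only [Nat.cast_zero, neg_zero] at h h' ⊢
      rw [h, h']
    · rw [slice_theta_neg (by norm_num), neg_neg, tri_succ,
        show 9 * (tri n + (n + 1)) - 6 * (n + 1) = 9 * tri n + 3 * (n + 1) by omega]
      push_cast
      rw [slice_theta_succ (by norm_num)]
      ring

lemma evalW_th6 : evalW 1 (th6 K) = val3 K := by
  rw [← flip_th3, evalW_flip]; rfl

lemma evalW_euler_th6 : evalW 1 (euler (th6 K)) = -der3 K := by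
  rw [← flip_th3, euler_flip, map_neg, evalW_flip]; rfl

lemma evalW_th0 : evalW 1 (th0 K) = 0 := evalW_one_theta_even 0 (by simp)

lemma constantCoeff_evalW (c : Kˣ) (f : K[T;T⁻¹]⟦X⟧) : constantCoeff (evalW c f) =
    LaurentPolynomial.eval₂ (RingHom.id K) c (constantCoeff f) := by
  rw [← coeff_zero_eq_constantCoeff_apply, evalW, coeff_map, coeff_zero_eq_constantCoeff_apply]

lemma constantCoeff_val3 : constantCoeff (val3 K) = -1 := by
  rw [val3, constantCoeff_evalW, constantCoeff_th3]; simp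

lemma constantCoeff_euler (f : K[T;T⁻¹]⟦X⟧) :
    constantCoeff (euler f) = eulerPoly (constantCoeff f) := by
  rw [← coeff_zero_eq_constantCoeff_apply, ← coeff_zero_eq_constantCoeff_apply]
  show coeff 0 (eulerAdd f) = _
  simp [eulerAdd]

lemma eulerPoly_T (j : ℤ) : eulerPoly (LaurentPolynomial.T j : K[T;T⁻¹]) =
    LaurentPolynomial.C (j : K) * LaurentPolynomial.T j := by
  have h := constantCoeff_euler K (wpow j)
  rw [euler_wpow] at h
  simpa [wpow] using h.symm

lemma eulerPoly_one : eulerPoly (1 : K[T;T⁻¹]) = 0 := by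
  have h := eulerPoly_T K 0
  simpa using h

lemma constantCoeff_der0 : constantCoeff (der0 K) = 1 := by
  rw [der0, constantCoeff_evalW, constantCoeff_euler, constantCoeff_th0, map_sub, eulerPoly_T,
    eulerPoly_one]
  simp

lemma constantCoeff_der3 : constantCoeff (der3 K) = 0 := by
  rw [der3, constantCoeff_evalW, constantCoeff_euler, constantCoeff_th3, map_neg, eulerPoly_one]
  simp

/-- The length variable as a series in the cube root `X` of the nome. -/
def tser : K⟦X⟧ := X * (der0 K * (6 * der3 K - val3 K)⁻¹)

lemma tser_mul : tser K * (6 * der3 K - val3 K) = X * der0 K := by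
  have h : constantCoeff (6 * der3 K - val3 K) ≠ 0 := by
    rw [map_sub, map_mul, constantCoeff_val3, constantCoeff_der3]; simp
  rw [tser, mul_assoc, mul_assoc, PowerSeries.inv_mul_cancel _ h, mul_one]

lemma der0_ne_zero : der0 K ≠ 0 := fun h => by
  have := constantCoeff_der0 K
  rw [h, map_zero] at this
  exact zero_ne_one this

lemma val3_ne_zero : val3 K ≠ 0 := fun h => by
  have := constantCoeff_val3 K
  rw [h, map_zero] at this
  exact neg_ne_zero.2 one_ne_zero this.symm

lemma shift_wpow_one (d : ℕ) : Shift d (wpow 1 : K[T;T⁻¹]⟦X⟧) (X ^ d * wpow 1) := by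
  simpa using Shift.wpow_natCast (K := K) (d := d) 1

lemma wpow_one_mul_neg_one : (wpow 1 * wpow (-1) : K[T;T⁻¹]⟦X⟧) = 1 := wpow_mul_wpow_neg 1

lemma ofX_injective : Function.Injective (ofX : K⟦X⟧ →+* K[T;T⁻¹]⟦X⟧) := fun a b h => by
  have := congrArg (evalW 1) h
  simpa using this

/-- The brackets on both sides satisfy f(X³w) = -X³w⁻¹f(w), hence are proportional. The constant of
proportionality is what dictates the formula for t in terms of the nome. -/
theorem kernel_theta : ofX (tser K) *
    (-(wpow 1 * th3 K ^ 3) + wpow 1 ^ 2 * th6 K ^ 3 + X ^ 3 * th0 K ^ 3) =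
      X * (-(wpow 1 * th3 K * th6 K * th0 K)) := by
  set z := th0 K with hz
  set p := th3 K with hp
  set p' := th6 K with hp'
  set w := (wpow 1 : K[T;T⁻¹]⟦X⟧) with hw
  set v := (wpow (-1) : K[T;T⁻¹]⟦X⟧) with hv
  have hwv : w * v = 1 := wpow_one_mul_neg_one K
  set H1 := -(w * p ^ 3) + w ^ 2 * p' ^ 3 + X ^ 3 * z ^ 3 with hH1
  set H2 := -(w * p * p' * z) with hH2
  have sz := shift_th0 K
  have sp := shift_th3 K
  have sp' := shift_th6 K
  have sw := shift_wpow_one K 3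
  have sX := Shift.X_pow (K := K) (d := 3) 3
  have s1 : Shift 3 H1 (ofX (-X ^ 3) * (wpow (-1) * H1)) := by
    have := ((sw.mul (sp.pow 3)).neg.add ((sw.pow 2).mul (sp'.pow 3))).add (sX.mul (sz.pow 3))
    convert this using 1
    rw [map_neg, map_pow, ofX_X, hH1]
    linear_combination (X ^ 3 * p ^ 3 - X ^ 3 * w * p' ^ 3 +
      X ^ 6 * z ^ 3 * (w * v + 1) * v) * hwv
  have s2 : Shift 3 H2 (ofX (-X ^ 3) * (wpow (-1) * H2)) := by
    have := (((sw.mul sp).mul sp').mul sz).neg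
    convert this using 1
    rw [map_neg, map_pow, ofX_X, hH2]
    ring
  set σ1 := slice 1 H1 with hσ1
  set σ2 := slice 1 H2 with hσ2
  have hσ2n : σ2 ≠ 0 := fun h0 => by
    have h1 : constantCoeff σ2 = 1 := by
      rw [hσ2, constantCoeff_slice, hH2]
      simp only [map_neg, map_mul, hp, hp', hz, constantCoeff_th0, constantCoeff_th3,
        constantCoeff_th6, hw, wpow]
      have : -(constantCoeff (C (LaurentPolynomial.T 1 : K[T;T⁻¹])) * -1 * -1 *
          (LaurentPolynomial.T 1 - 1)) = LaurentPolynomial.T 1 - LaurentPolynomial.T 2 := by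
        rw [T_two, constantCoeff_C]
        ring
      rw [this, AddMonoidAlgebra.coeff_sub, Finsupp.sub_apply, coeff_T, coeff_T]
      norm_num
    rw [h0, map_zero] at h1
    exact zero_ne_one h1
  have hlin : ofX σ2 * H1 = ofX σ1 * H2 := by
    rw [← sub_eq_zero]
    have hc : (-X ^ 3 : K⟦X⟧) ≠ 0 := neg_ne_zero.2 (pow_ne_zero _ X_ne_zero)
    refine Shift.eq_zero (d := 3) hc one_pos ?_ ?_
    · have := ((Shift.const σ2).mul s1).sub ((Shift.const σ1).mul s2)
      convert this using 1
      push_cast; ring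
    · intro m h1 h2
      obtain rfl : m = 1 := by omega
      rw [slice_sub, slice_ofX_mul, slice_ofX_mul]
      push_cast
      rw [← hσ1, ← hσ2]; ring
  -- Both series vanish at w = 1, so their ratio is read off from the first derivatives there, which
  -- are -`val3`² (6 `der3` - `val3`) and -`val3`² `der0`.
  have hev := congrArg (fun f => evalW 1 (euler f)) hlin
  have e0 : evalW 1 z = 0 := evalW_th0 K
  have e3 : evalW 1 p = val3 K := rfl
  have e6 : evalW 1 p' = val3 K := evalW_th6 K
  have d0 : evalW 1 (euler z) = der0 K := rfl
  have d3 : evalW 1 (euler p) = der3 K := rfl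
  have d6 : evalW 1 (euler p') = -der3 K := evalW_euler_th6 K
  have dw : euler w = w := by rw [hw, euler_wpow]; simp
  have ew : evalW 1 w = 1 := evalW_one_wpow 1
  have dX : euler (X ^ 3 : K[T;T⁻¹]⟦X⟧) = 0 := euler_X_pow 3
  simp only [hH1, hH2, Derivation.leibniz, Derivation.leibniz_pow, euler_ofX, map_add, map_neg, smul_eq_mul,
    map_mul, map_pow, evalW_ofX, nsmul_eq_mul, map_natCast, dw, ew, dX, e0, e3, e6, d0, d3, d6] at hev
  have hv3 := val3_ne_zero K
  have hd0 := der0_ne_zero K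
  have h1 : σ2 * (6 * der3 K - val3 K) = σ1 * der0 K := by
    apply mul_left_cancel₀ (pow_ne_zero 2 hv3)
    push_cast at hev
    linear_combination -hev
  have h2 : tser K * σ1 = X * σ2 := by
    apply mul_right_cancel₀ hd0
    linear_combination σ2 * tser_mul K - tser K * h1
  have h3 : ofX (tser K) * ofX σ1 = X * ofX σ2 := by
    rw [← map_mul, h2, map_mul, ofX_X]
  have h4 : (ofX σ2 : K[T;T⁻¹]⟦X⟧) ≠ 0 := fun h => hσ2n (ofX_injective K (by rw [h, map_zero]))
  apply mul_left_cancel₀ h4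
  linear_combination ofX (tser K) * hlin + H2 * h3

/-- One of the two roots of the kernel. -/
def root0 : K[T;T⁻¹]⟦X⟧ := X * th6 K * th0 K * inv3 K ^ 2

/-- The other root of the kernel. -/
def root1 : K[T;T⁻¹]⟦X⟧ := -(X * wpow (-1) * th0 K * th3 K * inv6 K ^ 2)

/-- The second coordinate of the curve is the translate of the first by q; this turns the functional
equation into a q-difference equation in w. -/
lemma shift_root : Shift 3 (root0 K) (root1 K) := by
  have hX : Shift 3 (X : K[T;T⁻¹]⟦X⟧) X := by simpa using Shift.X_pow (K := K) (d := 3) 1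
  have := ((hX.mul (shift_th6 K)).mul (shift_th0 K)).mul ((shift_inv3 K).pow 2)
  rw [root0, root1]
  convert this using 1
  ring

/-- `kernel_theta` times a monomial in X, w, `th0`, `inv3` and `inv6`: the three summands of the
kernel correspond to the three cubes of theta series. -/
theorem kernel_root : ofX (tser K) * (root0 K ^ 2 * root1 K ^ 2 + root0 K + root1 K) =
    root0 K * root1 K := by
  have h := kernel_theta K
  have h3 := th3_mul_inv3 K
  have h6 := th6_mul_inv6 K
  have hw := wpow_one_mul_neg_one K
  rw [root0, root1]
  set z := th0 K
  set p := th3 K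
  set p' := th6 K
  set i := inv3 K
  set i' := inv6 K
  set w := (wpow 1 : K[T;T⁻¹]⟦X⟧)
  set v := (wpow (-1) : K[T;T⁻¹]⟦X⟧)
  set t := (ofX (tser K) : K[T;T⁻¹]⟦X⟧)
  have e1 : (X * p' * z * i ^ 2) ^ 2 * (-(X * v * z * p * i' ^ 2)) ^ 2 + X * p' * z * i ^ 2 +
      -(X * v * z * p * i' ^ 2) = X * z * v ^ 2 * i ^ 2 * i' ^ 2 *
        (-(w * p ^ 3) + w ^ 2 * p' ^ 3 + X ^ 3 * z ^ 3) := by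
    have a1 : (p * i) ^ 2 = 1 := by rw [h3, one_pow]
    have a2 : (p' * i') ^ 2 = 1 := by rw [h6, one_pow]
    have a3 : (w * v) ^ 2 = 1 := by rw [hw, one_pow]
    have b1 : (X * p' * z * i ^ 2) ^ 2 * (-(X * v * z * p * i' ^ 2)) ^ 2 =
        X ^ 4 * z ^ 4 * v ^ 2 * i ^ 2 * i' ^ 2 * ((p * i) ^ 2 * (p' * i') ^ 2) := by ring
    have b2 : X * z * v ^ 2 * i ^ 2 * i' ^ 2 *
        (-(w * p ^ 3) + w ^ 2 * p' ^ 3 + X ^ 3 * z ^ 3) =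
        -(X * v * z * p * i' ^ 2) * ((w * v) * (p * i) ^ 2) +
          X * p' * z * i ^ 2 * ((w * v) ^ 2 * (p' * i') ^ 2) +
          X ^ 4 * z ^ 4 * v ^ 2 * i ^ 2 * i' ^ 2 := by ring
    rw [b1, b2, a1, a2, a3, hw]; ring
  have e2 : X * z * v ^ 2 * i ^ 2 * i' ^ 2 * (X * (-(w * p * p' * z))) =
      -(X ^ 2 * z ^ 2 * v * i * i') * ((w * v) * (p * i) * (p' * i')) := by ring
  have e3 : X * p' * z * i ^ 2 * -(X * v * z * p * i' ^ 2) =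
      -(X ^ 2 * z ^ 2 * v * i * i') * ((p * i) * (p' * i')) := by ring
  rw [e1, e3, mul_left_comm, h, e2, h3, h6, hw]
  ring

/-- `(θ f) ^ 2 - f * θ (θ f)` where `θ = w * d/dw`. -/
def wronsk (f : K[T;T⁻¹]⟦X⟧) : K[T;T⁻¹]⟦X⟧ := euler f ^ 2 - f * euler (euler f)

variable {K} in
lemma Shift.wronsk {d : ℕ} {f g : K[T;T⁻¹]⟦X⟧} (h : Shift d f g) :
    Shift d (wronsk K f) (Kreweras.wronsk K g) :=
  (h.euler.pow 2).sub (h.mul h.euler.euler)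

lemma wronsk_wpow_mul (f : K[T;T⁻¹]⟦X⟧) :
    wronsk K (-(wpow (-1) * f)) = wpow (-1) ^ 2 * wronsk K f := by
  have h : euler (wpow (-1) : K[T;T⁻¹]⟦X⟧) = -wpow (-1) := by rw [euler_wpow]; simp
  simp only [wronsk, map_neg, Derivation.leibniz, smul_eq_mul, h, map_add]
  ring

lemma wronsk_th3 [CharZero K] : wronsk K (th3 K) = th3 K ^ 2 * weierstrass K 3 9 := by
  have h := theta_one_sq_sub (K := K) (a := 3) (b := 9) (by norm_num) (by norm_num)
  have h2 : euler (2 : K[T;T⁻¹]⟦X⟧) = 0 := by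
    have := euler_ofX (2 : K⟦X⟧)
    rwa [map_ofNat] at this
  rw [theta_succ (by norm_num) 1, theta_succ (by norm_num) 0, map_sub, Derivation.leibniz, h2] at h
  change (2 * euler (th3 K) - th3 K) ^ 2 - th3 K * (2 * ((2 : K[T;T⁻¹]⟦X⟧) • euler (euler (th3 K)) +
    euler (th3 K) • 0 - euler (th3 K)) - (2 * euler (th3 K) - th3 K)) =
      4 * th3 K ^ 2 * weierstrass K 3 9 at h
  simp only [smul_eq_mul] at h
  have h4 : (4 : K[T;T⁻¹]⟦X⟧) ≠ 0 := by
    intro h0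
    have := congrArg (evalW 1) h0
    rw [map_ofNat, map_zero] at this
    have h1 := congrArg constantCoeff this
    rw [map_ofNat, map_zero] at h1
    exact (Nat.cast_ne_zero (R := K)).2 four_ne_zero (by exact_mod_cast h1)
  apply mul_left_cancel₀ h4
  rw [wronsk]
  linear_combination h

/-- An addition theorem. The series wθ(w)², w²θ(qw)θ(q²w) and w times the Wronskian of θ all satisfy
f(X⁹w) = X⁹w⁻²f(w), which leaves at most two degrees of freedom, so they are linearly dependent.
Replacing w by qw gives the form needed for `root0`. -/
theorem wronsk_th0 : ofX (val3 K ^ 2) * wronsk K (th3 K) =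
    ofX (evalW 1 (wronsk K (th3 K))) * th3 K ^ 2 -
      X ^ 3 * ofX (der0 K ^ 2) * th6 K * th0 K := by
  have hwv : (wpow 1 * wpow (-1) : K[T;T⁻¹]⟦X⟧) = 1 := wpow_one_mul_neg_one K
  have sz := shift_th0 K
  have sp := shift_th3 K
  have sp' := shift_th6 K
  have sw := shift_wpow_one K 3
  have sw9 := shift_wpow_one K 9
  set z := th0 K with hz
  set p := th3 K with hp
  set p' := th6 K with hp'
  set w := (wpow 1 : K[T;T⁻¹]⟦X⟧) with hw
  set v := (wpow (-1) : K[T;T⁻¹]⟦X⟧) with hv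
  have hv2 : (wpow (-2 : ℤ) : K[T;T⁻¹]⟦X⟧) = v ^ 2 := by
    rw [show (-2 : ℤ) = -1 + -1 by norm_num, wpow_add, ← hv]; ring
  have sz9 : Shift 9 z (-(v * z)) := (sz.trans sp).trans sp'
  have sq9 : Shift 9 (w ^ 2 * p * p') (X ^ 9 * p * p') := by
    have a1 : Shift 3 (w ^ 2 * p * p') (-(X ^ 6 * w * p' * z)) := by
      have := ((sw.pow 2).mul sp).mul sp'
      convert this using 1
      linear_combination (X ^ 6 * w * p' * z) * hwv
    have a2 : Shift 3 (-(X ^ 6 * w * p' * z)) (X ^ 9 * z * p) := by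
      have := ((((Shift.X_pow (K := K) (d := 3) 6).mul sw).mul sp').mul sz).neg
      convert this using 1
      linear_combination (-X ^ 9 * z * p) * hwv
    have a3 : Shift 3 (X ^ 9 * z * p) (X ^ 9 * p * p') :=
      ((Shift.X_pow (K := K) (d := 3) 9).mul sz).mul sp
    exact (a1.trans a2).trans a3
  set A := w * z ^ 2 with hA
  set B := w ^ 2 * p * p' with hB
  set Y := w * wronsk K z with hY
  have sA : Shift 9 A (ofX (X ^ 9) * (wpow (-(2 : ℕ)) * A)) := by
    have := sw9.mul (sz9.pow 2)
    convert this using 1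
    push_cast
    rw [hv2, map_pow, ofX_X, hA]
    ring
  have sB : Shift 9 B (ofX (X ^ 9) * (wpow (-(2 : ℕ)) * B)) := by
    convert sq9 using 1
    push_cast
    rw [hv2, map_pow, ofX_X, hB]
    linear_combination (X ^ 9 * p * p' * (w * v + 1)) * hwv
  have sY : Shift 9 Y (ofX (X ^ 9) * (wpow (-(2 : ℕ)) * Y)) := by
    have := sw9.mul sz9.wronsk
    convert this using 1
    push_cast
    rw [hv2, map_pow, ofX_X, hY, wronsk_wpow_mul]
    ring
  set a1 := slice 1 A with ha1
  set a2 := slice 2 A with ha2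
  set b1 := slice 1 B with hb1
  set b2 := slice 2 B with hb2
  set y1 := slice 1 Y with hy1
  set y2 := slice 2 Y with hy2
  -- Cramer's rule on the coefficients of w and w²; the determinant has constant term 1.
  set D := a1 * b2 - a2 * b1 with hD
  have hDn : D ≠ 0 := fun h0 => by
    have cA : constantCoeff A = LaurentPolynomial.T 1 - LaurentPolynomial.T 2 -
        LaurentPolynomial.T 2 + LaurentPolynomial.T 3 := by
      rw [hA, map_mul, map_pow, hz, constantCoeff_th0, hw, wpow,
        T_three, T_two, constantCoeff_C]
      ring
    have cB : constantCoeff B = LaurentPolynomial.T 2 := by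
      rw [hB, map_mul, map_mul, map_pow, hp, hp', constantCoeff_th3, constantCoeff_th6, hw, wpow,
        T_two, constantCoeff_C]
      ring
    have h1 : constantCoeff D = 1 := by
      rw [hD, map_sub, map_mul, map_mul, ha1, ha2, hb1, hb2]
      simp only [constantCoeff_slice, cA, cB, AddMonoidAlgebra.coeff_sub, AddMonoidAlgebra.coeff_add,
        Finsupp.sub_apply, Finsupp.add_apply, coeff_T]
      norm_num
    rw [h0, map_zero] at h1
    exact zero_ne_one h1
  set c1 := y1 * b2 - y2 * b1 with hc1
  set c2 := a1 * y2 - a2 * y1 with hc2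
  have hlin : ofX D * Y = ofX c1 * A + ofX c2 * B := by
    rw [← sub_eq_zero]
    refine Shift.eq_zero (d := 9) (c := X ^ 9) (pow_ne_zero _ X_ne_zero) two_pos ?_ ?_
    · have := ((Shift.const D).mul sY).sub (((Shift.const c1).mul sA).add ((Shift.const c2).mul sB))
      convert this using 1
      ring
    · intro m h1 h2
      rw [slice_sub, slice_add, slice_ofX_mul, slice_ofX_mul, slice_ofX_mul]
      obtain rfl | rfl : m = 1 ∨ m = 2 := by omega
      · push_cast
        rw [← ha1, ← hb1, ← hy1, hD, hc1, hc2]; ring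
      · push_cast
        rw [← ha2, ← hb2, ← hy2, hD, hc1, hc2]; ring
  have e0 : evalW 1 z = 0 := evalW_th0 K
  have e3 : evalW 1 p = val3 K := rfl
  have e6 : evalW 1 p' = val3 K := evalW_th6 K
  have d0 : evalW 1 (euler z) = der0 K := rfl
  have ew : evalW 1 w = 1 := evalW_one_wpow 1
  have h1 : D * der0 K ^ 2 = c2 * val3 K ^ 2 := by
    have := congrArg (evalW 1) hlin
    simp only [hY, hA, hB, wronsk, map_mul, map_add, map_sub, map_pow, evalW_ofX, e0, e3, e6, d0, ew] at this
    linear_combination this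
  -- The relation shifted by 3 has `th0` in the other summand. As `th0` vanishes at w = 1,
  -- evaluation before and after the shift isolates `c2` and `c1`.
  have h2 : ofX D * wronsk K p = ofX c1 * p ^ 2 - ofX c2 * (X ^ 3 * p' * z) := by
    have l := (Shift.const D).mul (sw.mul sz.wronsk)
    have r := ((Shift.const c1).mul (sw.mul (sz.pow 2))).add
      ((Shift.const c2).mul (((sw.pow 2).mul sp).mul sp'))
    rw [← hY, hlin] at l
    have := l.eq r
    have hX3w : (X ^ 3 * w) * (X ^ 3 * v) = X ^ 6 := by linear_combination X ^ 6 * hwv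
    have hn : (X ^ 3 * w : K[T;T⁻¹]⟦X⟧) ≠ 0 := fun h => by
      have := congrArg (evalW 1) h
      rw [map_mul, map_pow, evalW_X, ew, mul_one, map_zero] at this
      exact pow_ne_zero 3 X_ne_zero this
    apply mul_left_cancel₀ hn
    linear_combination this - (ofX c2 * X ^ 6 * w * p' * z) * hwv
  have h3 : D * evalW 1 (wronsk K p) = c1 * val3 K ^ 2 := by
    have := congrArg (evalW 1) h2
    simp only [map_mul, map_sub, map_pow, evalW_ofX, e0, e3] at this
    linear_combination this
  have h1' := congrArg (ofX (K := K)) h1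
  have h3' := congrArg (ofX (K := K)) h3
  rw [map_mul, map_mul] at h1' h3'
  have h4 : (ofX D : K[T;T⁻¹]⟦X⟧) ≠ 0 := fun h => hDn (ofX_injective K (by rw [h, map_zero]))
  apply mul_left_cancel₀ h4
  linear_combination ofX (val3 K ^ 2) * h2 - p ^ 2 * h3' + (X ^ 3 * p' * z) * h1'

/-- The root of the kernel as a linear function of a second logarithmic derivative. -/
theorem root0_eq [CharZero K] : ofX (X ^ 2 * der0 K ^ 2) * root0 K =
    ofX (val3 K ^ 2) * (ofX (evalW 1 (weierstrass K 3 9)) - weierstrass K 3 9) := by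
  have h := wronsk_th0 K
  have h3 := th3_mul_inv3 K
  have e3 : evalW 1 (th3 K) = val3 K := rfl
  rw [wronsk_th3, map_mul (evalW 1), map_pow (evalW 1), e3, map_mul] at h
  rw [root0, map_mul, map_pow, ofX_X]
  -- The addition theorem divided by `th3 K ^ 2`.
  linear_combination (inv3 K ^ 2) * h + ofX (val3 K ^ 2) *
    (ofX (evalW 1 (weierstrass K 3 9)) - weierstrass K 3 9) * (th3 K * inv3 K + 1) * h3

end Kernel

/-! ### The transfer operator in sector coordinates -/

section QuadrantWalks

variable {R : Type*} [CommRing R]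

/-- The vectors reached from the basis vector at `p` in one step: the lattice is cut into sectors
with coordinates in `ℕ × ℕ`, and a step that leaves a sector is recorded by a power of `s`. -/
def stepFrom (s : Rˣ) (p : ℕ × ℕ) : ℕ × ℕ →₀ R :=
  Finsupp.single (p.1 + 1, p.2 + 1) 1 +
  (if p.1 = 0 then if p.2 = 0 then 0 else Finsupp.single (p.2 - 1, 0) (s⁻¹ : Rˣ).1
    else Finsupp.single (p.1 - 1, p.2) 1) +
  if p.2 = 0 then Finsupp.single (0, p.1 + 2) s.1 else Finsupp.single (p.1, p.2 - 1) 1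

/-- The transfer operator of the walks. -/
def step (s : Rˣ) : (ℕ × ℕ →₀ R) →ₗ[R] (ℕ × ℕ →₀ R) := Finsupp.linearCombination R (stepFrom s)

/-- The distribution of the end points of the walks of length `n`. -/
def walkVec (s : Rˣ) : ℕ → (ℕ × ℕ →₀ R)
  | 0 => Finsupp.single (0, 0) 1
  | n + 1 => step s (walkVec s n)

variable {A : Type*} [CommRing A] [Algebra R A]

/-- Evaluation of a distribution as a polynomial in two variables. -/
def evalAt (x y : A) : (ℕ × ℕ →₀ R) →ₗ[R] A :=
  Finsupp.linearCombination R fun p => x ^ p.1 * y ^ p.2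

/-- Evaluation of the part of a distribution on the first axis. -/
def evalFst (x : A) : (ℕ × ℕ →₀ R) →ₗ[R] A :=
  Finsupp.linearCombination R fun p => if p.2 = 0 then x ^ p.1 else 0

/-- Evaluation of the part of a distribution on the second axis. -/
def evalSnd (y : A) : (ℕ × ℕ →₀ R) →ₗ[R] A :=
  Finsupp.linearCombination R fun p => if p.1 = 0 then y ^ p.2 else 0

lemma evalFst_zero (f : ℕ × ℕ →₀ R) : evalFst (0 : A) f = algebraMap R A (f (0, 0)) := by
  induction f using Finsupp.induction_linear with
  | zero => simp
  | add f g hf hg => rw [map_add, hf, hg, Finsupp.add_apply, map_add]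
  | single p a =>
    obtain ⟨i, j⟩ := p
    rw [evalFst, Finsupp.linearCombination_single, Finsupp.single_apply, Algebra.smul_def]
    rcases i with _ | i <;> rcases j with _ | j <;> simp

lemma evalSnd_zero (f : ℕ × ℕ →₀ R) : evalSnd (0 : A) f = algebraMap R A (f (0, 0)) := by
  induction f using Finsupp.induction_linear with
  | zero => simp
  | add f g hf hg => rw [map_add, hf, hg, Finsupp.add_apply, map_add]
  | single p a =>
    obtain ⟨i, j⟩ := p
    rw [evalSnd, Finsupp.linearCombination_single, Finsupp.single_apply, Algebra.smul_def]
    rcases i with _ | i <;> rcases j with _ | j <;> simp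

/-- The kernel accounts for unrestricted steps. The terms `evalSnd y` and `evalFst x` remove the
steps that leave the sector; those with s⁻¹ and s reinsert them in the neighbouring sectors. The
subtracted corner value accounts for the step into the origin, which is forbidden. -/
theorem evalAt_step (s : Rˣ) (x y : A) (f : ℕ × ℕ →₀ R) :
    x * y * evalAt x y (step s f) = (x ^ 2 * y ^ 2 + x + y) * evalAt x y f - y * evalSnd y f -
      x * evalFst x f + algebraMap R A (s⁻¹ : Rˣ).1 * y * (evalSnd x f - evalSnd (0 : A) f) +
      algebraMap R A s.1 * x * y ^ 3 * evalFst y f := by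
  induction f using Finsupp.induction_linear with
  | zero => simp
  | add f g hf hg =>
    simp only [map_add, mul_add] at hf hg ⊢
    linear_combination hf + hg
  | single p a =>
    rw [← Finsupp.smul_single_one]
    simp only [map_smul, mul_smul_comm, ← smul_sub, ← smul_add]
    congr 1
    obtain ⟨i, j⟩ := p
    simp only [step, evalAt, evalFst, evalSnd, Finsupp.linearCombination_single, one_smul, stepFrom,
      map_add]
    rcases i with _ | i <;> rcases j with _ | j <;>
      simp [Algebra.smul_def] <;> ring

end QuadrantWalks

/-! ### The functional equation on the kernel curve -/

section FunctionalEquation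

variable {K : Type*} [Field K]

lemma lsum_succ {R : Type*} [CommRing R] {f : ℕ → R⟦X⟧} (hf : ∀ n, (X : R⟦X⟧) ^ n ∣ f n) :
    lsum f = f 0 + lsum fun n => f (n + 1) := by
  have hf' : ∀ n, (X : R⟦X⟧) ^ n ∣ f (n + 1) := fun n =>
    (pow_dvd_pow _ n.le_succ).trans (hf (n + 1))
  apply lsum_eq
  intro N
  rcases N with _ | N
  · simp
  · rw [Finset.sum_range_succ']
    have h1 := lsum_spec hf' (N + 1)
    have h2 := hf (N + 1)
    rw [Finset.sum_range_succ] at h1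
    have e : f 0 + lsum (fun n => f (n + 1)) - (∑ k ∈ Finset.range N, f (k + 1) + f 0) =
      (lsum (fun n => f (n + 1)) - (∑ k ∈ Finset.range N, f (k + 1) + f (N + 1))) + f (N + 1) := by
      ring
    rw [e]
    exact dvd_add h1 h2

lemma Shift.lsum {d : ℕ} {f g : ℕ → K[T;T⁻¹]⟦X⟧} (hf : ∀ n, (X : K[T;T⁻¹]⟦X⟧) ^ n ∣ f n)
    (hg : ∀ n, (X : K[T;T⁻¹]⟦X⟧) ^ n ∣ g n) (h : ∀ n, Shift d (f n) (g n)) :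
    Shift d (lsum f) (Kreweras.lsum g) :=
  Shift.of_dvd fun N => ⟨_, _, Shift.sum (s := Finset.range N) fun i _ => h i, lsum_spec hf N,
    lsum_spec hg N⟩

lemma algebraMap_eq_ofX (a : K) : algebraMap K K[T;T⁻¹]⟦X⟧ a = ofX (C a) := by
  ext k : 1
  simp [ofX, PowerSeries.algebraMap_apply]

lemma smul_eq_ofX_mul (a : K) (f : K[T;T⁻¹]⟦X⟧) : a • f = ofX (C a) * f := by
  rw [Algebra.smul_def, algebraMap_eq_ofX]

lemma Shift.linearCombination {d : ℕ} {ι : Type*} {v v' : ι → K[T;T⁻¹]⟦X⟧}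
    (h : ∀ i, Shift d (v i) (v' i)) (f : ι →₀ K) :
    Shift d (Finsupp.linearCombination K v f) (Finsupp.linearCombination K v' f) := by
  rw [Finsupp.linearCombination_apply, Finsupp.linearCombination_apply]
  refine Shift.sum fun i _ => ?_
  simp only [smul_eq_ofX_mul]
  exact (Shift.const _).mul (h i)

lemma evalW_linearCombination {ι : Type*} (c : Kˣ) (v : ι → K[T;T⁻¹]⟦X⟧) (f : ι →₀ K) :
    evalW c (Finsupp.linearCombination K v f) =
      Finsupp.linearCombination K (fun i => evalW c (v i)) f := by
  rw [Finsupp.linearCombination_apply, Finsupp.linearCombination_apply, Finsupp.sum, Finsupp.sum,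
    map_sum]
  refine Finset.sum_congr rfl fun i _ => ?_
  rw [smul_eq_ofX_mul, map_mul, evalW_ofX, smul_eq_C_mul]

/-- The generating function of the values of a functional at the distributions of end points. -/
def gen (s : Kˣ) (t : K⟦X⟧) (φ : (ℕ × ℕ →₀ K) →ₗ[K] K[T;T⁻¹]⟦X⟧) : K[T;T⁻¹]⟦X⟧ :=
  lsum fun n => ofX t ^ n * φ (walkVec s n)

/-- The generating function of the walks that end at the corner of a sector. -/
def genCorner (s : Kˣ) (t : K⟦X⟧) : K⟦X⟧ := lsum fun n => t ^ n * C (walkVec s n (0, 0))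

lemma X_pow_dvd_pow_mul {R : Type*} [CommRing R] {t : R⟦X⟧} (ht : (X : R⟦X⟧) ∣ t) (n : ℕ)
    (f : R⟦X⟧) : (X : R⟦X⟧) ^ n ∣ t ^ n * f :=
  Dvd.dvd.mul_right (pow_dvd_pow_of_dvd ht n) f

lemma X_dvd_ofX {t : K⟦X⟧} (ht : (X : K⟦X⟧) ∣ t) : (X : K[T;T⁻¹]⟦X⟧) ∣ ofX t := by
  simpa using X_pow_dvd_ofX (N := 1) (by simpa using ht)

lemma shift_gen {d : ℕ} {s : Kˣ} {t : K⟦X⟧} (ht : (X : K⟦X⟧) ∣ t)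
    {φ ψ : (ℕ × ℕ →₀ K) →ₗ[K] K[T;T⁻¹]⟦X⟧} (h : ∀ f, Shift d (φ f) (ψ f)) :
    Shift d (gen s t φ) (gen s t ψ) :=
  Shift.lsum (fun n => X_pow_dvd_pow_mul (X_dvd_ofX ht) n _)
    (fun n => X_pow_dvd_pow_mul (X_dvd_ofX ht) n _) fun n =>
    ((Shift.const t).pow n).mul (h _)

lemma gen_evalSnd_zero (s : Kˣ) (t : K⟦X⟧) : gen s t (evalSnd 0) = ofX (genCorner s t) := by
  rw [gen, genCorner, ofX, map_lsum]
  congr 1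
  funext n
  rw [evalSnd_zero, algebraMap_eq_ofX, map_mul, map_pow]
  rfl

lemma evalW_one_gen_evalFst {x : K[T;T⁻¹]⟦X⟧} (hx : evalW 1 x = 0) (s : Kˣ) (t : K⟦X⟧) :
    evalW 1 (gen s t (evalFst x)) = genCorner s t := by
  rw [gen, evalW_lsum, genCorner]
  congr 1
  funext n
  rw [map_mul, map_pow, evalW_ofX, evalFst, evalW_linearCombination]
  have := evalFst_zero (A := K⟦X⟧) (walkVec s n)
  rw [evalFst] at this
  simp only [apply_ite (evalW (1 : Kˣ)), map_pow, hx, map_zero, this]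
  rfl

lemma evalW_one_gen_evalSnd {x : K[T;T⁻¹]⟦X⟧} (hx : evalW 1 x = 0) (s : Kˣ) (t : K⟦X⟧) :
    evalW 1 (gen s t (evalSnd x)) = genCorner s t := by
  rw [gen, evalW_lsum, genCorner]
  congr 1
  funext n
  rw [map_mul, map_pow, evalW_ofX, evalSnd, evalW_linearCombination]
  have := evalSnd_zero (A := K⟦X⟧) (walkVec s n)
  rw [evalSnd] at this
  simp only [apply_ite (evalW (1 : Kˣ)), map_pow, hx, map_zero, this]
  rfl

lemma mul_step_aux {A : Type*} [CommRing A] {x y k a₁ a₂ a₃ a₄ a₅ a₆ a₇ b₁ b₂ : A}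
    (h : x * y * a₁ = k * a₂ - y * a₃ - x * a₄ + b₁ * y * (a₅ - a₆) + b₂ * x * y ^ 3 * a₇)
    (t : A) (n : ℕ) : x * y * (t ^ (n + 1) * a₁) = t * (k * (t ^ n * a₂) - y * (t ^ n * a₃) -
      x * (t ^ n * a₄) + b₁ * y * (t ^ n * a₅ - t ^ n * a₆) + b₂ * x * y ^ 3 * (t ^ n * a₇)) := by
  linear_combination t ^ (n + 1) * h

/-- The functional equation of the walks, at a point where the kernel vanishes. -/
theorem gen_kernel {s : Kˣ} {t : K⟦X⟧} (ht : (X : K⟦X⟧) ∣ t) {x y : K[T;T⁻¹]⟦X⟧}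
    (h : ofX t * (x ^ 2 * y ^ 2 + x + y) = x * y) :
    x * y = ofX t * (y * gen s t (evalSnd y) + x * gen s t (evalFst x) -
      ofX (C (s⁻¹ : Kˣ).1) * y * (gen s t (evalSnd x) - ofX (genCorner s t)) -
      ofX (C s.1) * x * y ^ 3 * gen s t (evalFst y)) := by
  have hd := X_pow_dvd_pow_mul (X_dvd_ofX ht)
  -- The sum of `evalAt_step` over all lengths. The unknown series `gen s t (evalAt x y)` is then
  -- multiplied by the kernel and drops out.
  have h0 : gen s t (evalAt x y) =
      1 + lsum fun n => ofX t ^ (n + 1) * evalAt x y (step s (walkVec s n)) := by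
    rw [gen, lsum_succ (fun n => hd n _)]
    simp [walkVec, evalAt]
  have h1 : x * y * lsum (fun n => ofX t ^ (n + 1) * evalAt x y (step s (walkVec s n))) =
      lsum fun n => ofX t * ((x ^ 2 * y ^ 2 + x + y) * (ofX t ^ n * evalAt x y (walkVec s n)) -
        y * (ofX t ^ n * evalSnd y (walkVec s n)) - x * (ofX t ^ n * evalFst x (walkVec s n)) +
        ofX (C (s⁻¹ : Kˣ).1) * y * (ofX t ^ n * evalSnd x (walkVec s n) -
          ofX t ^ n * evalSnd 0 (walkVec s n)) +
        ofX (C s.1) * x * y ^ 3 * (ofX t ^ n * evalFst y (walkVec s n))) := by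
    refine (lsum_mul_left _ (fun n => (pow_dvd_pow X n.le_succ).trans (hd (n + 1) _))).symm.trans
      (congrArg lsum (funext fun n => ?_))
    have := evalAt_step s x y (walkVec s n)
    rw [algebraMap_eq_ofX, algebraMap_eq_ofX] at this
    exact mul_step_aux this (ofX t) n
  have h2 : ∀ (a : K[T;T⁻¹]⟦X⟧) (φ : (ℕ × ℕ →₀ K) →ₗ[K] K[T;T⁻¹]⟦X⟧),
      lsum (fun n => a * (ofX t ^ n * φ (walkVec s n))) = a * gen s t φ := fun a φ =>
    lsum_mul_left a (fun n => hd n _)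
  have h3 : lsum (fun n => ofX (C (s⁻¹ : Kˣ).1) * y * (ofX t ^ n * evalSnd x (walkVec s n) -
      ofX t ^ n * evalSnd 0 (walkVec s n))) =
      ofX (C (s⁻¹ : Kˣ).1) * y * (gen s t (evalSnd x) - gen s t (evalSnd 0)) := by
    rw [lsum_mul_left _ (fun n => dvd_sub (hd n _) (hd n _)), lsum_sub]
    rfl
  rw [lsum_mul_left] at h1
  swap
  · intro n
    exact dvd_add (dvd_add (dvd_sub (dvd_sub (Dvd.dvd.mul_left (hd n _) _)
      (Dvd.dvd.mul_left (hd n _) _)) (Dvd.dvd.mul_left (hd n _) _))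
      (Dvd.dvd.mul_left (dvd_sub (hd n _) (hd n _)) _)) (Dvd.dvd.mul_left (hd n _) _)
  rw [lsum_add, lsum_add, lsum_sub, lsum_sub, h2, h2, h2, h2, h3, gen_evalSnd_zero] at h1
  linear_combination -gen s t (evalAt x y) * h - x * y * h0 - h1

variable (s : Kˣ)

/-- The quotient of the two roots of the kernel. -/
def rootQuot (K : Type*) [Field K] : K[T;T⁻¹]⟦X⟧ := -(wpow 1 * th6 K ^ 3 * inv3 K ^ 3)

lemma root0_eq_mul : root0 K = rootQuot K * root1 K := by
  have h3 := th3_mul_inv3 K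
  have h6 := th6_mul_inv6 K
  have hw := wpow_one_mul_neg_one K
  rw [root0, root1, rootQuot]
  have e : -(wpow 1 * th6 K ^ 3 * inv3 K ^ 3) * -(X * wpow (-1) * th0 K * th3 K * inv6 K ^ 2) =
      (wpow 1 * wpow (-1)) * (th3 K * inv3 K) * (th6 K * inv6 K) ^ 2 *
        (X * th6 K * th0 K * inv3 K ^ 2) := by ring
  rw [e, hw, h3, h6]
  ring

/-- The quotient x/y multiplies one boundary series and xy² the other. That the shift takes x/y to
xy² is what makes the two unknown combinations translates of each other. -/
lemma shift_rootQuot : Shift 3 (rootQuot K) (root0 K * root1 K ^ 2) := by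
  have := (((shift_wpow_one K 3).mul ((shift_th6 K).pow 3)).mul ((shift_inv3 K).pow 3)).neg
  rw [rootQuot]
  convert this using 1
  have h3 := th3_mul_inv3 K
  have h6 := th6_mul_inv6 K
  have hw := wpow_one_mul_neg_one K
  rw [root0, root1]
  have e : X * th6 K * th0 K * inv3 K ^ 2 * (-(X * wpow (-1) * th0 K * th3 K * inv6 K ^ 2)) ^ 2 =
    X ^ 3 * wpow (-1) ^ 2 * th0 K ^ 3 * inv6 K ^ 3 * (th3 K * inv3 K) ^ 2 * (th6 K * inv6 K) := by
      ring
  have e' : -(X ^ 3 * wpow 1 * (-(wpow (-1) * th0 K)) ^ 3 * inv6 K ^ 3) =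
    X ^ 3 * wpow (-1) ^ 2 * th0 K ^ 3 * inv6 K ^ 3 * (wpow 1 * wpow (-1)) := by ring
  rw [e, e', h3, h6, hw]
  ring

lemma root1_ne_zero : root1 K ≠ 0 := fun h => by
  have h3 := th3_mul_inv3 K
  have h6 := th6_mul_inv6 K
  have hw := wpow_one_mul_neg_one K
  have h1 : X * th0 K = 0 := by
    have e : X * th0 K * ((wpow 1 * wpow (-1)) * (th3 K * inv3 K) * (th6 K * inv6 K) ^ 2) =
      -(wpow 1 * inv3 K * th6 K ^ 2) *
        -(X * wpow (-1) * th0 K * th3 K * inv6 K ^ 2) := by ring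
    rw [root1] at h
    rw [h, hw, h3, h6] at e
    simpa using e
  have h2 := congrArg (fun f => evalW 1 (euler f)) h1
  have hX : euler (X : K[T;T⁻¹]⟦X⟧) = 0 := euler_X
  simp only [Derivation.leibniz, hX, smul_eq_mul, map_mul, map_zero, evalW_X, mul_zero,
    add_zero] at h2
  exact mul_ne_zero X_ne_zero (der0_ne_zero K) h2

lemma evalW_root0 : evalW 1 (root0 K) = 0 := by
  simp [root0, evalW_th0]

lemma X_dvd_tser : (X : K⟦X⟧) ∣ tser K := Dvd.intro _ rfl

/-- The boundary values of the generating function at one of the roots of the kernel. -/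
def bdry0 : K[T;T⁻¹]⟦X⟧ := ofX (C (s⁻¹ : Kˣ).1) * gen s (tser K) (evalSnd (root0 K)) -
  rootQuot K * gen s (tser K) (evalFst (root0 K))

/-- The boundary values of the generating function at the other root of the kernel. -/
def bdry1 : K[T;T⁻¹]⟦X⟧ := ofX (C (s⁻¹ : Kˣ).1) * gen s (tser K) (evalSnd (root1 K)) -
  root0 K * root1 K ^ 2 * gen s (tser K) (evalFst (root1 K))

lemma shift_bdry : Shift 3 (bdry0 s) (bdry1 s) := by
  have hr := shift_root K
  refine ((Shift.const _).mul (shift_gen X_dvd_tser fun f => ?_)).sub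
    ((shift_rootQuot).mul (shift_gen X_dvd_tser fun f => ?_))
  · refine Shift.linearCombination (fun p => ?_) f
    split_ifs
    · exact hr.pow _
    · simpa using Shift.const (K := K) (d := 3) 0
  · refine Shift.linearCombination (fun p => ?_) f
    split_ifs
    · exact hr.pow _
    · simpa using Shift.const (K := K) (d := 3) 0

lemma ofX_C_mul_inv : (ofX (C s.1) * ofX (C (s⁻¹ : Kˣ).1) : K[T;T⁻¹]⟦X⟧) = 1 := by
  rw [← map_mul, ← map_mul]
  simp

/-- The functional equation at (x, y) = (`root0`, `root1`), divided by y and sorted into terms at x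
and terms at y. -/
theorem root0_add_bdry : root0 K + ofX (tser K) * (bdry0 s - ofX (C s.1) * bdry1 s -
    ofX (C (s⁻¹ : Kˣ).1) * ofX (genCorner s (tser K))) = 0 := by
  have h := gen_kernel (s := s) X_dvd_tser (kernel_root K)
  have hs := ofX_C_mul_inv s
  apply mul_left_cancel₀ root1_ne_zero
  rw [bdry0, bdry1]
  rw [mul_zero]
  linear_combination h + ofX (tser K) * gen s (tser K) (evalFst (root0 K)) * root0_eq_mul (K := K) -
    ofX (tser K) * root1 K * gen s (tser K) (evalSnd (root1 K)) * hs

/-- At w = 1 the root x vanishes while x/y tends to -1, so both boundary series reduce to the corner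
series. This is the condition that fixes the constant term. -/
lemma evalW_bdry0 : evalW 1 (bdry0 s) =
    C (s⁻¹ : Kˣ).1 * genCorner s (tser K) + genCorner s (tser K) := by
  have h1 : evalW 1 (rootQuot K) = -1 := by
    have h3 := congrArg (evalW 1) (th3_mul_inv3 K)
    rw [map_mul, map_one, show evalW 1 (th3 K) = val3 K from rfl] at h3
    rw [rootQuot, map_neg, map_mul, map_mul, map_pow, map_pow, evalW_one_wpow, evalW_th6]
    rw [one_mul, ← mul_pow, h3, one_pow]
  rw [bdry0, map_sub, map_mul, map_mul, evalW_ofX, evalW_one_gen_evalSnd evalW_root0,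
    evalW_one_gen_evalFst evalW_root0, h1]
  ring

end FunctionalEquation

/-! ### Solution of the q-difference equation -/

section Solution

variable {K : Type*} [Field K]

lemma C_mul_C_inv (s : Kˣ) : (C s.1 * C (s⁻¹ : Kˣ).1 : K⟦X⟧) = 1 := by
  rw [← map_mul]
  simp

lemma X_pow_dvd_of_le_natAbs {m : ℤ} {e : ℕ} (he : 0 < e) {f : K⟦X⟧} (h : X ^ (e * m.natAbs) ∣ f) :
    (X : K⟦X⟧) ^ m.natAbs ∣ f :=
  (pow_dvd_pow _ (Nat.le_mul_of_pos_left _ he)).trans h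

/-- The coefficients of the boundary values `bdry0`, up to a factor. -/
def bdryCoeff (s : Kˣ) (m : ℤ) : K⟦X⟧ :=
  (m : K⟦X⟧) * (X ^ (3 * m.natAbs) * (ginv (X ^ (9 * m.natAbs)) *
    if 0 < m then ginv (X ^ (3 * m.natAbs) * C s.1)
    else C (s⁻¹ : Kˣ).1 * X ^ (6 * m.natAbs) * ginv (X ^ (3 * m.natAbs) * C (s⁻¹ : Kˣ).1)))

lemma X_pow_dvd_bdryCoeff (s : Kˣ) (m : ℤ) : (X : K⟦X⟧) ^ m.natAbs ∣ bdryCoeff s m :=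
  X_pow_dvd_of_le_natAbs three_pos (Dvd.dvd.mul_left (Dvd.intro _ rfl) _)

lemma slice_ofX (m : ℤ) (a : K⟦X⟧) : slice m (ofX a) = if m = 0 then a else 0 := by
  simpa using slice_ofX_mul_wpow m 0 a

theorem bdry0_eq [CharZero K] (s : Kˣ) :
    ofX (X ^ 2 * der0 K ^ 2 * tser K) * bdry0 s =
      ofX (X ^ 2 * der0 K ^ 2 * tser K * slice 0 (bdry0 s)) +
        ofX (val3 K ^ 2) * collect (bdryCoeff s) := by
  have hsh := shift_bdry s
  have hC := C_mul_C_inv s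
  apply slice_ext
  intro m
  -- For m ≠ 0 the coefficient of w^m reads x_m + t(1 - sX^{3m})B_m = 0, with x_m known from
  -- `root0_eq`.
  have hk := congrArg (slice m) (root0_add_bdry s)
  have hr := congrArg (slice m) (root0_eq K)
  simp only [slice_add, slice_sub, slice_ofX_mul, slice_ofX, slice_zero] at hk hr
  rw [slice_add, slice_ofX_mul, slice_ofX_mul, slice_ofX, slice_collect (X_pow_dvd_bdryCoeff s)]
  rcases lt_trichotomy m 0 with hm | rfl | hm
  -- For m < 0 the factor 1 - sX^{3m} involves a negative power of X, so the coefficient of `bdry1`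
  -- is found first; that of `bdry0` is X^{3|m|} times it.
  · obtain ⟨n, rfl⟩ : ∃ n : ℕ, m = -((n : ℤ) + 1) := ⟨(-m - 1).toNat, by omega⟩
    have hn := hsh.slice_neg_natCast (n + 1)
    push_cast at hn
    have he : (-((n : ℤ) + 1)).natAbs = n + 1 := by omega
    rw [slice_weierstrass_neg (by norm_num) (by norm_num), if_neg hm.ne] at hr
    rw [if_neg hm.ne, hn] at hk
    rw [if_neg hm.ne, hn, bdryCoeff, if_neg (by omega), he]
    have hg := one_sub_mul_ginv (y := X ^ (3 * (n + 1)) * C (s⁻¹ : Kˣ).1)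
      (constantCoeff_X_pow_mul (R := K) (by positivity) _)
    simp only [Int.cast_neg, Int.cast_add, Int.cast_natCast, Int.cast_one]
    set y : K⟦X⟧ := X ^ (3 * (n + 1)) with hy
    have h6 : (X : K⟦X⟧) ^ ((9 - 3) * (n + 1)) = X ^ (6 * (n + 1)) := rfl
    rw [h6] at hr
    set g := slice (-((n : ℤ) + 1)) (bdry1 s)
    set b := ginv (y * C (s⁻¹ : Kˣ).1)
    set c := ginv (X ^ (9 * (n + 1)) : K⟦X⟧)
    set σ : K⟦X⟧ := C (s⁻¹ : Kˣ).1
    set x := slice (-((n : ℤ) + 1)) (root0 K)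
    set d := X ^ 2 * der0 K ^ 2
    set t := tser K
    set v := val3 K ^ 2
    have h1 : d * t * g * (C s.1 - y) = -(v * (((n : K⟦X⟧) + 1) * X ^ (6 * (n + 1)) * c)) := by
      linear_combination hr - d * hk
    have h2 : d * t * g = -(v * (((n : K⟦X⟧) + 1) * X ^ (6 * (n + 1)) * c)) * σ * b := by
      linear_combination (σ * b) * h1 + (-b * d * t * g) * hC - (d * t * g) * hg
    linear_combination y * h2
  · simp [bdryCoeff]
  · obtain ⟨n, rfl⟩ : ∃ n : ℕ, m = (n : ℤ) + 1 := ⟨(m - 1).toNat, by omega⟩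
    have hn := hsh.slice_natCast (n + 1)
    push_cast at hn
    have he : ((n : ℤ) + 1).natAbs = n + 1 := by omega
    rw [slice_weierstrass_succ (by norm_num) (by norm_num), if_neg hm.ne'] at hr
    rw [if_neg hm.ne', hn] at hk
    rw [if_neg hm.ne', bdryCoeff, if_pos hm, he]
    have hg := one_sub_mul_ginv (y := X ^ (3 * (n + 1)) * C s.1)
      (constantCoeff_X_pow_mul (R := K) (by positivity) _)
    simp only [Int.cast_add, Int.cast_natCast, Int.cast_one]
    set y : K⟦X⟧ := X ^ (3 * (n + 1)) with hy
    set g := slice ((n : ℤ) + 1) (bdry0 s)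
    set a := ginv (y * C s.1)
    set c := ginv (X ^ (9 * (n + 1)) : K⟦X⟧)
    set x := slice ((n : ℤ) + 1) (root0 K)
    set d := X ^ 2 * der0 K ^ 2
    set t := tser K
    set v := val3 K ^ 2
    have h1 : d * t * g * (1 - y * C s.1) = v * (((n : K⟦X⟧) + 1) * y * c) := by
      linear_combination d * hk - hr
    linear_combination a * h1 - (d * t * g) * hg

/-- The constant coefficient of `bdry0` is eliminated between the equation at w⁰ and the evaluation
at w = 1; the corner series remains with (1 - s)(1 + s⁻¹) - s⁻¹ = -s. -/
theorem genCorner_mul [CharZero K] (s : Kˣ) :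
    C s.1 * (X ^ 2 * der0 K ^ 2) * tser K * genCorner s (tser K) =
      val3 K ^ 2 * (evalW 1 (weierstrass K 3 9) -
        (1 - C s.1) * evalW 1 (collect (bdryCoeff s))) := by
  have h := congrArg (evalW 1) (bdry0_eq s)
  rw [map_add, map_mul (evalW 1), map_mul (evalW 1), evalW_ofX, evalW_ofX, evalW_ofX,
    evalW_bdry0] at h
  have hk := congrArg (slice 0) (root0_add_bdry s)
  have hr := congrArg (slice 0) (root0_eq K)
  have hn := (shift_bdry s).slice_natCast 0
  have hC := C_mul_C_inv s
  simp only [slice_add, slice_sub, slice_ofX_mul, slice_ofX, slice_zero,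
    slice_weierstrass_zero (K := K) (a := 3) (b := 9) (by norm_num) (by norm_num), if_true] at hk hr
  rw [Nat.cast_zero, mul_zero, pow_zero, one_mul] at hn
  rw [hn] at hk
  set E := genCorner s (tser K)
  set d := X ^ 2 * der0 K ^ 2
  set σ : K⟦X⟧ := C (s⁻¹ : Kˣ).1
  linear_combination (C s.1 - 1) * h - d * hk + hr - (d * tser K * E) * hC

/-- The Lambert series of the logarithmic derivative of a theta series with respect to the nome. -/
def lambertL (s : Kˣ) (b : ℕ) : K⟦X⟧ := lsum fun n : ℕ => ((n : K⟦X⟧) + 1) *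
  (X ^ (b * (n + 1)) * C s.1 * ginv (X ^ (b * (n + 1)) * C s.1) +
    X ^ (b * (n + 1)) * C (s⁻¹ : Kˣ).1 * ginv (X ^ (b * (n + 1)) * C (s⁻¹ : Kˣ).1))

lemma evalW_weierstrass : evalW 1 (weierstrass K 3 9) = lsum fun n : ℕ => ((n : K⟦X⟧) + 1) *
    ((X ^ (3 * (n + 1)) + X ^ (6 * (n + 1))) * ginv (X ^ (9 * (n + 1)))) := by
  have hd : ∀ m : ℤ, (X : K⟦X⟧) ^ m.natAbs ∣ slice m (weierstrass K 3 9) := fun m => by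
    rcases lt_trichotomy m 0 with hm | rfl | hm
    · obtain ⟨n, rfl⟩ : ∃ n : ℕ, m = -((n : ℤ) + 1) := ⟨(-m - 1).toNat, by omega⟩
      rw [slice_weierstrass_neg (by norm_num) (by norm_num)]
      exact Dvd.dvd.mul_right (Dvd.dvd.mul_left (pow_dvd_pow _ (by omega)) _) _
    · simp
    · obtain ⟨n, rfl⟩ : ∃ n : ℕ, m = (n : ℤ) + 1 := ⟨(m - 1).toNat, by omega⟩
      rw [slice_weierstrass_succ (by norm_num) (by norm_num)]
      exact Dvd.dvd.mul_right (Dvd.dvd.mul_left (pow_dvd_pow _ (by omega)) _) _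
  have h : weierstrass K 3 9 = collect fun m => slice m (weierstrass K 3 9) :=
    slice_ext fun m => (slice_collect hd m).symm
  rw [h, evalW_one_collect, slice_weierstrass_zero (by norm_num) (by norm_num), zero_add]
  congr 1
  funext n
  rw [slice_weierstrass_succ (by norm_num) (by norm_num),
    slice_weierstrass_neg (by norm_num) (by norm_num)]
  have h6 : (X : K⟦X⟧) ^ ((9 - 3) * (n + 1)) = X ^ (6 * (n + 1)) := rfl
  rw [h6]
  ring

/-- Partial fractions in y, with σ = s⁻¹. The prefactor arises because (1 - s)(1 + s + s²) = 1 - s³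
cancels against 1 - y³ at the poles y = s^{±1}. -/
lemma partial_fractions {R : Type*} [CommRing R] [IsDomain R] {s σ y a b c : R} (hs : s * σ = 1)
    (hc : (1 - y ^ 3) * c = 1) (ha : (1 - y * s) * a = 1) (hb : (1 - y * σ) * b = 1) :
    (1 + s + s ^ 2) * ((y + y ^ 2) * c - (1 - s) * (y * (c * a) - y * (c * (σ * y ^ 2 * b)))) =
      s ^ 2 * ((y + y ^ 2) * c + (y * s * a + y * σ * b) - 2 * (y ^ 3 * c)) := by
  have hb' : (s - y) * (σ * b) = 1 := by linear_combination hb + b * hs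
  have e : y * σ * b = y * (σ * b) := by ring
  have e' : σ * y ^ 2 * b = y ^ 2 * (σ * b) := by ring
  rw [e, e']
  generalize σ * b = β at hb'
  -- The common denominator is a unit, so it can be cleared; `e1` to `e5` give each fraction after
  -- clearing.
  have hu : IsUnit ((1 - y ^ 3) * (1 - y * s) * (s - y)) :=
    IsUnit.of_mul_eq_one (c * a * β)
      (by linear_combination ((1 - y * s) * a * ((s - y) * β)) * hc + ((s - y) * β) * ha + hb')
  apply hu.mul_left_cancel
  have e1 : (1 - y ^ 3) * (1 - y * s) * (s - y) * c = (1 - y * s) * (s - y) := by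
    linear_combination ((1 - y * s) * (s - y)) * hc
  have e2 : (1 - y ^ 3) * (1 - y * s) * (s - y) * a = (1 - y ^ 3) * (s - y) := by
    linear_combination ((1 - y ^ 3) * (s - y)) * ha
  have e3 : (1 - y ^ 3) * (1 - y * s) * (s - y) * β = (1 - y ^ 3) * (1 - y * s) := by
    linear_combination ((1 - y ^ 3) * (1 - y * s)) * hb'
  have e4 : (1 - y ^ 3) * (1 - y * s) * (s - y) * (c * a) = s - y := by
    linear_combination ((1 - y * s) * (s - y) * a) * hc + (s - y) * ha
  have e5 : (1 - y ^ 3) * (1 - y * s) * (s - y) * (c * β) = 1 - y * s := by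
    linear_combination ((1 - y * s) * (s - y) * β) * hc + (1 - y * s) * hb'
  linear_combination ((1 + s + s ^ 2) * (y + y ^ 2) - s ^ 2 * (y + y ^ 2 - 2 * y ^ 3)) * e1 -
    (s ^ 3 * y) * e2 - (s ^ 2 * y) * e3 - ((1 + s + s ^ 2) * (1 - s) * y) * e4 +
    ((1 + s + s ^ 2) * (1 - s) * y ^ 3) * e5

lemma X_pow_dvd_natCast_mul_X_pow {b : ℕ} (hb : 0 < b) (n : ℕ) (a f : K⟦X⟧)
    (h : X ^ (b * (n + 1)) ∣ f) : (X : K⟦X⟧) ^ n ∣ a * f :=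
  Dvd.dvd.mul_left ((pow_dvd_pow _ (by nlinarith)).trans h) a

/-- Holds term by term: the exponents n + 1 and -(n + 1) of w together give `partial_fractions` with
y = X^{3(n+1)}. -/
theorem weierstrass_sub_bdry (s : Kˣ) :
    (1 + C s.1 + C s.1 ^ 2) * (evalW 1 (weierstrass K 3 9) -
        (1 - C s.1) * evalW 1 (collect (bdryCoeff s))) =
      C s.1 ^ 2 * (evalW 1 (weierstrass K 3 9) + lambertL s 3 - 2 * lambertP K 9) := by
  have hG : evalW 1 (collect (bdryCoeff s)) = lsum fun n : ℕ =>
      bdryCoeff s ((n : ℤ) + 1) + bdryCoeff s (-((n : ℤ) + 1)) := by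
    rw [evalW_one_collect]
    simp [bdryCoeff]
  have d1 : ∀ n : ℕ, (X : K⟦X⟧) ^ n ∣ ((n : K⟦X⟧) + 1) *
      ((X ^ (3 * (n + 1)) + X ^ (6 * (n + 1))) * ginv (X ^ (9 * (n + 1)))) := fun n =>
    X_pow_dvd_natCast_mul_X_pow three_pos n _ _ (Dvd.dvd.mul_right
      (dvd_add dvd_rfl (pow_dvd_pow _ (by omega))) _)
  have d2 : ∀ n : ℕ, (X : K⟦X⟧) ^ n ∣
      bdryCoeff s ((n : ℤ) + 1) + bdryCoeff s (-((n : ℤ) + 1)) := fun n =>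
    dvd_add ((pow_dvd_pow _ (by omega)).trans (X_pow_dvd_bdryCoeff s _))
      ((pow_dvd_pow _ (by omega)).trans (X_pow_dvd_bdryCoeff s _))
  have d3 : ∀ n : ℕ, (X : K⟦X⟧) ^ n ∣ ((n : K⟦X⟧) + 1) *
      (X ^ (3 * (n + 1)) * C s.1 * ginv (X ^ (3 * (n + 1)) * C s.1) +
        X ^ (3 * (n + 1)) * C (s⁻¹ : Kˣ).1 * ginv (X ^ (3 * (n + 1)) * C (s⁻¹ : Kˣ).1)) := fun n =>
    X_pow_dvd_natCast_mul_X_pow three_pos n _ _ (dvd_add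
      (Dvd.dvd.mul_right (Dvd.intro _ rfl) _) (Dvd.dvd.mul_right (Dvd.intro _ rfl) _))
  have d4 : ∀ n : ℕ, (X : K⟦X⟧) ^ n ∣ ((n : K⟦X⟧) + 1) *
      (X ^ (9 * (n + 1)) * ginv (X ^ (9 * (n + 1)))) := fun n =>
    X_pow_dvd_natCast_mul_X_pow (b := 9) (by norm_num) n _ _ (Dvd.intro _ rfl)
  rw [hG, evalW_weierstrass, lambertL, lambertP, ← lsum_mul_left _ d2, ← lsum_sub,
    ← lsum_mul_left _ (fun n => dvd_sub (d1 n) (Dvd.dvd.mul_left (d2 n) _)), ← lsum_add,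
    ← lsum_mul_left 2 d4, ← lsum_sub, ← lsum_mul_left _ (fun n =>
      dvd_sub (dvd_add (d1 n) (d3 n)) (Dvd.dvd.mul_left (d4 n) _))]
  refine congrArg lsum (funext fun n => ?_)
  have e1 : ((n : ℤ) + 1).natAbs = n + 1 := by omega
  have e2 : (-((n : ℤ) + 1)).natAbs = n + 1 := by omega
  rw [bdryCoeff, bdryCoeff, if_pos (by omega), if_neg (by omega), e1, e2]
  have hy9 : (X : K⟦X⟧) ^ (9 * (n + 1)) = (X ^ (3 * (n + 1))) ^ 3 := by
    rw [← pow_mul]; congr 1; ring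
  have hy6 : (X : K⟦X⟧) ^ (6 * (n + 1)) = (X ^ (3 * (n + 1))) ^ 2 := by
    rw [← pow_mul]; congr 1; ring
  rw [hy9, hy6]
  have hy : constantCoeff (X ^ (3 * (n + 1)) : K⟦X⟧) = 0 := constantCoeff_X_pow (by positivity)
  have hc := one_sub_mul_ginv (y := ((X : K⟦X⟧) ^ (3 * (n + 1))) ^ 3) (by rw [map_pow, hy]; simp)
  have ha := one_sub_mul_ginv (y := X ^ (3 * (n + 1)) * C s.1)
    (constantCoeff_X_pow_mul (R := K) (by positivity) _)
  have hb := one_sub_mul_ginv (y := X ^ (3 * (n + 1)) * C (s⁻¹ : Kˣ).1)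
    (constantCoeff_X_pow_mul (R := K) (by positivity) _)
  have := partial_fractions (C_mul_C_inv s) hc ha hb
  simp only [Int.cast_neg, Int.cast_add, Int.cast_natCast, Int.cast_one]
  linear_combination ((n : K⟦X⟧) + 1) * this

/-- The generating function of the walks in terms of the cube root of the nome. -/
theorem genCorner_eq [CharZero K] (s : Kˣ) :
    (1 + C s.1 + C s.1 ^ 2) * (X ^ 2 * der0 K ^ 2) * tser K * genCorner s (tser K) =
      C s.1 * val3 K ^ 2 *
        (evalW 1 (weierstrass K 3 9) + lambertL s 3 - 2 * lambertP K 9) := by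
  have h1 := genCorner_mul s
  have h2 := weierstrass_sub_bdry s
  have hC := C_mul_C_inv s
  have hs : (C s.1 : K⟦X⟧) ≠ 0 := left_ne_zero_of_mul_eq_one hC
  apply mul_left_cancel₀ hs
  linear_combination (1 + C s.1 + C s.1 ^ 2) * h1 + val3 K ^ 2 * h2

lemma evalW_lambertTerm (s : Kˣ) {b : ℕ} (hb : 0 < b) :
    evalW s (lsum (lambertTerm (K := K) b)) = lambertP K b + lambertL s b := by
  rw [evalW_lsum, lambertP, lambertL, ← lsum_add]
  refine congrArg lsum (funext fun n => ?_)
  have he : 0 < b * (n + 1) := by positivity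
  simp only [lambertTerm, map_mul, map_add, map_natCast, map_one, map_pow, evalW_X,
    evalW_wpow, map_evalW_ginv s (constantCoeff_X_pow (R := K[T;T⁻¹]) he),
    map_evalW_ginv s (constantCoeff_X_pow_mul (R := K[T;T⁻¹]) he _), zpow_one, zpow_neg_one]
  ring

theorem evalW_theta_two [CharZero K] (s : Kˣ) {b : ℕ} (hb : 0 < b) : evalW s (theta K 2 0 b) =
    evalW s (theta K 0 0 b) * (1 - 8 * (lambertP K b + lambertL s b)) := by
  rw [theta_two_eq hb, map_mul, map_sub, map_mul, map_one, map_ofNat, evalW_lambertTerm s hb]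

end Solution

end Kreweras

end

open scoped PowerSeries LaurentSeries

noncomputable section

namespace Kreweras

/-! ### Winding angles and the sectors of the universal cover -/

section Combinatorics

/-- The primitive cube root of unity. -/
def omega : ℂ := Complex.exp (2 * Real.pi * Complex.I / 3)

lemma omega_eq : omega = ⟨-1 / 2, Real.sqrt 3 / 2⟩ := exp_third

lemma omega_quadratic : omega ^ 2 + omega + 1 = 0 := by
  have h3 : Real.sqrt 3 * Real.sqrt 3 = 3 := Real.mul_self_sqrt (by norm_num)
  rw [omega_eq]
  apply Complex.ext
  · simp [sq]; linear_combination -h3 / 4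
  · simp [sq]; ring

/-- Multiplication by `omega` in coordinates. -/
def rot : Equiv.Perm (ℤ × ℤ) where
  toFun v := (-v.2, v.1 - v.2)
  invFun v := (v.2 - v.1, -v.1)
  left_inv v := by ext <;> simp
  right_inv v := by ext <;> simp

lemma rot_apply (v : ℤ × ℤ) : rot v = (-v.2, v.1 - v.2) := rfl

lemma pos_rot (v : ℤ × ℤ) : pos (rot v) = omega * pos v := by
  have h := omega_quadratic
  simp only [pos, rot_apply]
  change _ + _ * omega = omega * (_ + _ * omega)
  push_cast
  linear_combination -(v.2 : ℂ) * h

lemma pos_add (v w : ℤ × ℤ) : pos (v + w) = pos v + pos w := by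
  simp [pos]; ring

lemma pos_smul (n : ℕ) (v : ℤ × ℤ) : pos (n • v) = n * pos v := by
  simp [pos]; ring

/-- The vertices from which there is an edge to the origin. -/
def IsDir (u : ℤ × ℤ) : Prop := u = (-1, 0) ∨ u = (0, -1) ∨ u = (1, 1)

lemma isDir_of_edge {u : ℤ × ℤ} (h : Edge u 0) : IsDir u := by
  obtain ⟨a, b⟩ := u
  simp only [Edge, IsDir, Prod.ext_iff, Prod.fst_sub, Prod.snd_sub, Prod.fst_zero,
    Prod.snd_zero] at h ⊢
  omega

lemma IsDir.rot {u : ℤ × ℤ} (h : IsDir u) : IsDir (Kreweras.rot u) := by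
  rcases h with rfl | rfl | rfl <;> simp [IsDir, rot_apply]

lemma rot_rot_rot (v : ℤ × ℤ) : rot (rot (rot v)) = v := by
  ext
  · simp [rot_apply]
  · simp only [rot_apply]; ring

lemma edge_iff {u : ℤ × ℤ} (hu : IsDir u) (v w : ℤ × ℤ) :
    Edge v w ↔ v = w + u ∨ v = w + rot (rot u) ∨ v = w + rot u := by
  obtain ⟨a, b⟩ := v
  obtain ⟨c, d⟩ := w
  rcases hu with rfl | rfl | rfl <;>
  · simp only [Edge, rot_apply, Prod.ext_iff, Prod.fst_sub, Prod.snd_sub, Prod.fst_add,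
      Prod.snd_add]
    omega

/-- The rotated copies of the starting point. -/
def dir (w₀ : ℤ × ℤ) (k : ℤ) : ℤ × ℤ := (rot ^ k) w₀

lemma dir_add_one (w₀ : ℤ × ℤ) (k : ℤ) : dir w₀ (k + 1) = rot (dir w₀ k) := by
  rw [dir, add_comm, zpow_one_add]; rfl

lemma dir_sub_one (w₀ : ℤ × ℤ) (k : ℤ) : dir w₀ (k - 1) = rot (rot (dir w₀ k)) := by
  have h := dir_add_one w₀ (k - 1)
  rw [sub_add_cancel] at h
  rw [h, rot_rot_rot]

lemma dir_zero (w₀ : ℤ × ℤ) : dir w₀ 0 = w₀ := by simp [dir]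

lemma isDir_dir {w₀ : ℤ × ℤ} (h : IsDir w₀) (k : ℤ) : IsDir (dir w₀ k) := by
  induction k using Int.induction_on with
  | zero => rwa [dir_zero]
  | succ k ih => rw [dir_add_one]; exact ih.rot
  | pred k ih => rw [dir_sub_one]; exact ih.rot.rot

lemma pos_dir (w₀ : ℤ × ℤ) (k : ℤ) :
    pos (dir w₀ k) = Complex.exp ((2 * Real.pi * k / 3 : ℝ) * Complex.I) * pos w₀ := by
  have key : ∀ k : ℤ, Complex.exp ((2 * Real.pi * (k + 1 : ℤ) / 3 : ℝ) * Complex.I) =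
      omega * Complex.exp ((2 * Real.pi * k / 3 : ℝ) * Complex.I) := fun k => by
    rw [omega, ← Complex.exp_add]
    congr 1
    push_cast
    ring
  induction k using Int.induction_on with
  | zero => simp [dir_zero]
  | succ k ih =>
    rw [dir_add_one, pos_rot, ih, key]
    exact (mul_assoc _ _ _).symm
  | pred k ih =>
    have h1 := dir_add_one w₀ (-(k : ℤ) - 1)
    have h2 := key (-(k : ℤ) - 1)
    rw [sub_add_cancel] at h1 h2
    have h3 := pos_rot (dir w₀ (-(k : ℤ) - 1))
    have h4 : omega ≠ 0 := Complex.exp_ne_zero _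
    apply mul_left_cancel₀ h4
    rw [← h3, ← h1, ih, h2, mul_assoc]

/-- A point of a sector, in the coordinates of the sector. -/
def sectorPt (i j : ℕ) : ℂ := (i + 1 : ℕ) + j * omega ^ 2

/-- The vertex with coordinates `i`, `j` in the sector of index `k`. -/
def vertex (w₀ : ℤ × ℤ) (k : ℤ) (i j : ℕ) : ℤ × ℤ := (i + 1) • dir w₀ k + j • rot (rot (dir w₀ k))

/-- The angle of the vertex with coordinates `i`, `j` in the sector of index `k`. -/
def angle (k : ℤ) (i j : ℕ) : ℝ := 2 * Real.pi * k / 3 + Complex.arg (sectorPt i j)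

lemma sectorPt_im (i j : ℕ) : (sectorPt i j).im = -(j * (Real.sqrt 3 / 2)) := by
  have h : sectorPt i j = (i + 1 : ℕ) - j - j * omega := by
    rw [sectorPt]
    linear_combination (j : ℂ) * omega_quadratic
  rw [h, omega_eq]
  simp

lemma sectorPt_zero_right (i : ℕ) : sectorPt i 0 = ((i + 1 : ℕ) : ℝ) := by
  simp [sectorPt]

lemma arg_sectorPt_zero_right (i : ℕ) : Complex.arg (sectorPt i 0) = 0 := by
  rw [sectorPt_zero_right]
  exact Complex.arg_ofReal_of_nonneg (by positivity)

lemma arg_sectorPt_neg (i j : ℕ) : Complex.arg (sectorPt i (j + 1)) < 0 := by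
  rw [Complex.arg_neg_iff, sectorPt_im]
  have : 0 < Real.sqrt 3 := Real.sqrt_pos.2 (by norm_num)
  have h2 : (0 : ℝ) < (j + 1 : ℕ) := by positivity
  nlinarith [mul_pos h2 this]

lemma arg_sectorPt_nonpos (i j : ℕ) : Complex.arg (sectorPt i j) ≤ 0 := by
  rcases j with _ | j
  · exact (arg_sectorPt_zero_right i).le
  · exact (arg_sectorPt_neg i j).le

lemma sectorPt_ne_zero (i j : ℕ) : sectorPt i j ≠ 0 := by
  rcases j with _ | j
  · rw [sectorPt_zero_right]
    exact_mod_cast (Nat.succ_ne_zero i)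
  · intro h
    have := arg_sectorPt_neg i j
    rw [h, Complex.arg_zero] at this
    exact lt_irrefl _ this

lemma pos_vertex (w₀ : ℤ × ℤ) (k : ℤ) (i j : ℕ) : pos (vertex w₀ k i j) =
    ‖sectorPt i j‖ * Complex.exp (angle k i j * Complex.I) * pos w₀ := by
  have h : pos (vertex w₀ k i j) = sectorPt i j * pos (dir w₀ k) := by
    rw [vertex, pos_add, pos_smul, pos_smul, pos_rot, pos_rot, sectorPt]
    ring
  rw [h, pos_dir, angle, Complex.ofReal_add, add_mul, Complex.exp_add]
  conv_lhs => rw [← Complex.norm_mul_exp_arg_mul_I (sectorPt i j)]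
  ring

lemma pos_ne_zero {v : ℤ × ℤ} (hv : v ≠ 0) : pos v ≠ 0 :=
  norm_pos_iff.mp (lt_of_lt_of_le one_pos (one_le_norm_pos hv))

lemma IsDir.ne_zero {u : ℤ × ℤ} (h : IsDir u) : u ≠ 0 := by
  rcases h with rfl | rfl | rfl <;> simp

lemma pos_zero : pos 0 = 0 := by simp [pos]

lemma vertex_ne_zero {w₀ : ℤ × ℤ} (h : IsDir w₀) (k : ℤ) (i j : ℕ) : vertex w₀ k i j ≠ 0 := by
  intro h0
  have h1 := pos_vertex w₀ k i j
  rw [h0, pos_zero] at h1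
  exact mul_ne_zero (mul_ne_zero (Complex.ofReal_ne_zero.2 (norm_ne_zero_iff.2
    (sectorPt_ne_zero i j))) (Complex.exp_ne_zero _)) (pos_ne_zero h.ne_zero) h1.symm

/-- `angle` lifts the argument to the universal cover, and the principal argument of a quotient is
the difference of lifts when this lies in (-π, π]. Hence `edgeAngle` sums to `angle` along a walk.
-/
lemma edgeAngle_vertex {w₀ : ℤ × ℤ} (h : IsDir w₀) {k k' : ℤ} {i j i' j' : ℕ}
    (h1 : -Real.pi < angle k' i' j' - angle k i j) (h2 : angle k' i' j' - angle k i j ≤ Real.pi) :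
    edgeAngle (vertex w₀ k i j) (vertex w₀ k' i' j') = angle k' i' j' - angle k i j := by
  have hw := pos_ne_zero h.ne_zero
  have hn := norm_pos_iff.2 (sectorPt_ne_zero i j)
  have hn' := norm_pos_iff.2 (sectorPt_ne_zero i' j')
  have hnc : ((‖sectorPt i j‖ : ℝ) : ℂ) ≠ 0 := Complex.ofReal_ne_zero.2 hn.ne'
  have he := Complex.exp_ne_zero (angle k i j * Complex.I)
  have e : pos (vertex w₀ k' i' j') / pos (vertex w₀ k i j) =
      ((‖sectorPt i' j'‖ / ‖sectorPt i j‖ : ℝ) : ℂ) *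
        Complex.exp ((angle k' i' j' - angle k i j : ℝ) * Complex.I) := by
    rw [pos_vertex, pos_vertex]
    push_cast
    rw [sub_mul, Complex.exp_sub]
    field_simp
  rw [edgeAngle, e, Complex.arg_real_mul _ (div_pos hn' hn), Complex.arg_exp_mul_I]
  exact (toIocMod_eq_self Real.two_pi_pos).2 ⟨h1, by linarith⟩

/-- The walks from `w₀` to `v` with a given winding angle. -/
def walks (w₀ : ℤ × ℤ) (n : ℕ) (v : ℤ × ℤ) (θ : ℝ) : Set (Fin (n + 1) → ℤ × ℤ) :=
  {γ | IsWalk γ ∧ γ 0 = w₀ ∧ γ (Fin.last n) = v ∧ windingAngle γ = θ}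

lemma walks_zero (w₀ : ℤ × ℤ) (n : ℕ) (θ : ℝ) : walks w₀ n 0 θ = ∅ :=
  Set.eq_empty_of_forall_notMem fun _ h => h.1.2 _ h.2.2.1

lemma windingAngle_snoc {n : ℕ} (γ : Fin (n + 1) → ℤ × ℤ) (v : ℤ × ℤ) :
    windingAngle (n := n + 1) (Fin.snoc γ v) = windingAngle γ + edgeAngle (γ (Fin.last n)) v := by
  rw [windingAngle, Fin.sum_univ_castSucc, windingAngle]
  congr 1
  · refine Finset.sum_congr rfl fun i _ => ?_
    rw [← Fin.castSucc_succ, Fin.snoc_castSucc (α := fun _ => ℤ × ℤ),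
      Fin.snoc_castSucc (α := fun _ => ℤ × ℤ)]
  · rw [Fin.snoc_castSucc (α := fun _ => ℤ × ℤ), Fin.succ_last,
      Fin.snoc_last (α := fun _ => ℤ × ℤ)]

lemma isWalk_snoc {n : ℕ} (γ : Fin (n + 1) → ℤ × ℤ) (v : ℤ × ℤ) :
    IsWalk (n := n + 1) (Fin.snoc γ v) ↔ IsWalk γ ∧ Edge (γ (Fin.last n)) v ∧ v ≠ 0 := by
  simp only [IsWalk]
  rw [Fin.forall_fin_succ', Fin.forall_fin_succ' (P := fun i =>
    (Fin.snoc γ v : Fin (n + 1 + 1) → ℤ × ℤ) i ≠ 0)]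
  simp only [← Fin.castSucc_succ, Fin.snoc_castSucc (α := fun _ => ℤ × ℤ), Fin.succ_last,
    Fin.snoc_last (α := fun _ => ℤ × ℤ)]
  tauto

/-- Removal of the last step. The use of `encard` makes prior knowledge of finiteness unnecessary.
-/
lemma encard_walks_succ {w₀ u v : ℤ × ℤ} (hu : IsDir u) (hv : v ≠ 0) (n : ℕ) (θ : ℝ) :
    (walks w₀ (n + 1) v θ).encard =
      (walks w₀ n (v + u) (θ - edgeAngle (v + u) v)).encard +
      (walks w₀ n (v + rot (rot u)) (θ - edgeAngle (v + rot (rot u)) v)).encard +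
      (walks w₀ n (v + rot u) (θ - edgeAngle (v + rot u) v)).encard := by
  have hne : u ≠ rot (rot u) ∧ u ≠ rot u ∧ rot (rot u) ≠ rot u := by
    rcases hu with rfl | rfl | rfl <;> simp [rot_apply]
  have hdis : ∀ {v₁ v₂ : ℤ × ℤ} (θ₁ θ₂ : ℝ), v₁ ≠ v₂ →
      Disjoint (walks w₀ n v₁ θ₁) (walks w₀ n v₂ θ₂) := fun θ₁ θ₂ h =>
    Set.disjoint_left.2 fun γ h1 h2 => h (h1.2.2.1.symm.trans h2.2.2.1)
  have hinj : Function.Injective (fun γ : Fin (n + 1) → ℤ × ℤ =>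
      (Fin.snoc γ v : Fin (n + 1 + 1) → ℤ × ℤ)) := fun γ γ' h => by
    have := congrArg (Fin.init (α := fun _ => ℤ × ℤ)) h
    simpa using this
  rw [← Set.encard_union_eq (hdis _ _ (by simpa using hne.1)), ← Set.encard_union_eq
    (Set.disjoint_union_left.2 ⟨hdis _ _ (by simpa using hne.2.1),
      hdis _ _ (by simpa using hne.2.2)⟩), ← hinj.encard_image]
  congr 1
  ext γ
  constructor
  · rintro ⟨h1, h2, h3, h4⟩
    obtain ⟨γ', v', rfl⟩ : ∃ (γ' : Fin (n + 1) → ℤ × ℤ) (v' : ℤ × ℤ),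
      γ = Fin.snoc γ' v' := ⟨Fin.init γ, γ (Fin.last _), (Fin.snoc_init_self γ).symm⟩
    rw [Fin.snoc_last (α := fun _ => ℤ × ℤ)] at h3
    subst h3
    rw [isWalk_snoc] at h1
    rw [windingAngle_snoc] at h4
    have h2' : γ' 0 = w₀ := by
      rw [← h2]
      exact (Fin.snoc_castSucc (α := fun _ => ℤ × ℤ) v' γ' 0).symm
    refine ⟨γ', ?_, rfl⟩
    have h5 := h1.2.1
    rw [edge_iff hu] at h5
    rcases h5 with h5 | h5 | h5
    · exact Or.inl (Or.inl ⟨h1.1, h2', h5, by rw [← h5]; linarith⟩)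
    · exact Or.inl (Or.inr ⟨h1.1, h2', h5, by rw [← h5]; linarith⟩)
    · exact Or.inr ⟨h1.1, h2', h5, by rw [← h5]; linarith⟩
  · rintro ⟨γ', h, rfl⟩
    have key : ∃ v', (v' = v + u ∨ v' = v + rot (rot u) ∨ v' = v + rot u) ∧
        γ' ∈ walks w₀ n v' (θ - edgeAngle v' v) := by
      rcases h with (h | h) | h
      · exact ⟨_, Or.inl rfl, h⟩
      · exact ⟨_, Or.inr (Or.inl rfl), h⟩
      · exact ⟨_, Or.inr (Or.inr rfl), h⟩
    obtain ⟨v', hv', h1, h2, h3, h4⟩ := key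
    refine ⟨(isWalk_snoc _ _).2 ⟨h1, ?_, hv⟩, ?_, Fin.snoc_last (α := fun _ => ℤ × ℤ) _ _, ?_⟩
    · rw [h3, edge_iff hu]; exact hv'
    · rw [← h2]
      exact Fin.snoc_castSucc (α := fun _ => ℤ × ℤ) v γ' 0
    · rw [windingAngle_snoc, h4, h3]; ring

/-- The number of walks that reach a vertex by the third kind of step. -/
def diagonalStep (c : ℤ → ℕ → ℕ → ℕ) (k : ℤ) : ℕ → ℕ → ℕ
  | i, 0 => c (k + 1) 0 (i + 1)
  | 0, 1 => 0
  | 0, j + 2 => c (k - 1) j 0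
  | i + 1, j + 1 => c k i j

/-- The number of walks of length `n` that end at the vertex with coordinates `i`, `j` in the sector
of index `k`, by recursion. -/
def sectorCount : ℕ → ℤ → ℕ → ℕ → ℕ
  | 0 => fun k i j => if k = 0 ∧ i = 0 ∧ j = 0 then 1 else 0
  | n + 1 => fun k i j => sectorCount n k (i + 1) j + sectorCount n k i (j + 1) +
      diagonalStep (sectorCount n) k i j

lemma angle_mem (k : ℤ) (i j : ℕ) :
    2 * Real.pi * k / 3 - Real.pi < angle k i j ∧ angle k i j ≤ 2 * Real.pi * k / 3 := by
  have h1 := arg_sectorPt_nonpos i j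
  have h2 := Complex.neg_pi_lt_arg (sectorPt i j)
  constructor <;> rw [angle] <;> linarith

lemma walks_vertex {w₀ : ℤ × ℤ} (h : IsDir w₀) (n : ℕ) {k k' : ℤ} {i j i' j' : ℕ} {v : ℤ × ℤ}
    (hv : v = vertex w₀ k' i' j') (h1 : -Real.pi < angle k i j - angle k' i' j')
    (h2 : angle k i j - angle k' i' j' ≤ Real.pi) :
    walks w₀ n v (angle k i j - edgeAngle v (vertex w₀ k i j)) =
      walks w₀ n (vertex w₀ k' i' j') (angle k' i' j') := by
  rw [hv, edgeAngle_vertex h h1 h2, sub_sub_cancel]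

/-- Prescribing both the end point and the angle means prescribing a point of the universal cover.
Induction on the length: each predecessor is located in its sector, with an angle that differs by at
most π. -/
theorem encard_walks_vertex {w₀ : ℤ × ℤ} (h : IsDir w₀) (n : ℕ) (k : ℤ) (i j : ℕ) :
    (walks w₀ n (vertex w₀ k i j) (angle k i j)).encard = sectorCount n k i j := by
  induction n generalizing k i j with
  | zero =>
    simp only [sectorCount]
    split_ifs with hk
    · obtain ⟨rfl, rfl, rfl⟩ := hk
      have : walks w₀ 0 (vertex w₀ 0 0 0) (angle 0 0 0) = {fun _ => w₀} := by
        ext γ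
        have e1 : vertex w₀ 0 0 0 = w₀ := by simp [vertex, dir_zero]
        have e2 : angle 0 0 0 = 0 := by simp [angle, arg_sectorPt_zero_right]
        rw [e1, e2]
        constructor
        · rintro ⟨-, h2, -, -⟩
          funext x
          rw [Fin.fin_one_eq_zero x]; exact h2
        · rintro rfl
          exact ⟨⟨fun x => x.elim0, fun _ => h.ne_zero⟩, rfl, rfl, by simp [windingAngle]⟩
      rw [this, Set.encard_singleton]
      rfl
    · rw [Nat.cast_zero, Set.encard_eq_zero]
      refine Set.eq_empty_of_forall_notMem ?_
      rintro γ ⟨-, h2, h3, h4⟩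
      have h5 : angle k i j = 0 := by rw [← h4]; simp [windingAngle]
      have h6 : vertex w₀ k i j = w₀ := by
        rw [← h3, ← h2]; rfl
      -- Angle 0 leaves only the sectors k = 0 and k = 1; of their points only the corner of sector
      -- 0 is both at angle 0 and equal to w₀.
      obtain ⟨h7, h8⟩ := angle_mem k i j
      have hpi := Real.pi_pos
      have hk0 : (0 : ℝ) ≤ k := by
        by_contra hlt
        nlinarith
      have hk1 : (k : ℝ) < 2 := by
        by_contra hlt
        nlinarith
      have hk0' : 0 ≤ k := by exact_mod_cast hk0
      have hk1' : k < 2 := by exact_mod_cast hk1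
      obtain rfl | rfl : k = 0 ∨ k = 1 := by omega
      · rcases j with _ | j
        · rw [vertex, dir_zero] at h6
          apply hk
          refine ⟨rfl, ?_, rfl⟩
          rcases h with rfl | rfl | rfl <;> simp at h6 <;> omega
        · have := arg_sectorPt_neg i j
          rw [angle] at h5
          simp at h5
          linarith
      · have h9 := dir_add_one w₀ 0
        rw [zero_add, dir_zero] at h9
        rw [vertex, h9, rot_rot_rot] at h6
        rcases h with rfl | rfl | rfl <;> simp [rot_apply] at h6 <;> omega
  | succ n ih =>
    have hb : ∀ i' j', -Real.pi < angle k i j - angle k i' j' ∧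
        angle k i j - angle k i' j' ≤ Real.pi := fun i' j' => by
      obtain ⟨a1, a2⟩ := angle_mem k i j
      obtain ⟨b1, b2⟩ := angle_mem k i' j'
      constructor <;> linarith
    have hpi := Real.pi_pos
    have hd := isDir_dir h k
    have hsum : dir w₀ k + rot (dir w₀ k) + rot (rot (dir w₀ k)) = 0 := by
      rcases hd with hd | hd | hd <;> rw [hd] <;> simp [rot_apply]
    have e1 : vertex w₀ k i j + dir w₀ k = vertex w₀ k (i + 1) j := by
      rw [vertex, vertex]; module
    have e2 : vertex w₀ k i j + rot (rot (dir w₀ k)) = vertex w₀ k i (j + 1) := by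
      rw [vertex, vertex]; module
    rw [encard_walks_succ hd (vertex_ne_zero h k i j), walks_vertex h n e1 (hb _ _).1 (hb _ _).2,
      walks_vertex h n e2 (hb _ _).1 (hb _ _).2, ih, ih, sectorCount]
    push_cast
    congr 1
    have hr : rot (dir w₀ k) = -dir w₀ k - rot (rot (dir w₀ k)) := by
      rw [eq_sub_iff_add_eq, eq_neg_iff_add_eq_zero, ← hsum]; abel
    -- The third predecessor is displaced by (-1, -1) in sector coordinates. It falls into the next
    -- sector when j = 0, on the origin at (0, 1), on the axis of the previous sector when i = 0 and
    -- j ≥ 2, and otherwise stays in the sector.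
    rcases j with _ | _ | j
    · have e3 : vertex w₀ k i 0 + rot (dir w₀ k) = vertex w₀ (k + 1) 0 (i + 1) := by
        rw [vertex, vertex, dir_add_one, rot_rot_rot]; module
      obtain ⟨b1, b2⟩ := angle_mem (k + 1) 0 (i + 1)
      have a : angle k i 0 = 2 * Real.pi * k / 3 := by
        rw [angle, arg_sectorPt_zero_right, add_zero]
      push_cast at b1 b2
      rw [walks_vertex h n e3 (by linarith) (by linarith), ih]
      simp [diagonalStep]
    · rcases i with _ | i
      · have e3 : vertex w₀ k 0 (0 + 1) + rot (dir w₀ k) = 0 := by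
          rw [vertex]
          generalize rot (rot (dir w₀ k)) = x at hr ⊢
          rw [hr]; module
        rw [e3, walks_zero]
        simp [diagonalStep]
      · have e3 : vertex w₀ k (i + 1) (0 + 1) + rot (dir w₀ k) = vertex w₀ k i 0 := by
          rw [vertex, vertex]
          generalize rot (rot (dir w₀ k)) = x at hr ⊢
          rw [hr]; module
        rw [walks_vertex h n e3 (hb _ _).1 (hb _ _).2, ih]
        simp [diagonalStep]
    · rcases i with _ | i
      · have e3 : vertex w₀ k 0 (j + 1 + 1) + rot (dir w₀ k) = vertex w₀ (k - 1) j 0 := by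
          rw [vertex, vertex, dir_sub_one]
          generalize rot (rot (dir w₀ k)) = x at hr ⊢
          rw [hr]; module
        obtain ⟨b1, b2⟩ := angle_mem k 0 (j + 1 + 1)
        have a : angle (k - 1) j 0 = 2 * Real.pi * (k - 1 : ℤ) / 3 := by
          rw [angle, arg_sectorPt_zero_right, add_zero]
        push_cast at a
        rw [walks_vertex h n e3 (by linarith) (by linarith), ih]
        simp [diagonalStep]
      · have e3 : vertex w₀ k (i + 1) (j + 1 + 1) + rot (dir w₀ k) = vertex w₀ k i (j + 1) := by
          rw [vertex, vertex]
          generalize rot (rot (dir w₀ k)) = x at hr ⊢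
          rw [hr]; module
        rw [walks_vertex h n e3 (hb _ _).1 (hb _ _).2, ih]
        simp [diagonalStep]

/-- The winding angle determines the direction of the end point, so it singles out which neighbour
of the origin the walk ends at. -/
lemma pos_last {n : ℕ} (γ : Fin (n + 1) → ℤ × ℤ) (hγ : ∀ i, γ i ≠ 0) : ∃ r : ℝ, 0 < r ∧
    pos (γ (Fin.last n)) = r * Complex.exp (windingAngle γ * Complex.I) * pos (γ 0) := by
  induction n with
  | zero => exact ⟨1, one_pos, by simp [windingAngle]⟩
  | succ n ih =>
    obtain ⟨γ', v', rfl⟩ : ∃ (γ' : Fin (n + 1) → ℤ × ℤ) (v' : ℤ × ℤ),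
      γ = Fin.snoc γ' v' := ⟨Fin.init γ, γ (Fin.last _), (Fin.snoc_init_self γ).symm⟩
    have h1 : ∀ i, γ' i ≠ 0 := fun i => by
      have := hγ i.castSucc
      rwa [Fin.snoc_castSucc (α := fun _ => ℤ × ℤ)] at this
    have h2 : v' ≠ 0 := by
      have := hγ (Fin.last _)
      rwa [Fin.snoc_last (α := fun _ => ℤ × ℤ)] at this
    obtain ⟨r, hr, h3⟩ := ih γ' h1
    have h0 : (Fin.snoc γ' v' : Fin (n + 1 + 1) → ℤ × ℤ) 0 = γ' 0 :=
      Fin.snoc_castSucc (α := fun _ => ℤ × ℤ) v' γ' 0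
    have hp := pos_ne_zero (h1 (Fin.last n))
    obtain ⟨q, hq⟩ : ∃ q, q = pos v' / pos (γ' (Fin.last n)) := ⟨_, rfl⟩
    have hq0 : q ≠ 0 := hq ▸ div_ne_zero (pos_ne_zero h2) hp
    have hv : pos v' = q * pos (γ' (Fin.last n)) := by rw [hq, div_mul_cancel₀ _ hp]
    refine ⟨‖q‖ * r, mul_pos (norm_pos_iff.2 hq0) hr, ?_⟩
    rw [Fin.snoc_last (α := fun _ => ℤ × ℤ), windingAngle_snoc, h0, edgeAngle, ← hq,
      Complex.ofReal_add, add_mul, Complex.exp_add, hv, h3, Complex.ofReal_mul]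
    linear_combination -(r * Complex.exp (windingAngle γ' * Complex.I) * pos (γ' 0)) *
      Complex.norm_mul_exp_arg_mul_I q

/-- Among the three neighbours of the origin only `dir w₀ k` lies in the direction prescribed by the
winding angle: the ratios to it of the other two, ω and ω², are not real. -/
theorem walkCount_eq {w₀ : ℤ × ℤ} (h : Edge w₀ 0) (n : ℕ) (k : ℤ) :
    walkCount w₀ n k = sectorCount n k 0 0 := by
  have hd := isDir_of_edge h
  have hang : angle k 0 0 = 2 * Real.pi * k / 3 := by
    rw [angle, arg_sectorPt_zero_right, add_zero]
  have hver : ∀ k, vertex w₀ k 0 0 = dir w₀ k := fun k => by simp [vertex]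
  have hset : {γ : Fin (n + 1) → ℤ × ℤ | IsWalk γ ∧ γ 0 = w₀ ∧ Edge (γ (Fin.last n)) 0 ∧
      windingAngle γ = 2 * Real.pi * k / 3} = walks w₀ n (vertex w₀ k 0 0) (angle k 0 0) := by
    ext γ
    rw [hang, hver]
    constructor
    · rintro ⟨h1, h2, h3, h4⟩
      refine ⟨h1, h2, ?_, h4⟩
      obtain ⟨r, hr, h5⟩ := pos_last γ h1.2
      rw [edge_iff (isDir_dir hd k)] at h3
      have hz : Complex.exp ((2 * Real.pi * k / 3 : ℝ) * Complex.I) * pos w₀ ≠ 0 :=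
        mul_ne_zero (Complex.exp_ne_zero _) (pos_ne_zero hd.ne_zero)
      rw [h4, h2] at h5
      have him : ∀ c : ℂ, pos (γ (Fin.last n)) = c * pos (dir w₀ k) → c.im = 0 := fun c hc => by
        rw [pos_dir, h5, mul_assoc] at hc
        rw [← mul_right_cancel₀ hz hc, Complex.ofReal_im]
      rcases h3 with h3 | h3 | h3
      · rw [h3, zero_add]
      · exfalso
        have := him (omega ^ 2) (by rw [h3, zero_add, pos_rot, pos_rot]; ring)
        rw [show omega ^ 2 = -1 - omega by linear_combination omega_quadratic, omega_eq] at this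
        simp at this
      · exfalso
        have := him omega (by rw [h3, zero_add, pos_rot])
        rw [omega_eq] at this
        simp at this
    · rintro ⟨h1, h2, h3, h4⟩
      refine ⟨h1, h2, ?_, h4⟩
      rw [h3, edge_iff (isDir_dir hd k)]
      exact Or.inl (zero_add _).symm
  have he := encard_walks_vertex hd n k 0 0
  rw [← hset] at he
  rw [walkCount]
  change Nat.card ↥{γ : Fin (n + 1) → ℤ × ℤ | IsWalk γ ∧ γ 0 = w₀ ∧ Edge (γ (Fin.last n)) 0 ∧
      windingAngle γ = 2 * Real.pi * k / 3} = _
  rw [Nat.card_coe_set_eq, Set.ncard, he, ENat.toNat_natCast]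

end Combinatorics

end Kreweras

end

open scoped PowerSeries LaurentSeries

noncomputable section

namespace Kreweras

open PowerSeries
open scoped LaurentPolynomial

/-! ### From counts of walks to the generating function -/

section Counting

variable {R : Type*} [CommRing R]

/-- The contribution of the third kind of step to the transfer operator. -/
def diagonalTerm (s : Rˣ) (f : ℕ × ℕ →₀ R) : ℕ → ℕ → R
  | i, 0 => (s⁻¹ : Rˣ).1 * f (0, i + 1)
  | 0, 1 => 0
  | 0, j + 2 => s.1 * f (j, 0)
  | i + 1, j + 1 => f (i, j)

lemma step_single (s : Rˣ) (p : ℕ × ℕ) (a : R) :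
    step s (Finsupp.single p a) = a • stepFrom s p := by
  rw [step, Finsupp.linearCombination_single]

/-- The transfer operator sorted by target instead of source, which is the shape of the recursion
`sectorCount`. -/
lemma step_apply (s : Rˣ) (f : ℕ × ℕ →₀ R) (i j : ℕ) :
    step s f (i, j) = f (i + 1, j) + f (i, j + 1) + diagonalTerm s f i j := by
  induction f using Finsupp.induction_linear with
  | zero => rcases i with _ | i <;> rcases j with _ | _ | j <;> simp [diagonalTerm]
  | add f g hf hg =>
    rw [map_add, Finsupp.add_apply, hf, hg]
    rcases i with _ | i <;> rcases j with _ | _ | j <;> simp [diagonalTerm] <;> ring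
  | single p a =>
    obtain ⟨a', b'⟩ := p
    rw [step_single, Finsupp.smul_apply, stepFrom]
    rcases a' with _ | a' <;> rcases b' with _ | b' <;> rcases i with _ | i <;>
      rcases j with _ | _ | j <;> simp [diagonalTerm, Finsupp.single_apply] <;>
      simp only [@eq_comm ℕ 0, add_mul, ite_mul, one_mul, zero_mul, mul_comm a] <;> ring

variable {S : Type*} [CommRing S]

/-- Coefficients of powers of s can be read off over Laurent polynomials but not over rational
functions; this moves the count from the former to the latter. -/
lemma walkVec_map (φ : R →+* S) {s : Rˣ} {s' : Sˣ} (hs : s'.1 = φ s.1) (n i j : ℕ) :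
    walkVec s' n (i, j) = φ (walkVec s n (i, j)) := by
  have hs' : (s'⁻¹ : Sˣ).1 = φ (s⁻¹ : Rˣ).1 := by
    have : s' = Units.map φ.toMonoidHom s := Units.ext hs
    rw [this]
    rfl
  induction n generalizing i j with
  | zero => simp [walkVec, Finsupp.single_apply, apply_ite φ]
  | succ n ih =>
    rw [walkVec, walkVec, step_apply, step_apply, ih, ih, map_add, map_add]
    congr 1
    rcases i with _ | i <;> rcases j with _ | _ | j <;>
      simp only [diagonalTerm, ih, hs, hs', map_mul, map_zero]

/-- The indeterminate of the Laurent polynomials, as a unit. -/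
def unitT (K : Type*) [Field K] : K[T;T⁻¹]ˣ where
  val := LaurentPolynomial.T 1
  inv := LaurentPolynomial.T (-1)
  val_inv := by rw [← LaurentPolynomial.T_add]; simp
  inv_val := by rw [← LaurentPolynomial.T_add]; simp

lemma coeff_T_mul {K : Type*} [Field K] (m j : ℤ) (f : K[T;T⁻¹]) :
    (LaurentPolynomial.T j * f).coeff m = f.coeff (m - j) := by
  rw [LaurentPolynomial.T,
    AddMonoidAlgebra.coeff_single_mul_eq_mul_coeff (m - j) (fun m' _ => by omega), one_mul]

theorem coeff_walkVec (K : Type*) [Field K] (n : ℕ) (k : ℤ) (i j : ℕ) :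
    (walkVec (unitT K) n (i, j)).coeff k = (sectorCount n k i j : K) := by
  induction n generalizing k i j with
  | zero =>
    simp only [walkVec, sectorCount]
    rw [Finsupp.single_apply, ← LaurentPolynomial.T_zero]
    by_cases h : i = 0 ∧ j = 0
    · obtain ⟨rfl, rfl⟩ := h
      simp only [if_true, and_true]
      rw [coeff_T]
      simp [eq_comm]
    · have h' : ¬ ((0, 0) = (i, j)) := fun e => h ⟨(Prod.mk.inj e).1.symm, (Prod.mk.inj e).2.symm⟩
      rw [if_neg h', if_neg (fun e => h e.2)]
      simp
  | succ n ih =>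
    rw [walkVec, step_apply, AddMonoidAlgebra.coeff_add, AddMonoidAlgebra.coeff_add,
      Finsupp.add_apply, Finsupp.add_apply, ih, ih, sectorCount]
    push_cast
    congr 1
    rcases i with _ | i <;> rcases j with _ | _ | j <;> simp only [diagonalTerm, diagonalStep]
    · change (LaurentPolynomial.T (-1) * _).coeff k = _
      rw [coeff_T_mul, ih, sub_neg_eq_add]
    · simp
    · change (LaurentPolynomial.T 1 * _).coeff k = _
      rw [coeff_T_mul, ih]
    · change (LaurentPolynomial.T (-1) * _).coeff k = _
      rw [coeff_T_mul, ih, sub_neg_eq_add]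
    · exact ih _ _ _
    · exact ih _ _ _

lemma eval₂_eq_finsum {K : Type*} [Field K] (s : Kˣ) (f : K[T;T⁻¹]) :
    LaurentPolynomial.eval₂ (RingHom.id K) s f = ∑ᶠ k : ℤ, f.coeff k * (s.1 : K) ^ k := by
  have hfin : ∀ g : K[T;T⁻¹], (Function.support fun k : ℤ => g.coeff k * (s.1 : K) ^ k).Finite :=
    fun g => g.coeff.hasFiniteSupport.subset fun k hk => by
      rw [Function.mem_support] at hk ⊢
      exact left_ne_zero_of_mul hk
  induction f using LaurentPolynomial.induction_on' with
  | add p q hp hq =>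
    rw [map_add, hp, hq, ← finsum_add_distrib (hfin p) (hfin q)]
    congr 1
    funext k
    simp [add_mul]
  | C_mul_T n a =>
    rw [finsum_eq_single _ n]
    · rw [← LaurentPolynomial.single_eq_C_mul_T, AddMonoidAlgebra.coeff_single,
        Finsupp.single_eq_same, LaurentPolynomial.single_eq_C_mul_T]
      simp
    · intro k hk
      rw [← LaurentPolynomial.single_eq_C_mul_T, AddMonoidAlgebra.coeff_single,
        Finsupp.single_eq_of_ne hk, zero_mul]

/-- The indeterminate of the rational functions, as a unit. -/
def unitX : (RatFunc ℚ)ˣ := Units.mk0 RatFunc.X RatFunc.X_ne_zero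

theorem walkGF_eq {w₀ : ℤ × ℤ} (h : Edge w₀ 0) :
    walkGF w₀ = genCorner unitX (X : (RatFunc ℚ)⟦X⟧) := by
  have hd : ∀ n, (X : (RatFunc ℚ)⟦X⟧) ^ n ∣ X ^ n * C (walkVec unitX n (0, 0)) := fun n =>
    Dvd.intro _ rfl
  ext n
  rw [walkGF, coeff_mk, genCorner, coeff_lsum, Finset.sum_eq_single n]
  · rw [coeff_X_pow_mul', if_pos le_rfl, Nat.sub_self, coeff_zero_C]
    have h1 := walkVec_map (LaurentPolynomial.eval₂ (RingHom.id (RatFunc ℚ)) unitX)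
      (s := unitT (RatFunc ℚ)) (s' := unitX) (by simp [unitT]) n 0 0
    rw [eval₂_eq_finsum] at h1
    rw [h1]
    congr 1
    funext k
    rw [coeff_walkVec, walkCount_eq h]
    rfl
  · intro m _ hm
    rw [coeff_X_pow_mul']
    split_ifs with h
    · rw [coeff_C, if_neg (by omega)]
    · rfl
  · intro hn
    exact absurd (Finset.mem_range.2 (Nat.lt_succ_self n)) hn

end Counting

/-! ### Theta values at `w = 1` and the series `tser` -/

section Values

variable (K : Type*) [Field K]

/-- The value at `w = 1` of the theta series with first argument `X ^ a * w`. -/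
def thetaVal (k a b : ℕ) : K⟦X⟧ := lsum fun n : ℕ => (-1) ^ n * (2 * (n : K⟦X⟧) + 1) ^ k *
  (X ^ (b * tri n + a * (n + 1)) - (-1) ^ k * X ^ (b * tri n - a * n))

lemma evalW_one_theta (k a b : ℕ) : evalW 1 (theta K k a b) = thetaVal K k a b := by
  rw [theta, evalW_lsum, thetaVal]
  refine congrArg lsum (funext fun n => ?_)
  rw [thetaTerm, map_sub, map_mul (evalW 1), map_mul (evalW 1), evalW_ofX, evalW_ofX, evalW_one_wpow, evalW_one_wpow]
  ring

variable {K}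

lemma map_thetaVal {L : Type*} [Field L] (φ : K →+* L) (k a b : ℕ) :
    PowerSeries.map φ (thetaVal K k a b) = thetaVal L k a b := by
  rw [thetaVal, map_lsum, thetaVal]
  refine congrArg lsum (funext fun n => ?_)
  simp only [map_mul, map_pow, map_sub, map_add, map_neg, map_one, map_natCast, map_ofNat,
    PowerSeries.map_X]

lemma two_mul_der0 : 2 * der0 K = thetaVal K 1 0 9 := by
  rw [← evalW_one_theta, theta_succ (by norm_num) 0, map_sub, map_mul, map_ofNat,
    evalW_one_theta_even 0 (by simp), sub_zero]
  rfl

lemma val3_eq : val3 K = thetaVal K 0 3 9 := evalW_one_theta K 0 3 9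

lemma two_mul_der3 : 2 * der3 K - val3 K = thetaVal K 1 3 9 := by
  rw [← evalW_one_theta, theta_succ (by norm_num) 0, map_sub, map_mul, map_ofNat]
  rfl

variable (K) in
/-- The denominator of `tser`. -/
def tden : K⟦X⟧ := 4 * thetaVal K 0 3 9 + 6 * thetaVal K 1 3 9

lemma tser_mul_tden : tser K * tden K = X * thetaVal K 1 0 9 := by
  rw [tden, ← two_mul_der0, ← two_mul_der3, ← val3_eq]
  linear_combination 2 * tser_mul K

lemma constantCoeff_tden : constantCoeff (tden K) = 2 := by
  rw [tden, ← two_mul_der3, ← val3_eq]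
  simp only [map_add, map_mul, map_sub, map_ofNat, constantCoeff_val3, constantCoeff_der3]
  norm_num

lemma tden_ne_zero [CharZero K] : tden K ≠ 0 := fun h => by
  have := constantCoeff_tden (K := K)
  rw [h, map_zero] at this
  exact two_ne_zero this.symm

/-- `tser` is the unique solution of a linear equation whose coefficients are theta values, and
these have integer coefficients. -/
lemma map_tser {L : Type*} [Field L] [CharZero L] (φ : K →+* L) :
    PowerSeries.map φ (tser K) = tser L := by
  have h := congrArg (PowerSeries.map φ) (tser_mul_tden (K := K))
  rw [map_mul, map_mul, map_thetaVal, PowerSeries.map_X, tden, map_add, map_mul, map_mul,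
    map_ofNat, map_ofNat, map_thetaVal, map_thetaVal, ← tser_mul_tden] at h
  exact mul_right_cancel₀ tden_ne_zero h

lemma X_pow_dvd_lsum {R : Type*} [CommRing R] {f : ℕ → R⟦X⟧} {N : ℕ}
    (h : ∀ n, (X : R⟦X⟧) ^ N ∣ f n) : (X : R⟦X⟧) ^ N ∣ lsum f := by
  rw [X_pow_dvd_iff]
  intro m hm
  rw [coeff_lsum]
  exact Finset.sum_eq_zero fun n _ => X_pow_dvd_iff.1 (h n) m hm

lemma X_pow_dvd_thetaVal_term {a b : ℕ} (h : a < b) (k n : ℕ) :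
    (X : K⟦X⟧) ^ n ∣ (-1) ^ n * (2 * (n : K⟦X⟧) + 1) ^ k *
      (X ^ (b * tri n + a * (n + 1)) - (-1) ^ k * X ^ (b * tri n - a * n)) := by
  have h1 := le_tri n
  have h2 : (a + 1) * n ≤ b * tri n := mul_le_mul_tri h n
  have h3 : tri n ≤ b * tri n := Nat.le_mul_of_pos_left _ (by omega)
  rw [add_mul] at h2
  refine Dvd.dvd.mul_left (dvd_sub (pow_dvd_pow _ (by omega))
    (Dvd.dvd.mul_left (pow_dvd_pow _ (by omega)) _)) _

/-- The theta values modulo `X ^ 9`. -/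
lemma thetaVal_mod {a : ℕ} (h : a < 9) (k : ℕ) : (X : K⟦X⟧) ^ 9 ∣ thetaVal K k a 9 -
    ((X ^ a - (-1) ^ k) - 3 ^ k * (X ^ (9 + 2 * a) - (-1) ^ k * X ^ (9 - a))) := by
  have hd := X_pow_dvd_thetaVal_term (K := K) h k
  rw [thetaVal, lsum_succ hd, lsum_succ fun n => (pow_dvd_pow _ n.le_succ).trans (hd (n + 1))]
  have t0 : tri 0 = 0 := rfl
  have t1 : tri 1 = 1 := rfl
  simp only [zero_add, t0, t1, mul_one, mul_zero, pow_zero, Nat.cast_zero, Nat.cast_one, pow_one,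
    one_pow, one_mul, Nat.sub_self]
  have e : ∀ u v x y w : K⟦X⟧, u + (v + w) - (x - y) = w + (u - x) + (v + y) := by
    intros; ring
  rw [e]
  refine dvd_add (dvd_add (X_pow_dvd_lsum fun n => ?_) ?_) ?_
  · have h1 : (a + 1) * (n + 2) ≤ 9 * (n + 2) := by gcongr; omega
    have h2 := le_tri n
    have h3 : tri (n + 1 + 1) = tri n + (n + 1) + (n + 1 + 1) := by rw [tri_succ, tri_succ]
    have h4 : a * (n + 1 + 1) ≤ 8 * (n + 1 + 1) := by gcongr; omega
    exact Dvd.dvd.mul_left (dvd_sub (pow_dvd_pow _ (by omega))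
      (Dvd.dvd.mul_left (pow_dvd_pow _ (by omega)) _)) _
  · simp
  · have e1 : 9 + a * (1 + 1) = 9 + 2 * a := by ring
    rw [e1]
    have e2 : (-1 : K⟦X⟧) * (2 + 1) ^ k * (X ^ (9 + 2 * a) - (-1) ^ k * X ^ (9 - a)) +
        3 ^ k * (X ^ (9 + 2 * a) - (-1) ^ k * X ^ (9 - a)) = 0 := by
      rw [show (2 + 1 : K⟦X⟧) = 3 by norm_num]; ring
    rw [e2]
    exact dvd_zero _

end Values

/-! ### `T` as the substitution of `r` in a theta series -/

section Laurent

variable {F : Type} [Field F]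

/-- The substitution of `r` in a power series, as a Laurent series. -/
def substL {r : F⟦X⟧} (hr : constantCoeff r = 0) : F⟦X⟧ →+* F⸨X⸩ :=
  (HahnSeries.ofPowerSeries ℤ F).comp (substAlgHom (R := F) (hasSubst_of_X_dvd hr)).toRingHom

lemma substL_apply {r : F⟦X⟧} (hr : constantCoeff r = 0) (f : F⟦X⟧) :
    substL hr f = ((f.subst r : F⟦X⟧) : F⸨X⸩) := by
  rw [substL, RingHom.comp_apply]
  congr 1
  exact congrFun (coe_substAlgHom (hasSubst_of_X_dvd hr)) f

/-- With r = q^{1/3} every `T` in the theorem has this form: c is 1 or s, a is 0 or 3, and b is 3 or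
9. -/
theorem T_eq {r : F⟦X⟧} (hr : constantCoeff r = 0) (hr0 : r ≠ 0) (c : Fˣ) {k a b : ℕ} (h : a < b) :
    T k (HahnSeries.C c.1 * (r : F⸨X⸩) ^ a) ((r : F⸨X⸩) ^ b) = substL hr (evalW c (theta F k a b)) := by
  have hs := hasSubst_of_X_dvd hr
  have hd : ∀ n, (X : F⟦X⟧) ^ n ∣ evalW c (thetaTerm F k a b n) := fun n => by
    have := map_dvd (evalW c) (X_pow_dvd_thetaTerm (K := F) h k n)
    rwa [map_pow, evalW_X] at this
  have hsum := hasSum_coe (f := fun n => (evalW c (thetaTerm F k a b n)).subst r)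
    (fun n => X_pow_dvd_subst hr (hd n)) (subst_lsum hr hd).symm
  rw [substL_apply, theta, evalW_lsum]
  rw [T, ← hsum.tsum_eq]
  congr 1
  funext n
  have hrL : (r : F⸨X⸩) ≠ 0 := fun h0 => hr0
    (HahnSeries.ofPowerSeries_injective (Γ := ℤ) (R := F) (by rw [map_zero]; exact h0))
  have hcL : (HahnSeries.C c.1 : F⸨X⸩) ≠ 0 := fun h0 => c.ne_zero
    (HahnSeries.C_injective (Γ := ℤ) (R := F) (by rw [h0, map_zero]))
  have hle : a * n ≤ b * tri n := mul_le_mul_tri h.le n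
  rw [← substL_apply hr, thetaTerm, map_sub, map_mul (evalW c), map_mul (evalW c), evalW_ofX, evalW_ofX, evalW_wpow, evalW_wpow,
    map_sub]
  have hX : substL hr X = (r : F⸨X⸩) := by rw [substL_apply, subst_X hs]
  have hC : ∀ x : F, substL hr (C x) = HahnSeries.C x := fun x => by
    rw [substL_apply]
    have : (C x : F⟦X⟧).subst r = C x := subst_C x
    rw [this, coe_C]
  have e1 : ((c ^ ((n : ℤ) + 1) : Fˣ) : F) = c.1 ^ (n + 1) := by
    rw [← Nat.cast_succ, zpow_natCast, Units.val_pow_eq_pow_val]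
  have e2 : ((c ^ (-(n : ℤ)) : Fˣ) : F) = (c.1 ^ n)⁻¹ := by
    rw [zpow_neg, zpow_natCast, Units.val_inv_eq_inv_val, Units.val_pow_eq_pow_val]
  have e3 : (r : F⸨X⸩) ^ (b * tri n - a * n) = (r : F⸨X⸩) ^ (b * tri n) * ((r : F⸨X⸩) ^ (a * n))⁻¹ := by
    rw [pow_sub₀ _ hrL hle]
  simp only [hC, e1, e2, map_mul, map_pow, map_add, map_neg, map_one, map_natCast, map_ofNat, hX, e3, map_inv₀]
  rw [show n * (n + 1) / 2 = tri n from rfl, mul_pow, mul_pow, ← pow_mul, ← pow_mul, ← pow_mul,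
    mul_inv, pow_add]
  ring

end Laurent

/-! ### The nome and its expansion -/

section Nome

variable {F : Type} [Field F]

lemma substL_ne_zero {r : F⟦X⟧} (hr : constantCoeff r = 0) {f : F⟦X⟧} (hf : constantCoeff f ≠ 0) :
    substL hr f ≠ 0 := fun h => by
  rw [substL_apply] at h
  have h1 : f.subst r = 0 := HahnSeries.ofPowerSeries_injective (Γ := ℤ) (R := F) (by
    rw [map_zero]; exact h)
  have h2 := constantCoeff_subst_of_zero hr f
  rw [h1, map_zero] at h2
  exact hf h2.symm

lemma substL_X {r : F⟦X⟧} (hr : constantCoeff r = 0) : substL hr X = (r : F⸨X⸩) := by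
  rw [substL_apply, subst_X (hasSubst_of_X_dvd hr)]

lemma substL_C {r : F⟦X⟧} (hr : constantCoeff r = 0) (c : F) : substL hr (C c) = HahnSeries.C c := by
  have : (C c : F⟦X⟧).subst r = C c := subst_C c
  rw [substL_apply, this, coe_C]

lemma T_pow_eq {r : F⟦X⟧} (hr : constantCoeff r = 0) (hr0 : r ≠ 0) {k a b : ℕ} (h : a < b) :
    T k ((r : F⸨X⸩) ^ a) ((r : F⸨X⸩) ^ b) = substL hr (thetaVal F k a b) := by
  have := T_eq hr hr0 1 (k := k) h
  rwa [Units.val_one, map_one, one_mul, evalW_one_theta] at this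

lemma T_one_eq {r : F⟦X⟧} (hr : constantCoeff r = 0) (hr0 : r ≠ 0) {k b : ℕ} (h : 0 < b) :
    T k 1 ((r : F⸨X⸩) ^ b) = substL hr (thetaVal F k 0 b) := by
  have := T_pow_eq hr hr0 (k := k) h
  rwa [pow_zero] at this

lemma T_C_eq {r : F⟦X⟧} (hr : constantCoeff r = 0) (hr0 : r ≠ 0) (c : Fˣ) {k b : ℕ} (h : 0 < b) :
    T k (HahnSeries.C c.1) ((r : F⸨X⸩) ^ b) = substL hr (evalW c (theta F k 0 b)) := by
  have := T_eq hr hr0 c (k := k) h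
  rwa [pow_zero, mul_one] at this

lemma constantCoeff_eq_zero_of_cube {r : F⟦X⟧} (h : constantCoeff (r ^ 3) = 0) :
    constantCoeff r = 0 := by
  rw [map_pow] at h
  exact (pow_eq_zero_iff three_ne_zero).1 h

lemma coe_X_ne_zero : ((X : F⟦X⟧) : F⸨X⸩) ≠ 0 := fun h => X_ne_zero (R := F)
  (HahnSeries.ofPowerSeries_injective (Γ := ℤ) (R := F) (by rw [map_zero]; exact h))

/-- The equation for the nome in terms of power series. -/
theorem isNome_iff (q r : ℚ⟦X⟧) :
    IsNome q r ↔ r ^ 3 = q ∧ constantCoeff r = 0 ∧ (tser ℚ).subst r = X := by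
  have key : ∀ hr : constantCoeff r = 0, r ≠ 0 → r ^ 3 = q →
      (((X : ℚ⟦X⟧) : ℚ⸨X⸩) = (r : ℚ⸨X⸩) * T 1 1 ((q : ℚ⸨X⸩) ^ 3) /
        (4 * T 0 (q : ℚ⸨X⸩) ((q : ℚ⸨X⸩) ^ 3) + 6 * T 1 (q : ℚ⸨X⸩) ((q : ℚ⸨X⸩) ^ 3)) ↔
      (tser ℚ).subst r = X) := fun hr hr0 h => by
    have hq : (q : ℚ⸨X⸩) = (r : ℚ⸨X⸩) ^ 3 := by rw [← h, map_pow]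
    have hq3 : (q : ℚ⸨X⸩) ^ 3 = (r : ℚ⸨X⸩) ^ 9 := by rw [hq, ← pow_mul]
    rw [hq3, hq, T_one_eq hr hr0 (by norm_num), T_pow_eq hr hr0 (by norm_num),
      T_pow_eq hr hr0 (by norm_num)]
    have hden : (4 * substL hr (thetaVal ℚ 0 3 9) + 6 * substL hr (thetaVal ℚ 1 3 9)) =
        substL hr (tden ℚ) := by
      rw [tden, map_add, map_mul, map_mul, map_ofNat, map_ofNat]
    have hne : substL hr (tden ℚ) ≠ 0 :=
      substL_ne_zero hr (by rw [constantCoeff_tden]; norm_num)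
    have ht := congrArg (substL hr) (tser_mul_tden (K := ℚ))
    rw [map_mul, map_mul, substL_X] at ht
    rw [hden, eq_div_iff hne, ← ht, mul_left_inj' hne, substL_apply]
    constructor
    · intro h1
      exact (HahnSeries.ofPowerSeries_injective (Γ := ℤ) (R := ℚ) h1).symm
    · intro h1
      rw [h1]
  constructor
  · rintro ⟨h1, h2, h3⟩
    have hr : constantCoeff r = 0 := constantCoeff_eq_zero_of_cube (by rw [h2, h1])
    refine ⟨h2, hr, (key hr ?_ h2).1 h3⟩
    rintro rfl
    rw [map_zero, zero_mul, zero_div] at h3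
    exact coe_X_ne_zero h3
  · rintro ⟨h1, hr, h2⟩
    refine ⟨by rw [← h1, map_pow, hr]; simp, h1, (key hr ?_ h1).2 h2⟩
    rintro rfl
    have h3 := constantCoeff_subst_of_zero hr (tser ℚ)
    obtain ⟨g, hg⟩ := X_dvd_tser (K := ℚ)
    have hs := hasSubst_of_X_dvd hr
    rw [hg, subst_mul hs, subst_X hs, zero_mul] at h2
    exact X_ne_zero h2.symm

lemma constantCoeff_tser : constantCoeff (tser ℚ) = 0 := by
  rw [tser, map_mul, constantCoeff_X, zero_mul]

lemma coeff_one_tser : coeff 1 (tser ℚ) = 1 := by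
  rw [tser, show (1 : ℕ) = 0 + 1 from rfl, coeff_succ_X_mul, coeff_zero_eq_constantCoeff_apply,
    map_mul, constantCoeff_inv, constantCoeff_der0, map_sub, map_mul, constantCoeff_der3,
    constantCoeff_val3]
  norm_num

/-- Since t = X + ⋯, it has a compositional inverse; being inverse on the left as well makes it
unique. -/
theorem existsUnique_tser_subst :
    ∃! r : ℚ⟦X⟧, constantCoeff r = 0 ∧ (tser ℚ).subst r = X := by
  have hu : IsUnit (coeff 1 (tser ℚ)) := by rw [coeff_one_tser]; exact isUnit_one
  refine ⟨(tser ℚ).substInvOfIsUnit hu, ⟨constantCoeff_substInvOfIsUnit _ _,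
    subst_substInvOfIsUnit_right _ constantCoeff_tser _⟩, ?_⟩
  rintro r ⟨hr, h⟩
  have h1 := subst_substInvOfIsUnit_left _ constantCoeff_tser hu
  have h2 := congrArg (fun f : ℚ⟦X⟧ => f.subst r) h1
  have hs := hasSubst_of_X_dvd hr
  rw [subst_comp_subst_apply (hasSubst_of_X_dvd constantCoeff_tser) hs, h, subst_X hs, X_subst] at h2
  exact h2.symm

/-- After division by X, the quotient is 2/(2 + 10X³ - 14X⁶) up to terms of order 9. -/
lemma tser_mod : (X : ℚ⟦X⟧) ^ 10 ∣ tser ℚ - (X - 5 * X ^ 4 + 32 * X ^ 7) := by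
  have hu : IsUnit (tden ℚ) := by
    rw [isUnit_iff_constantCoeff, constantCoeff_tden]
    exact isUnit_iff_ne_zero.2 two_ne_zero
  obtain ⟨a, ha⟩ := thetaVal_mod (K := ℚ) (a := 3) (by norm_num) 0
  obtain ⟨b, hb⟩ := thetaVal_mod (K := ℚ) (a := 3) (by norm_num) 1
  obtain ⟨c, hc⟩ := thetaVal_mod (K := ℚ) (a := 0) (by norm_num) 1
  have ht := tser_mul_tden (K := ℚ)
  have hden : tden ℚ = 2 + 10 * X ^ 3 - 14 * X ^ 6 + X ^ 9 * (4 * a + 6 * b - 22 * X ^ 6) := by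
    rw [tden]
    linear_combination 4 * ha + 6 * hb
  rw [← hu.dvd_mul_right]
  -- With Y = X³, (1 - 5Y + 32Y²)(2 + 10Y - 14Y²) = 2 + 390Y³ - 448Y⁴, which supplies 390 and 448;
  -- the -6 comes from the numerator.
  refine ⟨c - 6 - 390 + 448 * X ^ 3 - (1 - 5 * X ^ 3 + 32 * X ^ 6) *
    (4 * a + 6 * b - 22 * X ^ 6), ?_⟩
  rw [sub_mul, ht, hden]
  linear_combination X * hc

/-- Inverting t gives the fixed point equation r = X + 5r⁴ - 32r⁷ - ⋯, in which each substitution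
gains three orders. -/
lemma nome_expansion {r : ℚ⟦X⟧} (hr : constantCoeff r = 0) (h : (tser ℚ).subst r = X) :
    ∃ f : ℚ⟦X⟧, r ^ 3 = X ^ 3 + 15 * X ^ 6 + 279 * X ^ 9 + X ^ 12 * f := by
  obtain ⟨g, hg⟩ := tser_mod
  obtain ⟨ρ, hρ⟩ := X_dvd_iff.2 hr
  have hs := hasSubst_of_X_dvd hr
  have h1 : r = X + 5 * r ^ 4 - 32 * r ^ 7 - r ^ 10 * g.subst r := by
    have h2 : tser ℚ = X - 5 * X ^ 4 + 32 * X ^ 7 + X ^ 10 * g := by linear_combination hg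
    rw [h2, ← coe_substAlgHom hs] at h
    simp only [map_add, map_sub, map_mul, map_pow, map_ofNat, substAlgHom_X] at h
    rw [coe_substAlgHom hs] at h
    linear_combination h
  generalize g.subst r = γ at h1
  obtain ⟨a, ha⟩ : ∃ a, r = X + X ^ 4 * a := ⟨5 * ρ ^ 4 - 32 * X ^ 3 * ρ ^ 7 - X ^ 6 * ρ ^ 10 * γ, by
    rw [hρ] at h1 ⊢
    linear_combination h1⟩
  obtain ⟨b, hb⟩ : ∃ b, r = X + 5 * X ^ 4 + X ^ 7 * b :=
    ⟨5 * (4 * a + 6 * X ^ 3 * a ^ 2 + 4 * X ^ 6 * a ^ 3 + X ^ 9 * a ^ 4) - 32 * (1 + X ^ 3 * a) ^ 7 -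
      X ^ 3 * (1 + X ^ 3 * a) ^ 10 * γ, by
    rw [ha] at h1 ⊢
    linear_combination h1⟩
  -- The coefficient is 68 = 5 · 4 · 5 - 32; cubing then gives 279 = 3 · 68 + 3 · 5².
  obtain ⟨c, hc⟩ : ∃ c, r = X + 5 * X ^ 4 + 68 * X ^ 7 + X ^ 10 * c := by
    obtain ⟨v, hv⟩ : ∃ v, v = 5 + X ^ 3 * b := ⟨_, rfl⟩
    have hb' : r = X * (1 + X ^ 3 * v) := by rw [hb, hv]; ring
    refine ⟨5 * (4 * b + 6 * v ^ 2 + 4 * X ^ 3 * v ^ 3 + X ^ 6 * v ^ 4) -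
      32 * (7 * v + 21 * X ^ 3 * v ^ 2 + 35 * X ^ 6 * v ^ 3 + 35 * X ^ 9 * v ^ 4 +
        21 * X ^ 12 * v ^ 5 + 7 * X ^ 15 * v ^ 6 + X ^ 18 * v ^ 7) - (1 + X ^ 3 * v) ^ 10 * γ, ?_⟩
    rw [hb'] at h1 ⊢
    linear_combination h1 + 20 * X ^ 7 * hv
  refine ⟨3 * c + 3 * (10 * (68 + X ^ 3 * c) + X ^ 3 * (68 + X ^ 3 * c) ^ 2) +
    (5 + X ^ 3 * (68 + X ^ 3 * c)) ^ 3, ?_⟩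
  rw [hc]
  ring

end Nome

/-! ### Assembly of the formula -/

section Main

/-- The inclusion of the rational numbers in the field of rational functions. -/
abbrev incl : ℚ →+* RatFunc ℚ := algebraMap ℚ (RatFunc ℚ)

lemma X_sub_one_ne_zero : (RatFunc.X : RatFunc ℚ) - 1 ≠ 0 := by
  have e : (RatFunc.X : RatFunc ℚ) - 1 = algebraMap (Polynomial ℚ) (RatFunc ℚ) (Polynomial.X - 1) := by
    rw [map_sub, RatFunc.algebraMap_X, map_one]
  rw [e]
  refine (map_ne_zero_iff _ (RatFunc.algebraMap_injective ℚ)).2 fun h => ?_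
  simpa using congrArg (Polynomial.eval 0) h

lemma one_add_X_add_X_sq_ne_zero : 1 + (RatFunc.X : RatFunc ℚ) + RatFunc.X ^ 2 ≠ 0 := by
  have e : 1 + (RatFunc.X : RatFunc ℚ) + RatFunc.X ^ 2 =
      algebraMap (Polynomial ℚ) (RatFunc ℚ) (1 + Polynomial.X + Polynomial.X ^ 2) := by
    rw [map_add, map_add, map_pow, RatFunc.algebraMap_X, map_one]
  rw [e]
  refine (map_ne_zero_iff _ (RatFunc.algebraMap_injective ℚ)).2 fun h => ?_
  simpa using congrArg (Polynomial.eval 0) h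

theorem walkGF_formula {w₀ : ℤ × ℤ} (h : Edge w₀ 0) {r : ℚ⟦X⟧} (hr : constantCoeff r = 0)
    (ht : (tser ℚ).subst r = X) :
    ((walkGF w₀ : (RatFunc ℚ)⟦X⟧) : (RatFunc ℚ)⸨X⸩) =
      closedForm (lift X) sVar (lift (r ^ 3)) (lift r) := by
  set R : (RatFunc ℚ)⟦X⟧ := PowerSeries.map incl r with hR
  have hR0 : constantCoeff R = 0 := by
    rw [hR, ← coeff_zero_eq_constantCoeff_apply, coeff_map, coeff_zero_eq_constantCoeff_apply, hr,
      map_zero]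
  have hs := hasSubst_of_X_dvd hR0
  have htR : (tser (RatFunc ℚ)).subst R = X := by
    have h1 := congrArg (PowerSeries.map incl) ht
    rw [PowerSeries.map_X] at h1
    have h2 : PowerSeries.map incl ((tser ℚ).subst r) =
        (PowerSeries.map incl (tser ℚ)).subst (PowerSeries.map incl r) :=
      map_subst (hasSubst_of_X_dvd hr) (tser ℚ)
    rw [h2, map_tser] at h1
    exact h1
  have hRne : R ≠ 0 := fun h0 => by
    obtain ⟨g, hg⟩ := X_dvd_tser (K := RatFunc ℚ)
    rw [hg, subst_mul hs, subst_X hs, h0, zero_mul] at htR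
    exact X_ne_zero htR.symm
  -- Substituting r for X sends `tser` to t, so the identities in X become identities of Laurent
  -- series in t.
  set ψ := substL hR0 with hψ
  have ψX : ψ X = (R : (RatFunc ℚ)⸨X⸩) := substL_X hR0
  have ψt : ψ (tser (RatFunc ℚ)) = ((X : (RatFunc ℚ)⟦X⟧) : (RatFunc ℚ)⸨X⸩) := by
    rw [hψ, substL_apply, htR]
  have ψE : ψ (genCorner unitX (tser (RatFunc ℚ))) =
      ((walkGF w₀ : (RatFunc ℚ)⟦X⟧) : (RatFunc ℚ)⸨X⸩) := by
    rw [hψ, substL_apply, walkGF_eq h]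
    congr 1
    rw [genCorner, genCorner, subst_lsum hR0 (fun n => X_pow_dvd_pow_mul X_dvd_tser n _)]
    refine congrArg lsum (funext fun n => ?_)
    have hC : (C (walkVec unitX n (0, 0)) : (RatFunc ℚ)⟦X⟧).subst R =
      C (walkVec unitX n (0, 0)) := subst_C _
    rw [subst_mul hs, subst_pow hs, htR, hC]
  have ψs : ψ (C unitX.1) = sVar := substL_C hR0 _
  have hlX : lift X = ((X : (RatFunc ℚ)⟦X⟧) : (RatFunc ℚ)⸨X⸩) := by rw [lift, PowerSeries.map_X]
  have hlr : lift r = (R : (RatFunc ℚ)⸨X⸩) := rfl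
  have hlq : lift (r ^ 3) = (R : (RatFunc ℚ)⸨X⸩) ^ 3 := by
    rw [lift, map_pow, map_pow]
  have hq3 : ((R : (RatFunc ℚ)⸨X⸩) ^ 3) ^ 3 = (R : (RatFunc ℚ)⸨X⸩) ^ 9 := by rw [← pow_mul]
  rw [closedForm, hlX, hlr, hlq, hq3]
  have hT : ∀ k, T k ((R : (RatFunc ℚ)⸨X⸩) ^ 3) ((R : (RatFunc ℚ)⸨X⸩) ^ 9) =
      ψ (evalW 1 (theta (RatFunc ℚ) k 3 9)) := fun k => by
    rw [T_pow_eq hR0 hRne (by norm_num), evalW_one_theta]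
  have hT9 : ∀ k, T k 1 ((R : (RatFunc ℚ)⸨X⸩) ^ 9) = ψ (evalW 1 (theta (RatFunc ℚ) k 0 9)) :=
    fun k => by rw [T_one_eq hR0 hRne (by norm_num), evalW_one_theta]
  have hT3 : ∀ k, T k 1 ((R : (RatFunc ℚ)⸨X⸩) ^ 3) = ψ (evalW 1 (theta (RatFunc ℚ) k 0 3)) :=
    fun k => by rw [T_one_eq hR0 hRne (by norm_num), evalW_one_theta]
  have hTs : ∀ k, T k sVar ((R : (RatFunc ℚ)⸨X⸩) ^ 3) = ψ (evalW unitX (theta (RatFunc ℚ) k 0 3)) :=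
    fun k => T_C_eq hR0 hRne unitX (by norm_num)
  rw [hT, hT, hT, hT9, hT9, hT3, hT3, hTs, hTs, evalW_theta_two unitX three_pos,
    evalW_one_theta_three three_pos, evalW_one_theta_three (b := 9) (by norm_num)]
  have hmain := congrArg ψ (genCorner_eq unitX)
  have hS := congrArg (fun f => ψ (evalW 1 f))
    (theta_one_sq_sub (K := RatFunc ℚ) (a := 3) (b := 9) (by norm_num) (by norm_num))
  have hv : evalW 1 (theta (RatFunc ℚ) 0 3 9) = val3 (RatFunc ℚ) := rfl
  have hd : evalW 1 (theta (RatFunc ℚ) 1 0 9) = 2 * der0 (RatFunc ℚ) := by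
    rw [evalW_one_theta, two_mul_der0]
  rw [hv, hd]
  simp only [map_mul, map_add, map_sub, map_pow, map_one, map_ofNat, ψE, ψs, ψt, ψX, hv] at hmain hS ⊢
  have nv : ψ (val3 (RatFunc ℚ)) ≠ 0 :=
    substL_ne_zero hR0 (by rw [constantCoeff_val3]; exact neg_ne_zero.2 one_ne_zero)
  have nd : ψ (der0 (RatFunc ℚ)) ≠ 0 :=
    substL_ne_zero hR0 (by rw [constantCoeff_der0]; exact one_ne_zero)
  have n3 : ψ (evalW 1 (theta (RatFunc ℚ) 1 0 3)) ≠ 0 := by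
    refine substL_ne_zero hR0 ?_
    rw [evalW_one_theta, thetaVal, constantCoeff_lsum]
    simp [tri, one_add_one_eq_two, map_ofNat (constantCoeff (R := RatFunc ℚ)) 2]
  have ns : ψ (evalW unitX (theta (RatFunc ℚ) 0 0 3)) ≠ 0 := by
    refine substL_ne_zero hR0 ?_
    rw [evalW, ← coeff_zero_eq_constantCoeff_apply, coeff_map, coeff_zero_eq_constantCoeff_apply,
      constantCoeff_theta, pow_zero, mul_one, map_sub, map_one, LaurentPolynomial.eval₂_T, zpow_one]
    exact X_sub_one_ne_zero
  have nX : ((X : (RatFunc ℚ)⟦X⟧) : (RatFunc ℚ)⸨X⸩) ≠ 0 := coe_X_ne_zero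
  have nR : (R : (RatFunc ℚ)⸨X⸩) ≠ 0 := fun h0 => hRne
    (HahnSeries.ofPowerSeries_injective (Γ := ℤ) (R := RatFunc ℚ) (by rw [map_zero]; exact h0))
  have nq : 1 + sVar + sVar ^ 2 ≠ 0 := by
    have e : 1 + sVar + sVar ^ 2 = HahnSeries.C (1 + RatFunc.X + RatFunc.X ^ 2) := by
      rw [map_add, map_add, map_pow, map_one]; rfl
    rw [e, map_ne_zero_iff _ HahnSeries.C_injective]
    exact one_add_X_add_X_sq_ne_zero
  have hchar : CharZero (RatFunc ℚ)⸨X⸩ :=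
    charZero_of_injective_ringHom (f := HahnSeries.C) (HahnSeries.C_injective (Γ := ℤ))
  generalize ψ (val3 (RatFunc ℚ)) = v at *
  generalize ψ (der0 (RatFunc ℚ)) = d at *
  generalize ψ (evalW 1 (theta (RatFunc ℚ) 1 0 3)) = z3 at *
  generalize ψ (evalW unitX (theta (RatFunc ℚ) 0 0 3)) = zs at *
  generalize ψ (evalW 1 (theta (RatFunc ℚ) 1 3 9)) = p1 at *
  generalize ψ (evalW 1 (theta (RatFunc ℚ) 2 3 9)) = p2 at *
  generalize ψ (evalW 1 (weierstrass (RatFunc ℚ) 3 9)) = S at *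
  generalize ψ (lambertL unitX 3) = L at *
  generalize ψ (lambertP (RatFunc ℚ) 3) = P3 at *
  generalize ψ (lambertP (RatFunc ℚ) 9) = P9 at *
  -- The constants -1/2 + 1/6 + 1/3 cancel, and so do the contributions 4 `P3` and -4 `P3`.
  have hb : p1 ^ 2 / v ^ 2 - p2 / v - zs * (1 - 8 * (P3 + L)) / (2 * zs) +
      z3 * (1 - 24 * P3) / (6 * z3) + 2 * d * (1 - 24 * P9) / (3 * (2 * d)) =
      4 * (S + L - 2 * P9) := by
    have e1 : p1 ^ 2 / v ^ 2 - p2 / v = 4 * S := by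
      field_simp
      linear_combination hS
    rw [e1]
    field_simp
    ring
  rw [hb]
  field_simp
  linear_combination 4 * hmain

end Main

end Kreweras

end

theorem theorem2 (w₀ : ℤ × ℤ) (hw₀ : Kreweras.Edge w₀ 0) :
    (∃! q : PowerSeries ℚ, ∃ r : PowerSeries ℚ, Kreweras.IsNome q r) ∧
    ∀ q r : PowerSeries ℚ, Kreweras.IsNome q r →
      (∃ f : PowerSeries ℚ, q = PowerSeries.X ^ 3 + 15 * PowerSeries.X ^ 6 +
        279 * PowerSeries.X ^ 9 + PowerSeries.X ^ 12 * f) ∧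
      ((Kreweras.walkGF w₀ : PowerSeries (RatFunc ℚ)) : LaurentSeries (RatFunc ℚ)) =
        Kreweras.closedForm (Kreweras.lift PowerSeries.X) Kreweras.sVar
          (Kreweras.lift q) (Kreweras.lift r) := by
  obtain ⟨r₀, ⟨hr₀, ht₀⟩, huniq⟩ := Kreweras.existsUnique_tser_subst
  refine ⟨⟨r₀ ^ 3, ⟨r₀, (Kreweras.isNome_iff _ _).2 ⟨rfl, hr₀, ht₀⟩⟩, fun q ⟨r, h⟩ => ?_⟩,
    fun q r h => ?_⟩
  · obtain ⟨h1, h2, h3⟩ := (Kreweras.isNome_iff q r).1 h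
    rw [← h1, huniq r ⟨h2, h3⟩]
  · obtain ⟨rfl, h2, h3⟩ := (Kreweras.isNome_iff q r).1 h
    exact ⟨Kreweras.nome_expansion h2 h3, Kreweras.walkGF_formula hw₀ h2 h3⟩
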